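/- Let $\mathbb{N}=\{0,1,2,\dots\}$, let $P,Q\in\mathbb{R}(x)$ have no zeros and no poles in $\mathbb{N}$, and suppose $P(n)>0$ for all sufficiently large $n\in\mathbb N$. A sequence $f\in\mathbb{R}^{\mathbb{N}}$ is *$(P,Q)$-holonomic* if $f(n+2)=P(n)f(n+1)+Q(n)f(n)$ for all $n\in\mathbb{N}$; its *initial value* is $(f(0),f(1))$. A sequence $f$ has the *ultimate sign* $s=(s_0,\dots,s_{\tau-1})\in\{+,-,0\}^\tau$ ($\tau\ge 1$) if $\operatorname{sgn} f(n)=s_{n\bmod \tau}$ for all sufficiently large $n$; the ultimate sign of a rational function is that of its sequence of values on $\mathbb{N}$. Let $I(s)\subseteq\mathbb{R}^2\setminus\{0\}$ be the set of non-zero initial values of $(P,Q)$-holonomic sequences with ultimate sign $s$, and let $p:\mathbb{R}^2\setminus\{0\}\to S^1$, $p(v)=v/\|v\|$. Put $R(x)=\frac{Q(x)}{P(x)P(x-1)}$ and let $d=\deg R\in\mathbb{Z}$ (degree of numerator minus degree of denominator). If $d\le 0$, let $\alpha_0,\alpha_1,\alpha_2\in\mathbb R$ be given by $R(x)=\alpha_0+\frac{\alpha_1}{x}+\frac{\alpha_2}{x^2}+O(x^{-3})$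 as $x\to\infty$. The pair $(P,Q)$ is said to be * of *$\infty$-$O$ loxodromic type* if $R$ has ultimate sign $(+)$ and $d>2$; * of *$\infty$-$\Omega$ loxodromic type* if $R$ has ultimate sign $(+)$ and $d\le 2$; * of *hyperbolic type* if $R$ has ultimate sign $(-)$, $d\le 0$ and $(\alpha_0,\alpha_1,\alpha_2)\ge(-\frac14,0,-\frac1{16})$ lexicographically; * of *$\theta$-$O$ elliptic type*, for a rational $0<\theta<\frac12$, if $R$ has ultimate sign $(-)$, $d\le 0$, $(\alpha_0,\alpha_1,\alpha_2)<(-\frac14,0,-\frac1{16})$ lexicographically, $\alpha_0=-\frac{1}{4\cos^2\theta\pi}$ and $\alpha_1=0$; * of *$\frac12$-$O$ elliptic type* if $R$ has ultimate sign $(-)$ and $d>2$; * of *$\mathbb{Q}$-$\Omega$ elliptic type* if $R$ has ultimate sign $(-)$ and either $d\in\{1,2\}$, or $d\le 0$, $(\alpha_0,\alpha_1,\alpha_2)<(-\frac14,0,-\frac1{16})$ lexicographically and, writing $\alpha_0=-\frac1{4\cos^2\theta\pi}$ with $\theta\in[0,\frac12)$ real, it is not the case that $\theta$ is a positive rational number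 and $\alpha_1=0$. Then the following hold. 1. If $(P,Q)$ is of $\infty$-$O$ loxodromic type, $S^1$ is partitioned into the closed intervals $p(I(+,-))$, $p(I(-,+))$, which have non-empty interiors, and the non-empty open intervals $p(I(+))$, $p(I(-))$. 2. If $(P,Q)$ is of $\infty$-$\Omega$ loxodromic type, $S^1$ is partitioned into the singletons $p(I(+,-))$, $p(I(-,+))$ and the non-empty open intervals $p(I(+))$, $p(I(-))$. 3. If $(P,Q)$ is of hyperbolic type, $S^1$ is partitioned into the half-open intervals $p(I(+))$, $p(I(-))$. 4. If $(P,Q)$ is of $\frac kr$-$O$ elliptic type, where $k,r$ are coprime positive integers, let for $j=0,\dots,2r-1$ $$s_j=\Bigl(\operatorname{sgn}\sin\tfrac{(j-ik+\frac12)\pi}{r}\Bigr)_{i=0,\dots,(k\bmod 2)r+r-1},\qquad t_j=\Bigl(\operatorname{sgn}\sin\tfrac{(j-ik)\pi}{r}\Bigr)_{i=0,\dots,(k\bmod 2)r+r-1}.$$ * If $R$ is constant, $S^1$ is partitioned into $p(I(t_0)),p(I(s_0)),\dots,p(I(t_{2r-1})),p(I(s_{2r-1}))$, arranged in this order (clockwise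 or anticlockwise), where the $p(I(t_j))$ are singletons and the $p(I(s_j))$ are non-empty open intervals. * Otherwise, $S^1$ is partitioned into the non-empty half-open intervals $p(I(s_0)),\dots,p(I(s_{2r-1}))$, arranged in this order (clockwise or anticlockwise). For each $j=0,\dots,2r-1$ (with $s_{2r}=s_0$), the closures of $p(I(s_j))$ and $p(I(s_{j+1}))$ meet in exactly one point, which belongs to $p(I(s_{j+1}))$ if $R$ is eventually increasing (that is, strictly increasing on some $[N,\infty)$) and to $p(I(s_j))$ if $R$ is eventually decreasing. 5. If $(P,Q)$ is of $\mathbb{Q}$-$\Omega$ elliptic type, no non-zero $(P,Q)$-holonomic sequence has an ultimate sign. -/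

import Mathlib

open Filter Asymptotics

noncomputable section

namespace HolonomicSign

/-! ### Rational functions -/

/-- The value at `x` of a rational function, meaningful when `x` is not a pole. -/
def val (R : RatFunc ℝ) (x : ℝ) : ℝ := R.eval (RingHom.id ℝ) x

/-- No zeros and no poles in `ℕ = {0, 1, 2, …}` (numerator and denominator are coprime). -/
def NoZerosOrPoles (R : RatFunc ℝ) : Prop :=
  ∀ n : ℕ, R.num.eval (n : ℝ) ≠ 0 ∧ R.denom.eval (n : ℝ) ≠ 0

/-- The rational function `R(x - 1)`. -/
def shift (R : RatFunc ℝ) : RatFunc ℝ :=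
  algebraMap (Polynomial ℝ) (RatFunc ℝ) (R.num.comp (Polynomial.X - 1)) /
    algebraMap (Polynomial ℝ) (RatFunc ℝ) (R.denom.comp (Polynomial.X - 1))

/-- The rational function `Q(x) / (P(x) P(x - 1))`. -/
def normQ (P Q : RatFunc ℝ) : RatFunc ℝ := Q / (P * shift P)

def IsConstant (R : RatFunc ℝ) : Prop := ∃ c : ℝ, R = RatFunc.C c

def EventuallyIncreasing (R : RatFunc ℝ) : Prop := ∃ N : ℝ, StrictMonoOn (val R) (Set.Ici N)

def EventuallyDecreasing (R : RatFunc ℝ) : Prop := ∃ N : ℝ, StrictAntiOn (val R) (Set.Ici N)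

/-! ### Ultimate signs -/

/-- `f` has the ultimate sign `s = (s₀, …, s_{τ-1})`: for some `N`, the sign of `f n` is
`s_{n mod τ}` for all `n ≥ N`. Here `s[i]?` is `some sᵢ` if `i < τ` and `none` otherwise,
so the empty word is never an ultimate sign. -/
def HasUltimateSign (f : ℕ → ℝ) (s : List SignType) : Prop :=
  ∃ N : ℕ, ∀ n ≥ N, s[n % s.length]? = some (SignType.sign (f n))

/-- The ultimate sign of a rational function is that of its sequence of values at `n ∈ ℕ`. -/
def RatHasUltimateSign (R : RatFunc ℝ) (s : List SignType) : Prop :=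
  HasUltimateSign (fun n => val R n) s

/-- `f` is `(P, Q)`-holonomic. -/
def IsHolonomic (P Q : RatFunc ℝ) (f : ℕ → ℝ) : Prop :=
  ∀ n : ℕ, f (n + 2) = val P n * f (n + 1) + val Q n * f n

/-! ### The types of pairs `(P, Q)` -/

/-- `R(x) = α₀ + α₁ / x + α₂ / x² + O(x⁻³)` as `x → ∞`. -/
def HasExpansion (R : RatFunc ℝ) (α₀ α₁ α₂ : ℝ) : Prop :=
  (fun x : ℝ => val R x - (α₀ + α₁ / x + α₂ / x ^ 2)) =O[atTop] fun x : ℝ => x ^ (-3 : ℤ)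

/-- `(α₀, α₁, α₂) ≥ (-1/4, 0, -1/16)` in lexicographic order. -/
def LexGe (α₀ α₁ α₂ : ℝ) : Prop :=
  toLex ((-(1 / 4) : ℝ), toLex ((0 : ℝ), (-(1 / 16) : ℝ))) ≤ toLex (α₀, toLex (α₁, α₂))

def IsInftyOLoxodromic (P Q : RatFunc ℝ) : Prop :=
  RatHasUltimateSign (normQ P Q) [1] ∧ 2 < (normQ P Q).intDegree

def IsInftyOmegaLoxodromic (P Q : RatFunc ℝ) : Prop :=
  RatHasUltimateSign (normQ P Q) [1] ∧ (normQ P Q).intDegree ≤ 2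

def IsHyperbolic (P Q : RatFunc ℝ) : Prop :=
  RatHasUltimateSign (normQ P Q) [-1] ∧ (normQ P Q).intDegree ≤ 0 ∧
    ∃ α₀ α₁ α₂ : ℝ, HasExpansion (normQ P Q) α₀ α₁ α₂ ∧ LexGe α₀ α₁ α₂

/-- `(P, Q)` is of `θ`-`O` elliptic type; `0 < θ < 1/2` in the first case and `θ = 1/2` in the
second one. -/
def IsOElliptic (P Q : RatFunc ℝ) (θ : ℚ) : Prop :=
  RatHasUltimateSign (normQ P Q) [-1] ∧
    (((normQ P Q).intDegree ≤ 0 ∧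
        ∃ α₀ α₁ α₂ : ℝ, HasExpansion (normQ P Q) α₀ α₁ α₂ ∧ ¬ LexGe α₀ α₁ α₂ ∧
          0 < θ ∧ θ < 1 / 2 ∧ α₀ = -(1 / (4 * Real.cos ((θ : ℝ) * Real.pi) ^ 2)) ∧ α₁ = 0) ∨
      (2 < (normQ P Q).intDegree ∧ θ = 1 / 2))

def IsQOmegaElliptic (P Q : RatFunc ℝ) : Prop :=
  RatHasUltimateSign (normQ P Q) [-1] ∧
    ((normQ P Q).intDegree = 1 ∨ (normQ P Q).intDegree = 2 ∨
      ((normQ P Q).intDegree ≤ 0 ∧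
        ∃ α₀ α₁ α₂ : ℝ, HasExpansion (normQ P Q) α₀ α₁ α₂ ∧ ¬ LexGe α₀ α₁ α₂ ∧
          ∃ θ : ℝ, 0 ≤ θ ∧ θ < 1 / 2 ∧ α₀ = -(1 / (4 * Real.cos (θ * Real.pi) ^ 2)) ∧
            ¬ ((∃ q : ℚ, 0 < q ∧ θ = q) ∧ α₁ = 0)))

/-! ### Initial values on the circle -/

/-- The unit circle `S¹` in `ℝ²`. -/
def unitCircle : Set (ℝ × ℝ) := {v | v.1 ^ 2 + v.2 ^ 2 = 1}

/-- The projection `p : ℝ² ∖ {0} → S¹`, `(x, y) ↦ (x, y) / √(x² + y²)`. -/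
def proj (v : ℝ × ℝ) : ℝ × ℝ :=
  (v.1 / Real.sqrt (v.1 ^ 2 + v.2 ^ 2), v.2 / Real.sqrt (v.1 ^ 2 + v.2 ^ 2))

/-- `I_{P,Q}(s)`: the non-zero initial values of the `(P, Q)`-holonomic sequences with ultimate
sign `s`. -/
def initialValues (P Q : RatFunc ℝ) (s : List SignType) : Set (ℝ × ℝ) :=
  {v | v ≠ 0 ∧ ∃ f : ℕ → ℝ, IsHolonomic P Q f ∧ (f 0, f 1) = v ∧ HasUltimateSign f s}

/-- `p(I_{P,Q}(s))`. -/
def pI (P Q : RatFunc ℝ) (s : List SignType) : Set (ℝ × ℝ) := proj '' initialValues P Q s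

/-- The point of `S¹` at angle `θ`. -/
def circlePoint (θ : ℝ) : ℝ × ℝ := (Real.cos θ, Real.sin θ)

/-- A non-empty open interval on `S¹` (not the whole circle). -/
def IsOpenArc (A : Set (ℝ × ℝ)) : Prop :=
  ∃ a b : ℝ, a < b ∧ b ≤ a + 2 * Real.pi ∧ A = circlePoint '' Set.Ioo a b

/-- A closed interval on `S¹` with non-empty interior (not the whole circle). -/
def IsClosedArc (A : Set (ℝ × ℝ)) : Prop :=
  ∃ a b : ℝ, a < b ∧ b < a + 2 * Real.pi ∧ A = circlePoint '' Set.Icc a b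

/-- A non-empty half-open interval on `S¹` (not the whole circle). -/
def IsHalfOpenArc (A : Set (ℝ × ℝ)) : Prop :=
  ∃ a b : ℝ, a < b ∧ b < a + 2 * Real.pi ∧
    (A = circlePoint '' Set.Ico a b ∨ A = circlePoint '' Set.Ioc a b)

def IsSingleton (A : Set (ℝ × ℝ)) : Prop := ∃ v, A = {v}

/-- `S¹` is the disjoint union of `A 0, …, A (m - 1)`. -/
def PartitionsCircle {m : ℕ} (A : Fin m → Set (ℝ × ℝ)) : Prop :=
  Pairwise (Function.onFun Disjoint A) ∧ ⋃ i, A i = unitCircle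

/-- `A 0, …, A (m - 1)` lie on `S¹` in this order, anticlockwise (`ε = 1`) or clockwise
(`ε = -1`): measuring angles in that direction, the sets can be lifted to sets of angles
`L 0 < L 1 < … < L (m - 1)` that together stay within less than one full turn. -/
def ArrangedInOrder {m : ℕ} (A : Fin m → Set (ℝ × ℝ)) : Prop :=
  ∃ ε : ℝ, (ε = 1 ∨ ε = -1) ∧ ∃ L : Fin m → Set ℝ,
    (∀ i, A i = (fun θ => circlePoint (ε * θ)) '' L i) ∧
    (∀ i j, i < j → ∀ x ∈ L i, ∀ y ∈ L j, x < y) ∧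
    (∀ i j, ∀ x ∈ L i, ∀ y ∈ L j, y - x < 2 * Real.pi)

/-! ### The ultimate signs in the elliptic case -/

/-- `s_j = (sgn sin ((j - ik + 0.5)π/r))`, `i = 0, …, (k mod 2) r + r - 1`. -/
def sWord (k r j : ℕ) : List SignType :=
  (List.range ((k % 2) * r + r)).map fun i =>
    SignType.sign (Real.sin (((j : ℝ) - (i : ℝ) * (k : ℝ) + 1 / 2) / (r : ℝ) * Real.pi))

/-- `t_j = (sgn sin ((j - ik)π/r))`, `i = 0, …, (k mod 2) r + r - 1`. -/
def tWord (k r j : ℕ) : List SignType :=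
  (List.range ((k % 2) * r + r)).map fun i =>
    SignType.sign (Real.sin (((j : ℝ) - (i : ℝ) * (k : ℝ)) / (r : ℝ) * Real.pi))

/-- The family `p(I(s_0)), …, p(I(s_{2r-1}))`. -/
def sSets (P Q : RatFunc ℝ) (k r : ℕ) : Fin (2 * r) → Set (ℝ × ℝ) :=
  fun j => pI P Q (sWord k r j)

/-- The family `p(I(t_0)), p(I(s_0)), p(I(t_1)), p(I(s_1)), …, p(I(t_{2r-1})), p(I(s_{2r-1}))`. -/
def tsSets (P Q : RatFunc ℝ) (k r : ℕ) : Fin (4 * r) → Set (ℝ × ℝ) :=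
  fun i => if (i : ℕ) % 2 = 0 then pI P Q (tWord k r ((i : ℕ) / 2))
    else pI P Q (sWord k r ((i : ℕ) / 2))

end HolonomicSign

end

noncomputable section

namespace HolonomicSign

open Topology

/-! ### Values of rational functions at infinity -/

/-! A holonomic sequence depends linearly and injectively on its initial value, and neither a
positive rescaling of its terms nor one of the initial value changes signs. Since `P` is eventually
positive, dividing by products of its values turns the recurrence into `g(n+2) = g(n+1) + R(n) g(n)`
for large `n` (`exists_normalForm`). For each type, linear coordinates on the plane of initial
values are found in which the direction alone decides the signs. A linear isomorphism acts on
directions by a homeomorphism of the circle, so arcs in those coordinates are arcs of initial values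
(`partition_of_classification`). Only the classification in the good coordinates is left.

A second rescaling replaces `R` by its sign: there are `b n > 0` with `b n * b (n+1) * |R(n+1)| = 1`
eventually and `b n` of order `n^(-d/2)` (`exists_balanced`). The recurrence becomes `h(n+2) = b n *
h(n+1) ± h(n)`, and `b` is summable if and only if `d > 2`.

Loxodromic types (sign `+`). The quotients of two basic solutions increase along odd indices and
decrease along even ones, to limits `β ≤ α`. These coincide if and only if `b` is not summable
(`exists_alternating_limits`). The directions between the two limits give alternating signs; the
others give a constant sign.

Hyperbolic type. The Riccati inequality `-R(n) ≤ y(n) (1 - y(n+1))` has the positive solution `y(n)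
= 1/2 + 1/(4n) + c/n²`. It yields a positive solution of the recurrence, and positivity of all the
others is then a lexicographic condition on two coordinates (`exists_lex_coordinates`), which
describes a half-open half circle.

Elliptic types. The limiting recurrence rotates the plane by `θ` at each step. In a frame that
rotates along, a solution becomes a complex vector `W n` with small increments proportional to `δ
n`, where `δ n` is `R(n) - α₀` or `b n` (`IsRotationForm`), and the sign of the term is that of `Im
(W n e^{-inθ})`. Averaged over a period of the frame, the increment is a rotation with angular speed
a positive multiple of `δ n` (`IsRotating.drift`). If `δ` is summable, `W n` tends to a non-zero
limit. A limit strictly inside a sector of angle `π/r` gives the word `s_j`. A limit on a boundary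
ray is approached from the side opposite to the rotation, which makes the arcs half-open and selects
the end by the sign of `δ`; if `δ = 0` the ray itself is occupied and gives `t_j`.

An ultimate sign would give an eventual period of the signs. For rational `θ/π` and `|δ n| ≥ c/n`
this would confine `W n`, sampled along a common period, to a half plane while its total rotation
diverges. For irrational `θ/π` the frame turns through both signs before `W n` has moved noticeably.
In the remaining case `α₀ = -1/4` the Riccati equation shows that no solution stays positive, while
a solution that becomes positive stays so for longer than any prescribed period. -/

theorem val_eq_div (R : RatFunc ℝ) (x : ℝ) : val R x = R.num.eval x / R.denom.eval x := by
  simp [val, RatFunc.eval, Polynomial.eval₂_id]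

theorem eventually_eval_ne_zero {p : Polynomial ℝ} (hp : p ≠ 0) : ∀ᶠ x in atTop, p.eval x ≠ 0 :=
  p.eventually_atTop_not_isRoot hp

theorem eventually_val_div (p : Polynomial ℝ) {q : Polynomial ℝ} (hq : q ≠ 0) :
    ∀ᶠ x in atTop, val (algebraMap (Polynomial ℝ) (RatFunc ℝ) p /
      algebraMap (Polynomial ℝ) (RatFunc ℝ) q) x = p.eval x / q.eval x := by
  set R := algebraMap (Polynomial ℝ) (RatFunc ℝ) p / algebraMap (Polynomial ℝ) (RatFunc ℝ) q with hR
  have hq' : algebraMap (Polynomial ℝ) (RatFunc ℝ) q ≠ 0 := RatFunc.algebraMap_ne_zero hq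
  have hd' : algebraMap (Polynomial ℝ) (RatFunc ℝ) R.denom ≠ 0 :=
    RatFunc.algebraMap_ne_zero R.denom_ne_zero
  have h1 : R.num * q = p * R.denom := by
    apply RatFunc.algebraMap_injective ℝ
    rw [map_mul, map_mul]
    have h2 := R.num_div_denom
    rw [div_eq_iff hd'] at h2
    rw [h2, hR]
    field_simp
  filter_upwards [eventually_eval_ne_zero hq, eventually_eval_ne_zero R.denom_ne_zero] with x h3 h4
  rw [val_eq_div, div_eq_div_iff h4 h3, ← Polynomial.eval_mul, ← Polynomial.eval_mul, h1]

theorem eventually_val_mul (R S : RatFunc ℝ) :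
    ∀ᶠ x in atTop, val (R * S) x = val R x * val S x := by
  have h := eventually_val_div (R.num * S.num) (mul_ne_zero R.denom_ne_zero S.denom_ne_zero)
  rw [map_mul, map_mul, mul_div_mul_comm, R.num_div_denom, S.num_div_denom] at h
  filter_upwards [h] with x hx
  rw [hx, val_eq_div, val_eq_div, Polynomial.eval_mul, Polynomial.eval_mul, mul_div_mul_comm]

theorem eventually_val_div' (R S : RatFunc ℝ) (hS : S ≠ 0) :
    ∀ᶠ x in atTop, val (R / S) x = val R x / val S x := by
  have hS' : S.num ≠ 0 := RatFunc.num_ne_zero hS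
  have h := eventually_val_div (R.num * S.denom) (mul_ne_zero R.denom_ne_zero hS')
  rw [map_mul, map_mul, mul_div_mul_comm, R.num_div_denom, ← inv_div (algebraMap _ _ S.num),
    S.num_div_denom, ← div_eq_mul_inv] at h
  filter_upwards [h] with x hx
  rw [hx, val_eq_div, val_eq_div, Polynomial.eval_mul, Polynomial.eval_mul, div_div_div_eq]

theorem eventually_val_sub_C (R : RatFunc ℝ) (a : ℝ) :
    ∀ᶠ x in atTop, val (R - RatFunc.C a) x = val R x - a := by
  have h := eventually_val_div (R.num - Polynomial.C a * R.denom) R.denom_ne_zero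
  have hd' : algebraMap (Polynomial ℝ) (RatFunc ℝ) R.denom ≠ 0 :=
    RatFunc.algebraMap_ne_zero R.denom_ne_zero
  rw [map_sub, map_mul, sub_div, mul_div_assoc, div_self hd', mul_one, R.num_div_denom,
    RatFunc.algebraMap_C] at h
  filter_upwards [h, eventually_eval_ne_zero R.denom_ne_zero] with x hx h2
  rw [hx, val_eq_div, Polynomial.eval_sub, Polynomial.eval_mul, Polynomial.eval_C]
  field_simp

theorem eventually_val_shift (R : RatFunc ℝ) :
    ∀ᶠ x in atTop, val (shift R) x = val R (x - 1) := by
  have hX : (Polynomial.X - 1 : Polynomial ℝ) = Polynomial.X - Polynomial.C 1 := by simp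
  have hq : R.denom.comp (Polynomial.X - 1) ≠ 0 := by
    intro h
    rw [hX] at h
    apply R.denom_ne_zero
    have := Polynomial.comp_eq_zero_iff.1 h
    rcases this with h | ⟨_, h⟩
    · exact h
    · have := congrArg (fun p => Polynomial.coeff p 1) h
      simp [Polynomial.coeff_one] at this
  filter_upwards [eventually_val_div (R.num.comp (Polynomial.X - 1)) hq] with x hx
  rw [shift, hx, val_eq_div]
  simp [Polynomial.eval_comp]

theorem shift_ne_zero {R : RatFunc ℝ} (hR : R ≠ 0) : shift R ≠ 0 := by
  intro h
  have h1 := eventually_val_shift R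
  have h2 : ∀ᶠ x : ℝ in atTop, R.num.eval (x - 1) ≠ 0 ∧ R.denom.eval (x - 1) ≠ 0 := by
    have h3 : Tendsto (fun x : ℝ => x - 1) atTop atTop := tendsto_atTop_add_const_right _ _ tendsto_id
    exact h3.eventually ((eventually_eval_ne_zero (RatFunc.num_ne_zero hR)).and
      (eventually_eval_ne_zero R.denom_ne_zero))
  obtain ⟨x, h1, h2⟩ := (h1.and h2).exists
  rw [h, val_eq_div, val_eq_div] at h1
  simp only [RatFunc.num_zero, Polynomial.eval_zero, zero_div] at h1
  exact div_ne_zero h2.1 h2.2 h1.symm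

theorem eventually_val_ne_zero {R : RatFunc ℝ} (hR : R ≠ 0) : ∀ᶠ x in atTop, val R x ≠ 0 := by
  filter_upwards [eventually_eval_ne_zero (RatFunc.num_ne_zero hR),
    eventually_eval_ne_zero R.denom_ne_zero] with x h1 h2
  rw [val_eq_div]
  exact div_ne_zero h1 h2

theorem eventually_val_normQ {P Q : RatFunc ℝ} (hP : P ≠ 0) :
    ∀ᶠ x in atTop, val (normQ P Q) x = val Q x / (val P x * val P (x - 1)) := by
  filter_upwards [eventually_val_div' Q (P * shift P) (mul_ne_zero hP (shift_ne_zero hP)),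
    eventually_val_mul P (shift P), eventually_val_shift P] with x h1 h2 h3
  rw [normQ, h1, h2, h3]

/-- The rational function in the local coordinate `1 / x` at infinity, divided by its leading
power. -/
def atInfinity (R : RatFunc ℝ) (t : ℝ) : ℝ := R.num.reverse.eval t / R.denom.reverse.eval t

theorem eval_eq_pow_mul_reverse (p : Polynomial ℝ) {x : ℝ} (hx : x ≠ 0) :
    p.eval x = x ^ p.natDegree * p.reverse.eval (1 / x) := by
  have := invertibleOfNonzero hx
  have h := Polynomial.eval₂_reverse_mul_pow (RingHom.id ℝ) x p
  rw [Polynomial.eval₂_id, Polynomial.eval₂_id, invOf_eq_inv] at h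
  rw [← h, one_div, mul_comm]

theorem val_eq_zpow_mul (R : RatFunc ℝ) {x : ℝ} (hx : x ≠ 0) :
    val R x = x ^ R.intDegree * atInfinity R (1 / x) := by
  rw [val_eq_div, eval_eq_pow_mul_reverse _ hx, eval_eq_pow_mul_reverse _ hx, atInfinity,
    RatFunc.intDegree, zpow_sub₀ hx, zpow_natCast, zpow_natCast, mul_div_mul_comm]

theorem reverse_eval_zero_ne_zero {p : Polynomial ℝ} (hp : p ≠ 0) : p.reverse.eval 0 ≠ 0 := by
  rw [← Polynomial.coeff_zero_eq_eval_zero, Polynomial.coeff_zero_reverse]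
  exact Polynomial.leadingCoeff_ne_zero.2 hp

theorem atInfinity_zero_ne_zero {R : RatFunc ℝ} (hR : R ≠ 0) : atInfinity R 0 ≠ 0 :=
  div_ne_zero (reverse_eval_zero_ne_zero (RatFunc.num_ne_zero hR))
    (reverse_eval_zero_ne_zero R.denom_ne_zero)

theorem polynomial_contDiffAt (p : Polynomial ℝ) {x : ℝ} : ContDiffAt ℝ 1 (fun t => p.eval t) x := by
  simpa using (p.contDiff_aeval (𝕜 := ℝ) (R := ℝ) 1).contDiffAt (x := x)

theorem contDiffAt_atInfinity (R : RatFunc ℝ) : ContDiffAt ℝ 1 (atInfinity R) 0 := by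
  apply ContDiffAt.div
  · exact polynomial_contDiffAt _
  · exact polynomial_contDiffAt _
  · exact reverse_eval_zero_ne_zero R.denom_ne_zero

theorem tendsto_one_div_atTop : Tendsto (fun x : ℝ => 1 / x) atTop (𝓝 0) := by
  simpa using tendsto_inv_atTop_zero (𝕜 := ℝ)

theorem tendsto_val_div_zpow (R : RatFunc ℝ) :
    Tendsto (fun x => val R x / x ^ R.intDegree) atTop (𝓝 (atInfinity R 0)) := by
  have h := (contDiffAt_atInfinity R).continuousAt.tendsto.comp tendsto_one_div_atTop
  refine h.congr' ?_
  filter_upwards [eventually_gt_atTop 0] with x hx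
  rw [val_eq_zpow_mul R hx.ne']
  have : x ^ R.intDegree ≠ 0 := zpow_ne_zero _ hx.ne'
  simp only [Function.comp]
  field_simp

/-- `atInfinity R` is `C¹` and non-zero at `0`, hence so is its logarithm near `0`. `Real.log` is
the logarithm of the absolute value, so the sign of `R` plays no role. -/
theorem exists_log_atInfinity_lipschitz {R : RatFunc ℝ} (hR : R ≠ 0) :
    ∃ K : ℝ, 0 ≤ K ∧ ∃ ε > 0, ∀ s t : ℝ, |s| < ε → |t| < ε →
      |Real.log (atInfinity R s) - Real.log (atInfinity R t)| ≤ K * |s - t| := by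
  have h : ContDiffAt ℝ 1 (fun t => Real.log (atInfinity R t)) 0 :=
    (contDiffAt_atInfinity R).log (atInfinity_zero_ne_zero hR)
  obtain ⟨K, t, ht, hL⟩ := h.exists_lipschitzOnWith
  obtain ⟨ε, hε, hb⟩ := Metric.mem_nhds_iff.1 ht
  refine ⟨K, K.2, ε, hε, fun s t hs ht => ?_⟩
  have := hL.dist_le_mul s (hb (by simpa using hs)) t (hb (by simpa using ht))
  simpa [Real.dist_eq] using this

theorem eventually_log_val {R : RatFunc ℝ} (hR : R ≠ 0) :
    ∀ᶠ n : ℕ in atTop, Real.log (val R n) =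
      R.intDegree * Real.log n + Real.log (atInfinity R (1 / n)) := by
  have h := (tendsto_natCast_atTop_atTop (R := ℝ)).eventually (eventually_val_ne_zero hR)
  filter_upwards [h, eventually_gt_atTop 0] with n h1 h2
  have h2' : (n : ℝ) ≠ 0 := by positivity
  rw [val_eq_zpow_mul R h2'] at h1 ⊢
  rw [Real.log_mul (left_ne_zero_of_mul h1) (right_ne_zero_of_mul h1), Real.log_zpow]

theorem tendsto_val_succ_div {R : RatFunc ℝ} (hR : R ≠ 0) :
    Tendsto (fun n : ℕ => val R ((n + 1 : ℕ) : ℝ) / val R n) atTop (𝓝 1) := by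
  have h0 := (tendsto_val_div_zpow R).comp (tendsto_natCast_atTop_atTop (R := ℝ))
  have h1 := h0.comp (tendsto_add_atTop_nat 1)
  have h2 := h1.div h0 (atInfinity_zero_ne_zero hR)
  rw [div_self (atInfinity_zero_ne_zero hR)] at h2
  have h3 : Tendsto (fun n : ℕ => (((n + 1 : ℕ) : ℝ) / n) ^ R.intDegree) atTop (𝓝 1) := by
    have h4 : Tendsto (fun n : ℕ => (((n + 1 : ℕ) : ℝ) / n)) atTop (𝓝 1) := by
      have h5 := (tendsto_one_div_atTop_nhds_zero_nat (𝕜 := ℝ)).const_add 1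
      rw [add_zero] at h5
      refine h5.congr' ?_
      filter_upwards [eventually_gt_atTop 0] with n hn
      have : (n : ℝ) ≠ 0 := by positivity
      push_cast
      field_simp
    have h6 := h4.zpow₀ R.intDegree (Or.inl one_ne_zero)
    simpa using h6
  have h7 := h2.mul h3
  rw [mul_one] at h7
  refine h7.congr' ?_
  filter_upwards [eventually_gt_atTop 0] with n hn
  have h8 : (n : ℝ) ^ R.intDegree ≠ 0 := zpow_ne_zero _ (by positivity)
  have h9 : ((n + 1 : ℕ) : ℝ) ^ R.intDegree ≠ 0 := zpow_ne_zero _ (by positivity)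
  simp only [Function.comp, Pi.div_apply, div_zpow]
  field_simp

/-! ### Second differences of `log |R(n)|`. -/

theorem abs_log_second_difference_le {n : ℝ} (hn : 0 < n) :
    |2 * Real.log (n + 1) - Real.log n - Real.log (n + 2)| ≤ 1 / n ^ 2 := by
  have h1 : 2 * Real.log (n + 1) - Real.log n - Real.log (n + 2)
      = Real.log (1 + 1 / (n * (n + 2))) := by
    have : 1 + 1 / (n * (n + 2)) = (n + 1) ^ 2 / (n * (n + 2)) := by field_simp; ring
    rw [this, Real.log_div (by positivity) (by positivity), Real.log_pow,
      Real.log_mul (by positivity) (by positivity)]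
    push_cast
    ring
  have h2 : 0 < 1 / (n * (n + 2)) := by positivity
  rw [h1, abs_of_nonneg (Real.log_nonneg (by linarith))]
  have h3 := Real.log_le_sub_one_of_pos (show 0 < 1 + 1 / (n * (n + 2)) by linarith)
  have h4 : 1 / (n * (n + 2)) ≤ 1 / n ^ 2 := by
    apply one_div_le_one_div_of_le (by positivity)
    nlinarith
  linarith

/-- In `log |R(n)| = d log n + log |φ(1/n)|` the logarithm has second differences at most `1/n²`.
The other summand already has first differences `O(1/n²)`, because it is Lipschitz in `1/n`. The
resulting summability is what allows the balancing of `R`. -/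
theorem exists_second_difference_bound {R : RatFunc ℝ} (hR : R ≠ 0) :
    ∃ K : ℝ, ∀ᶠ n : ℕ in atTop,
      |2 * Real.log (val R ((n + 1 : ℕ) : ℝ)) - Real.log (val R n) -
        Real.log (val R ((n + 2 : ℕ) : ℝ))| ≤ K / (n : ℝ) ^ 2 := by
  obtain ⟨K, hK, ε, hε, hL⟩ := exists_log_atInfinity_lipschitz hR
  have h0 := eventually_log_val hR
  have h1 := (tendsto_add_atTop_nat 1).eventually h0
  have h2 := (tendsto_add_atTop_nat 2).eventually h0
  have h3 : ∀ᶠ n : ℕ in atTop, |1 / (n : ℝ)| < ε := by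
    have := (tendsto_one_div_atTop_nhds_zero_nat (𝕜 := ℝ)).abs
    rw [abs_zero] at this
    exact this.eventually_lt_const hε
  have h4 := (tendsto_add_atTop_nat 1).eventually h3
  have h5 := (tendsto_add_atTop_nat 2).eventually h3
  refine ⟨|(R.intDegree : ℝ)| + 2 * K, ?_⟩
  filter_upwards [h0, h1, h2, h3, h4, h5, eventually_gt_atTop 0] with n h0 h1 h2 h3 h4 h5 hn
  have hn' : (0 : ℝ) < n := by positivity
  rw [h0, h1, h2]
  have e1 := hL _ _ h4 h3
  have e2 := hL _ _ h4 h5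
  have e3 := abs_log_second_difference_le hn'
  push_cast at *
  have d1 : |1 / ((n : ℝ) + 1) - 1 / n| ≤ 1 / (n : ℝ) ^ 2 := by
    rw [abs_le]; constructor
    · have : 1 / ((n : ℝ) + 1) - 1 / n = - (1 / ((n + 1) * n)) := by field_simp; ring
      rw [this, neg_le_neg_iff]
      apply one_div_le_one_div_of_le (by positivity); nlinarith
    · have : 1 / ((n : ℝ) + 1) - 1 / n = - (1 / ((n + 1) * n)) := by field_simp; ring
      rw [this]
      have a : 0 < 1 / (((n : ℝ) + 1) * n) := by positivity
      have b : 0 < 1 / (n : ℝ) ^ 2 := by positivity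
      linarith
  have d2 : |1 / ((n : ℝ) + 1) - 1 / (n + 2)| ≤ 1 / (n : ℝ) ^ 2 := by
    have : 1 / ((n : ℝ) + 1) - 1 / (n + 2) = 1 / ((n + 1) * (n + 2)) := by field_simp; ring
    rw [this, abs_of_pos (by positivity)]
    apply one_div_le_one_div_of_le (by positivity); nlinarith
  have f1 := e1.trans (mul_le_mul_of_nonneg_left d1 hK)
  have f2 := e2.trans (mul_le_mul_of_nonneg_left d2 hK)
  have f3 : |(R.intDegree : ℝ) * (2 * Real.log (n + 1) - Real.log n - Real.log (n + 2))|
      ≤ |(R.intDegree : ℝ)| * (1 / (n : ℝ) ^ 2) := by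
    rw [abs_mul]
    exact mul_le_mul_of_nonneg_left e3 (abs_nonneg _)
  have : (|(R.intDegree : ℝ)| + 2 * K) / (n : ℝ) ^ 2 = |(R.intDegree : ℝ)| * (1 / (n : ℝ) ^ 2) +
      K * (1 / (n : ℝ) ^ 2) + K * (1 / (n : ℝ) ^ 2) := by ring
  rw [this]
  refine le_trans (le_of_eq ?_) ((abs_add_three _ _ _).trans (add_le_add (add_le_add f3 f1) f2))
  congr 1
  ring


/-! ### Balanced square roots of the inverse -/

/-- The solution is the alternating tail `γ n = d n - d (n+1) + d (n+2) - …`, which converges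
absolutely when grouped in pairs. In `γ n + γ (n+1)` the pairs interleave to a telescoping sum. -/
theorem exists_alternating_split {d : ℕ → ℝ} (h0 : Tendsto d atTop (𝓝 0))
    (hs : Summable fun n => |d n - d (n + 1)|) :
    ∃ γ : ℕ → ℝ, (∀ n, γ n + γ (n + 1) = d n) ∧ Tendsto γ atTop (𝓝 0) := by
  set e : ℕ → ℝ := fun n => d n - d (n + 1) with he
  have hs' : Summable e := hs.of_abs
  have hshift : ∀ n, Summable fun j => e (n + j) := fun n => by
    simpa [add_comm] using (summable_nat_add_iff n).2 hs'
  have hshift' : ∀ n, Summable fun j => |e (n + j)| := fun n => by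
    simpa [add_comm] using (summable_nat_add_iff n).2 hs
  have i2 : Function.Injective fun j : ℕ => 2 * j := fun a b h => by simpa using h
  have i3 : Function.Injective fun j : ℕ => 2 * j + 1 := fun a b h => by simpa using h
  refine ⟨fun n => ∑' j, e (n + 2 * j), fun n => ?_, ?_⟩
  · have h1 : ∑' j, e (n + j) = d n := by
      refine HasSum.tsum_eq ?_
      rw [(hshift n).hasSum_iff_tendsto_nat]
      have h2 : ∀ M, ∑ j ∈ Finset.range M, e (n + j) = d n - d (n + M) := fun M => by
        induction M with
        | zero => simp
        | succ k ih => rw [Finset.sum_range_succ, ih, he]; simp only [← add_assoc]; ring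
      simp only [h2]
      have h3 : Tendsto (fun M => d (n + M)) atTop (𝓝 0) := by
        exact (h0.comp (tendsto_add_atTop_nat n)).congr fun M => by simp [add_comm]
      simpa using h3.const_sub (d n)
    rw [← h1, ← tsum_even_add_odd (f := fun j => e (n + j)) ((hshift n).comp_injective i2)
      ((hshift n).comp_injective i3)]
    congr 1
    refine tsum_congr fun j => ?_
    congr 1
    ring
  · have h4 : Tendsto (fun n => ∑' j, |e (j + n)|) atTop (𝓝 0) :=
      tendsto_sum_nat_add fun j => |e j|
    refine squeeze_zero_norm (fun n => ?_) h4
    have h5 : Summable fun j => |e (n + 2 * j)| := (hshift' n).comp_injective i2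
    have h6 : ‖∑' j, e (n + 2 * j)‖ ≤ ∑' j, |e (n + 2 * j)| := norm_tsum_le_tsum_norm h5
    refine h6.trans ?_
    have h7 : ∑' j, |e (n + 2 * j)| ≤ ∑' j, |e (n + j)| :=
      tsum_comp_le_tsum_of_inj (hshift' n) (fun _ => abs_nonneg _) i2
    simpa [add_comm] using h7

theorem tendsto_log_ratio {R : RatFunc ℝ} (hR : R ≠ 0) :
    Tendsto (fun n : ℕ => Real.log (val R ((n + 1 : ℕ) : ℝ)) - Real.log (val R n)) atTop (𝓝 0) := by
  have h := (tendsto_val_succ_div hR).log one_ne_zero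
  rw [Real.log_one] at h
  have h2 := (tendsto_natCast_atTop_atTop (R := ℝ)).eventually (eventually_val_ne_zero hR)
  refine h.congr' ?_
  filter_upwards [h2, (tendsto_add_atTop_nat 1).eventually h2] with n h3 h4
  rw [Real.log_div h4 h3]

/-- The naive choice `b n = |R(n+1)|^(-1/2)` satisfies the product identity only asymptotically. A
correction factor tending to `1` makes it exact; in logarithms it solves an equation `γ n + γ (n+1)
= d n`, with `d` a first difference of `log |R|`. -/
theorem exists_balanced {R : RatFunc ℝ} (hR : R ≠ 0) :
    ∃ b : ℕ → ℝ, (∀ n, 0 < b n) ∧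
      (∀ᶠ n : ℕ in atTop, b n * b (n + 1) * |val R ((n + 1 : ℕ) : ℝ)| = 1) ∧
      Tendsto (fun n : ℕ => b n ^ 2 * |val R ((n + 1 : ℕ) : ℝ)|) atTop (𝓝 1) := by
  set l : ℕ → ℝ := fun n => Real.log (val R n) with hl
  have hne := (tendsto_natCast_atTop_atTop (R := ℝ)).eventually (eventually_val_ne_zero hR)
  have hne1 := (tendsto_add_atTop_nat 1).eventually hne
  have hexp : ∀ n : ℕ, val R n ≠ 0 → |val R n| = Real.exp (l n) := fun n h =>
    (Real.exp_log_eq_abs h).symm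
  have hd : Summable fun n => |(l (n + 1 + 1) - l (n + 1)) - (l (n + 1 + 1 + 1) - l (n + 1 + 1))| := by
    obtain ⟨K, hK⟩ := exists_second_difference_bound hR
    have h1 : Summable fun n : ℕ => K / (n : ℝ) ^ 2 := by
      simpa [div_eq_mul_inv] using (Real.summable_one_div_nat_pow.2 one_lt_two).mul_left K
    have h2 : Summable fun n => |(l (n + 1) - l n) - (l (n + 1 + 1) - l (n + 1))| := by
      refine Summable.of_norm_bounded_eventually_nat h1 ?_
      filter_upwards [hK] with n hn
      rw [Real.norm_eq_abs, abs_abs]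
      refine le_trans (le_of_eq ?_) hn
      congr 1
      simp only [hl]
      ring
    exact (summable_nat_add_iff 1).2 h2
  obtain ⟨γ, hγ, hγ0⟩ := exists_alternating_split
    ((tendsto_log_ratio hR).comp (tendsto_add_atTop_nat 1)) hd
  -- With `γ n + γ (n+1) = l (n+2) - l (n+1)`, the logarithm of `b n * b (n+1)` is `-l (n+1)`.
  refine ⟨fun n => Real.exp ((γ n - l (n + 1)) / 2), fun n => Real.exp_pos _, ?_, ?_⟩
  · filter_upwards [hne1] with n hn
    rw [hexp _ hn, ← Real.exp_add, ← Real.exp_add, Real.exp_eq_one_iff]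
    have := hγ n
    simp only [Function.comp] at this
    change γ n + γ (n + 1) = l (n + 1 + 1) - l (n + 1) at this
    linarith
  · have h := (Real.continuous_exp.tendsto 0).comp hγ0
    rw [Real.exp_zero] at h
    refine h.congr' ?_
    filter_upwards [hne1] with n hn
    rw [hexp _ hn, pow_two, ← Real.exp_add, ← Real.exp_add]
    simp only [Function.comp]
    congr 1
    ring

/-- By the exact identity the ratio is eventually the inverse of `b n ^ 2 * |R(n+1)|`. -/
theorem tendsto_balanced_ratio {R : RatFunc ℝ} {b : ℕ → ℝ} (hb : ∀ n, 0 < b n)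
    (h1 : ∀ᶠ n : ℕ in atTop, b n * b (n + 1) * |val R ((n + 1 : ℕ) : ℝ)| = 1)
    (h2 : Tendsto (fun n : ℕ => b n ^ 2 * |val R ((n + 1 : ℕ) : ℝ)|) atTop (𝓝 1)) :
    Tendsto (fun n => b (n + 1) / b n) atTop (𝓝 1) := by
  have h3 := h2.inv₀ one_ne_zero
  rw [inv_one] at h3
  refine h3.congr' ?_
  filter_upwards [h1] with n hn
  have hb0 := hb n
  have hq : |val R ((n + 1 : ℕ) : ℝ)| ≠ 0 := fun h => by rw [h] at hn; simp at hn
  field_simp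
  linarith

/-- Thus `b n` is of order `n^(-d/2)`: at most of order `n^(-3/2)` for `d ≥ 3`, at least of order
`1/n` for `d ≤ 2`, and null for `d > 0`. This is where the threshold `d = 2` comes from. -/
theorem tendsto_balanced_sq {R : RatFunc ℝ} (hR : R ≠ 0) {b : ℕ → ℝ}
    (h2 : Tendsto (fun n : ℕ => b n ^ 2 * |val R ((n + 1 : ℕ) : ℝ)|) atTop (𝓝 1)) :
    ∃ C > 0, Tendsto (fun n : ℕ => b n ^ 2 * ((n + 1 : ℕ) : ℝ) ^ R.intDegree) atTop (𝓝 C) := by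
  have h3 := (((tendsto_val_div_zpow R).comp (tendsto_natCast_atTop_atTop (R := ℝ))).comp
    (tendsto_add_atTop_nat 1)).abs
  have h4 := h2.div h3 (abs_ne_zero.2 (atInfinity_zero_ne_zero hR))
  refine ⟨_, ?_, h4.congr' ?_⟩
  · have := abs_pos.2 (atInfinity_zero_ne_zero hR)
    positivity
  have hne := (tendsto_add_atTop_nat 1).eventually
    ((tendsto_natCast_atTop_atTop (R := ℝ)).eventually (eventually_val_ne_zero hR))
  filter_upwards [hne] with n hn
  have h5 : ((n + 1 : ℕ) : ℝ) ^ R.intDegree > 0 := zpow_pos (by positivity) _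
  have h6 := abs_pos.2 hn
  simp only [Function.comp, Pi.div_apply, abs_div, abs_of_pos h5]
  field_simp

theorem balanced_summable {R : RatFunc ℝ} (hR : R ≠ 0) (hd : 2 < R.intDegree) {b : ℕ → ℝ}
    (hb : ∀ n, 0 < b n)
    (h2 : Tendsto (fun n : ℕ => b n ^ 2 * |val R ((n + 1 : ℕ) : ℝ)|) atTop (𝓝 1)) :
    Summable b := by
  obtain ⟨C, hC, h⟩ := tendsto_balanced_sq hR h2
  have hs : Summable fun n : ℕ => Real.sqrt (C + 1) * (1 / ((n + 1 : ℕ) : ℝ) ^ (3 / 2 : ℝ)) :=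
    ((summable_nat_add_iff 1).2 (Real.summable_one_div_nat_rpow.2 (by norm_num))).mul_left _
  refine Summable.of_norm_bounded_eventually_nat hs ?_
  filter_upwards [h.eventually_lt_const (lt_add_one C)] with n hn
  have hx : (1 : ℝ) ≤ ((n + 1 : ℕ) : ℝ) := by push_cast; linarith [n.cast_nonneg (α := ℝ)]
  set x : ℝ := ((n + 1 : ℕ) : ℝ)
  have h3 : x ^ (3 : ℤ) ≤ x ^ R.intDegree := zpow_le_zpow_right₀ hx (by omega)
  rw [Real.norm_of_nonneg (hb n).le, mul_one_div, le_div_iff₀ (by positivity)]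
  apply Real.le_sqrt_of_sq_le
  rw [mul_pow, ← Real.rpow_natCast (x ^ (3 / 2 : ℝ)), ← Real.rpow_mul (by positivity)]
  have h4 : x ^ ((3 / 2 : ℝ) * (2 : ℕ)) = x ^ (3 : ℤ) := by
    rw [← Real.rpow_intCast]; norm_num
  rw [h4]
  exact (mul_le_mul_of_nonneg_left h3 (by positivity)).trans hn.le

theorem balanced_lower_bound {R : RatFunc ℝ} (hR : R ≠ 0) (hd : R.intDegree ≤ 2) {b : ℕ → ℝ}
    (hb : ∀ n, 0 < b n)
    (h2 : Tendsto (fun n : ℕ => b n ^ 2 * |val R ((n + 1 : ℕ) : ℝ)|) atTop (𝓝 1)) :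
    ∃ c > 0, ∀ᶠ n : ℕ in atTop, c / (n : ℝ) ≤ b n := by
  obtain ⟨C, hC, h⟩ := tendsto_balanced_sq hR h2
  refine ⟨Real.sqrt (C / 2) / 2, by positivity, ?_⟩
  filter_upwards [h.eventually_const_lt (half_lt_self hC), eventually_gt_atTop 0] with n hn hn0
  have hx : (1 : ℝ) ≤ ((n + 1 : ℕ) : ℝ) := by push_cast; linarith [n.cast_nonneg (α := ℝ)]
  have hn1 : (1 : ℝ) ≤ n := by exact_mod_cast hn0
  have h3 : ((n + 1 : ℕ) : ℝ) ^ R.intDegree ≤ ((n + 1 : ℕ) : ℝ) ^ (2 : ℤ) :=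
    zpow_le_zpow_right₀ hx hd
  have h4 := hn.trans_le (mul_le_mul_of_nonneg_left h3 (sq_nonneg (b n)))
  have h5 : Real.sqrt (C / 2) ≤ b n * ((n + 1 : ℕ) : ℝ) := by
    apply Real.sqrt_le_iff.2 ⟨mul_nonneg (hb n).le (by positivity), ?_⟩
    rw [mul_pow]
    exact_mod_cast h4.le
  rw [div_div, div_le_iff₀ (by positivity)]
  refine h5.trans ?_
  apply mul_le_mul_of_nonneg_left _ (hb n).le
  push_cast
  linarith

theorem balanced_tendsto_zero {R : RatFunc ℝ} (hR : R ≠ 0) (hd : 0 < R.intDegree) {b : ℕ → ℝ}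
    (h2 : Tendsto (fun n : ℕ => b n ^ 2 * |val R ((n + 1 : ℕ) : ℝ)|) atTop (𝓝 1)) :
    Tendsto b atTop (𝓝 0) := by
  obtain ⟨C, hC, h⟩ := tendsto_balanced_sq hR h2
  have h3 : Tendsto (fun n : ℕ => (((n + 1 : ℕ) : ℝ) ^ R.intDegree)) atTop atTop :=
    (tendsto_zpow_atTop_atTop hd).comp
      ((tendsto_natCast_atTop_atTop (R := ℝ)).comp (tendsto_add_atTop_nat 1))
  have h4 := h.div_atTop h3
  have h5 : Tendsto (fun n => b n ^ 2) atTop (𝓝 0) := by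
    refine h4.congr fun n => ?_
    have : ((n + 1 : ℕ) : ℝ) ^ R.intDegree > 0 := zpow_pos (by positivity) _
    field_simp
  have h6 := h5.sqrt
  simp only [Real.sqrt_zero, Real.sqrt_sq_eq_abs] at h6
  exact (tendsto_zero_iff_abs_tendsto_zero _).2 h6

/-! ### The action of a linear isomorphism on directions -/

/-- The image of the point of the unit circle at angle `x` under the linear map with columns
`e₁`, `e₂`. -/
def ellipse (e₁ e₂ : ℂ) (x : ℝ) : ℂ := (Real.cos x : ℂ) * e₁ + (Real.sin x : ℂ) * e₂

def ellipseVelocity (e₁ e₂ : ℂ) (x : ℝ) : ℂ := -(Real.sin x : ℂ) * e₁ + (Real.cos x : ℂ) * e₂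

theorem hasDerivAt_ellipse (e₁ e₂ : ℂ) (x : ℝ) :
    HasDerivAt (ellipse e₁ e₂) (ellipseVelocity e₁ e₂ x) x := by
  have h1 := ((Real.hasDerivAt_cos x).ofReal_comp).mul_const e₁
  have h2 := ((Real.hasDerivAt_sin x).ofReal_comp).mul_const e₂
  have h3 := h1.add h2
  rw [Complex.ofReal_neg] at h3
  exact h3

/-- The areal velocity along the ellipse is constant. The angle therefore changes at the rate `D /
|w|²`, which never vanishes and has the sign of the determinant `D`. -/
theorem im_velocity_mul_conj (e₁ e₂ : ℂ) (x : ℝ) :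
    (ellipseVelocity e₁ e₂ x * (starRingEnd ℂ) (ellipse e₁ e₂ x)).im =
      e₁.re * e₂.im - e₁.im * e₂.re := by
  simp only [ellipse, ellipseVelocity, map_add, map_mul, Complex.conj_ofReal, Complex.mul_im,
    Complex.add_re, Complex.add_im, Complex.mul_re, Complex.neg_re, Complex.neg_im,
    Complex.ofReal_re, Complex.ofReal_im, Complex.conj_re, Complex.conj_im]
  linear_combination (e₁.re * e₂.im - e₁.im * e₂.re) * Real.sin_sq_add_cos_sq x

theorem im_ellipse_mul_conj_zero (e₁ e₂ : ℂ) (x : ℝ) :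
    (ellipse e₁ e₂ x * (starRingEnd ℂ) (ellipse e₁ e₂ 0)).im =
      Real.sin x * (e₁.re * e₂.im - e₁.im * e₂.re) := by
  simp [ellipse, Complex.mul_im, -Complex.ofReal_cos, -Complex.ofReal_sin]
  ring

theorem ellipse_ne_zero {e₁ e₂ : ℂ} (hD : e₁.re * e₂.im - e₁.im * e₂.re ≠ 0) (x : ℝ) :
    ellipse e₁ e₂ x ≠ 0 := fun h => by
  have := im_velocity_mul_conj e₁ e₂ x
  rw [h] at this
  simp at this
  exact hD this.symm

theorem ellipse_add_pi (e₁ e₂ : ℂ) (x : ℝ) : ellipse e₁ e₂ (x + Real.pi) = -ellipse e₁ e₂ x := by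
  simp only [ellipse, Real.cos_add_pi, Real.sin_add_pi, Complex.ofReal_neg]
  ring

theorem continuous_ellipse (e₁ e₂ : ℂ) : Continuous (ellipse e₁ e₂) := by
  unfold ellipse; fun_prop

theorem continuous_ellipseVelocity (e₁ e₂ : ℂ) : Continuous (ellipseVelocity e₁ e₂) := by
  unfold ellipseVelocity; fun_prop

/-- A continuous logarithm of `w` is a constant plus a primitive of `w'/w`; its imaginary part is
the angle. -/
theorem exists_angle_lift {e₁ e₂ : ℂ} (hD : e₁.re * e₂.im - e₁.im * e₂.re ≠ 0) :
    ∃ A : ℝ → ℝ, (∀ x, HasDerivAt A ((e₁.re * e₂.im - e₁.im * e₂.re) /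
      Complex.normSq (ellipse e₁ e₂ x)) x) ∧
      ∀ x, ellipse e₁ e₂ x = (‖ellipse e₁ e₂ x‖ : ℂ) * Complex.exp (A x * Complex.I) := by
  set w := ellipse e₁ e₂ with hw
  have hw0 := ellipse_ne_zero hD
  set v : ℝ → ℂ := fun x => ellipseVelocity e₁ e₂ x / w x with hv
  have hvc : Continuous v :=
    (continuous_ellipseVelocity e₁ e₂).div (continuous_ellipse e₁ e₂) hw0
  set L : ℝ → ℂ := fun x => ∫ t in (0 : ℝ)..x, v t with hL
  have hLd : ∀ x, HasDerivAt L (v x) x := fun x => (hvc.integral_hasStrictDerivAt 0 x).hasDerivAt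
  have hconst : ∀ x, w x * Complex.exp (-L x) = w 0 := by
    have h1 : ∀ x, HasDerivAt (fun x => w x * Complex.exp (-L x)) 0 x := fun x => by
      have h2 := (hasDerivAt_ellipse e₁ e₂ x).mul ((hLd x).fun_neg.cexp)
      refine h2.congr_deriv ?_
      have := hw0 x
      simp only [hv, hw]
      field_simp
      ring
    intro x
    have h3 := is_const_of_deriv_eq_zero (fun x => (h1 x).differentiableAt)
      (fun x => (h1 x).deriv) x 0
    simpa [hL] using h3
  have hwx : ∀ x, w x = w 0 * Complex.exp (L x) := fun x => by
    rw [← hconst x, mul_assoc, ← Complex.exp_add]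
    simp
  refine ⟨fun x => (w 0).arg + (L x).im, fun x => ?_, fun x => ?_⟩
  · have h4 : HasDerivAt (fun x => (L x).im) (v x).im x :=
      Complex.imCLM.hasFDerivAt.comp_hasDerivAt x (hLd x)
    refine (h4.const_add ((w 0).arg)).congr_deriv ?_
    rw [← im_velocity_mul_conj e₁ e₂ x, hv]
    simp only [Complex.div_im, Complex.mul_im, Complex.conj_re, Complex.conj_im, ← hw]
    field_simp
    ring
  · have h5 : ‖w x‖ = ‖w 0‖ * Real.exp (L x).re := by
      rw [hwx x, norm_mul, Complex.norm_exp]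
    rw [h5]
    conv_lhs => rw [hwx x, ← Complex.norm_mul_exp_arg_mul_I (w 0)]
    conv_lhs => rw [← Complex.re_add_im (L x)]
    push_cast
    rw [add_mul, Complex.exp_add, Complex.exp_add]
    ring

theorem cos_eq_neg_one_of_exp {K : ℝ} (h : Complex.exp (K * Complex.I) = -1) : Real.cos K = -1 := by
  have := congrArg Complex.re h
  simpa [Complex.exp_ofReal_mul_I_re] using this

/-- The angle is strictly monotone. The gain over a half period has to be exactly `π`, which yields
both the equivariance and the surjectivity. -/
theorem exists_angle_orderIso {e₁ e₂ : ℂ} (hD : e₁.re * e₂.im - e₁.im * e₂.re ≠ 0) :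
    ∃ ε : ℝ, (ε = 1 ∨ ε = -1) ∧ ∃ T : ℝ ≃o ℝ, (∀ x, T (x + 2 * Real.pi) = T x + 2 * Real.pi) ∧
      ∀ x, ellipse e₁ e₂ x =
        (‖ellipse e₁ e₂ x‖ : ℂ) * Complex.exp ((ε * T x : ℝ) * Complex.I) := by
  obtain ⟨A, hA, hAw⟩ := exists_angle_lift hD
  set D := e₁.re * e₂.im - e₁.im * e₂.re with hDdef
  set w := ellipse e₁ e₂ with hw
  have hw0 := ellipse_ne_zero hD
  obtain ⟨ε, hε, hεD⟩ : ∃ ε : ℝ, (ε = 1 ∨ ε = -1) ∧ 0 < ε * D := by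
    rcases lt_or_gt_of_ne hD with h | h
    · exact ⟨-1, Or.inr rfl, by linarith⟩
    · exact ⟨1, Or.inl rfl, by linarith⟩
  have hεε : ε * ε = 1 := by rcases hε with rfl | rfl <;> norm_num
  set T : ℝ → ℝ := fun x => ε * A x with hT
  have hTd : ∀ x, HasDerivAt T (ε * (D / Complex.normSq (w x))) x := fun x => (hA x).const_mul ε
  have hTw : ∀ x, w x = (‖w x‖ : ℂ) * Complex.exp ((ε * T x : ℝ) * Complex.I) := fun x => by
    rw [hT]
    simp only
    rw [← mul_assoc, hεε, one_mul]
    exact hAw x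
  have hmono : StrictMono T := strictMono_of_deriv_pos fun x => by
    rw [(hTd x).deriv, ← mul_div_assoc]
    exact div_pos hεD (Complex.normSq_pos.2 (hw0 x))
  have hcont : Continuous T := continuous_iff_continuousAt.2 fun x => (hTd x).continuousAt
  -- Since `w (x + π) = -w x`, the angular speeds at `x` and `x + π` agree, so the gain does not
  -- depend on `x`.
  have hK : ∀ x, T (x + Real.pi) - T x = T (0 + Real.pi) - T 0 := fun x => by
    have h1 : ∀ x, HasDerivAt (fun x => T (x + Real.pi) - T x) 0 x := fun x => by
      have h2 := ((hTd (x + Real.pi)).comp_add_const x Real.pi).sub (hTd x)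
      rw [hw, ellipse_add_pi, Complex.normSq_neg, sub_self] at h2
      exact h2
    exact is_const_of_deriv_eq_zero (fun x => (h1 x).differentiableAt) (fun x => (h1 x).deriv) x 0
  set K := T (0 + Real.pi) - T 0 with hKdef
  have hKpos : 0 < K := sub_pos.2 (hmono (by linarith [Real.pi_pos]))
  have hKcos : Real.cos K = -1 := by
    have h1 := hTw (0 + Real.pi)
    have h2 := hTw 0
    rw [hw, ellipse_add_pi, ← hw, norm_neg] at h1
    have h3 : (‖w 0‖ : ℂ) ≠ 0 := by exact_mod_cast norm_ne_zero_iff.2 (hw0 0)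
    have h4 : Complex.exp ((ε * T (0 + Real.pi) : ℝ) * Complex.I) =
        -Complex.exp ((ε * T 0 : ℝ) * Complex.I) := by
      apply mul_left_cancel₀ h3
      rw [← h1, mul_neg, ← h2]
    have h5 : Complex.exp ((ε * K : ℝ) * Complex.I) = -1 := by
      rw [hKdef, mul_sub, Complex.ofReal_sub, sub_mul, Complex.exp_sub, h4, neg_div,
        div_self (Complex.exp_ne_zero _)]
    have h6 := cos_eq_neg_one_of_exp h5
    rcases hε with rfl | rfl
    · simpa using h6
    · simpa using h6
  -- A gain above `π` would make the angle increase by exactly `π` at some `x` in `(0, π)`. There `w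
  -- x` would be parallel to `w 0`, although the area they span is `D sin x ≠ 0`.
  have hKle : K ≤ Real.pi := by
    by_contra! hlt
    have h1 : T 0 + Real.pi ∈ Set.Icc (T 0) (T (0 + Real.pi)) :=
      ⟨by linarith [Real.pi_pos], by linarith⟩
    obtain ⟨x, hx, hx'⟩ := intermediate_value_Icc (by linarith [Real.pi_pos]) hcont.continuousOn h1
    have hx0 : 0 < x := by
      rcases hx.1.lt_or_eq with h | h
      · exact h
      · rw [← h] at hx'; linarith [Real.pi_pos]
    have hx1 : x < Real.pi := by
      rcases hx.2.lt_or_eq with h | h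
      · simpa using h
      · rw [h] at hx'; linarith [Real.pi_pos]
    have h2 := im_ellipse_mul_conj_zero e₁ e₂ x
    have h3 : (w x * (starRingEnd ℂ) (w 0)).im = 0 := by
      rw [hTw x, hTw 0, hx']
      rw [map_mul, Complex.conj_ofReal, ← Complex.exp_conj, map_mul, Complex.conj_I,
        Complex.conj_ofReal, mul_mul_mul_comm, ← Complex.exp_add, ← Complex.ofReal_mul]
      rw [show ((ε * (T 0 + Real.pi) : ℝ) : ℂ) * Complex.I + ((ε * T 0 : ℝ) : ℂ) * -Complex.I =
        ((ε * Real.pi : ℝ) : ℂ) * Complex.I by push_cast; ring]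
      rw [Complex.im_ofReal_mul, Complex.exp_ofReal_mul_I_im]
      rcases hε with rfl | rfl <;> simp
    rw [h3] at h2
    exact mul_ne_zero (Real.sin_pos_of_pos_of_lt_pi hx0 hx1).ne' hD h2.symm
  have hKpi : K = Real.pi := by
    have : Real.cos K = Real.cos Real.pi := by rw [hKcos, Real.cos_pi]
    exact Real.injOn_cos ⟨hKpos.le, hKle⟩ ⟨Real.pi_pos.le, le_rfl⟩ this
  have hTpi : ∀ x, T (x + Real.pi) = T x + Real.pi := fun x => by
    have := hK x
    linarith
  have hTnat : ∀ (n : ℕ) x, T (x + n * Real.pi) = T x + n * Real.pi := fun n => by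
    induction n with
    | zero => intro x; simp
    | succ k ih =>
      intro x
      have := hTpi (x + k * Real.pi)
      rw [ih] at this
      push_cast
      rw [show x + ((k : ℝ) + 1) * Real.pi = x + k * Real.pi + Real.pi by ring, this]
      ring
  have hsurj : Function.Surjective T := fun y => by
    obtain ⟨n, hn⟩ := exists_nat_gt (|y - T 0| / Real.pi)
    rw [div_lt_iff₀ Real.pi_pos] at hn
    have h1 := hTnat n 0
    have h2 := hTnat n (0 - n * Real.pi)
    rw [sub_add_cancel] at h2
    have h3 := abs_lt.1 hn
    exact mem_range_of_exists_le_of_exists_ge hcont ⟨0 - n * Real.pi, by linarith⟩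
      ⟨0 + n * Real.pi, by linarith⟩
  refine ⟨ε, hε, hmono.orderIsoOfSurjective T hsurj, fun x => ?_, fun x => ?_⟩
  · rw [StrictMono.coe_orderIsoOfSurjective]
    have := hTnat 2 x
    simpa using this
  · rw [StrictMono.coe_orderIsoOfSurjective]
    exact hTw x

/-! ### Circle lifts and the images of intervals. -/

theorem circlePoint_mem (t : ℝ) : circlePoint t ∈ unitCircle := by
  simp [circlePoint, unitCircle]

theorem exists_circlePoint {v : ℝ × ℝ} (hv : v ∈ unitCircle) : ∃ t, v = circlePoint t := by
  obtain ⟨x, y⟩ := v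
  have h : x ^ 2 + y ^ 2 = 1 := hv
  have hn : ‖(⟨x, y⟩ : ℂ)‖ = 1 := by
    rw [Complex.norm_def, Complex.normSq_mk]
    rw [← pow_two, ← pow_two, h, Real.sqrt_one]
  have h2 := Complex.norm_mul_exp_arg_mul_I (⟨x, y⟩ : ℂ)
  rw [hn, Complex.ofReal_one, one_mul] at h2
  refine ⟨(⟨x, y⟩ : ℂ).arg, ?_⟩
  rw [circlePoint, ← Complex.exp_ofReal_mul_I_re, ← Complex.exp_ofReal_mul_I_im, h2]

theorem circlePoint_eq_iff {s t : ℝ} :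
    circlePoint s = circlePoint t ↔ ∃ m : ℤ, s = t + m * (2 * Real.pi) := by
  constructor
  · intro h
    have h1 : Complex.exp (s * Complex.I) = Complex.exp (t * Complex.I) := by
      apply Complex.ext
      · rw [Complex.exp_ofReal_mul_I_re, Complex.exp_ofReal_mul_I_re]; exact congrArg Prod.fst h
      · rw [Complex.exp_ofReal_mul_I_im, Complex.exp_ofReal_mul_I_im]; exact congrArg Prod.snd h
    obtain ⟨m, hm⟩ := Complex.exp_eq_exp_iff_exists_int.1 h1
    refine ⟨m, ?_⟩
    have := congrArg Complex.im hm
    simpa using this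
  · rintro ⟨m, rfl⟩
    simp [circlePoint]

/-- A lift `T` of an orientation-preserving homeomorphism of the circle. -/
def IsCircleLift (T : ℝ ≃o ℝ) : Prop := ∀ x, T (x + 2 * Real.pi) = T x + 2 * Real.pi

/-- The point of the circle at angle `ε * T x`. -/
def arcMap (ε : ℝ) (T : ℝ ≃o ℝ) (x : ℝ) : ℝ × ℝ := circlePoint (ε * T x)

theorem IsCircleLift.add_int {T : ℝ ≃o ℝ} (hT : IsCircleLift T) (m : ℤ) (x : ℝ) :
    T (x + m * (2 * Real.pi)) = T x + m * (2 * Real.pi) := by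
  induction m using Int.induction_on generalizing x with
  | zero => simp
  | succ k ih =>
    have := hT (x + k * (2 * Real.pi))
    have h2 := ih x
    push_cast at *
    rw [show x + ((k : ℝ) + 1) * (2 * Real.pi) = x + k * (2 * Real.pi) + 2 * Real.pi by ring, this,
      h2]
    ring
  | pred k ih =>
    have := hT (x + (-k - 1 : ℝ) * (2 * Real.pi))
    have h2 := ih x
    push_cast at *
    rw [show x + (-(k : ℝ) - 1) * (2 * Real.pi) + 2 * Real.pi = x + -(k : ℝ) * (2 * Real.pi) by ring,
      h2] at this
    linarith

theorem arcMap_eq_iff {ε : ℝ} (hε : ε = 1 ∨ ε = -1) {T : ℝ ≃o ℝ} (hT : IsCircleLift T) {x y : ℝ} :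
    arcMap ε T x = arcMap ε T y ↔ ∃ m : ℤ, x = y + m * (2 * Real.pi) := by
  rw [arcMap, arcMap, circlePoint_eq_iff]
  constructor
  · rintro ⟨m, hm⟩
    rcases hε with rfl | rfl
    · refine ⟨m, T.injective ?_⟩
      rw [hT.add_int]
      linarith
    · refine ⟨-m, T.injective ?_⟩
      rw [hT.add_int]
      push_cast
      linarith
  · rintro ⟨m, rfl⟩
    rcases hε with rfl | rfl
    · exact ⟨m, by rw [hT.add_int]; ring⟩
    · exact ⟨-m, by rw [hT.add_int]; push_cast; ring⟩

theorem arcMap_add_two_pi {ε : ℝ} (hε : ε = 1 ∨ ε = -1) {T : ℝ ≃o ℝ} (hT : IsCircleLift T) (x : ℝ) :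
    arcMap ε T (x + 2 * Real.pi) = arcMap ε T x :=
  (arcMap_eq_iff hε hT).2 ⟨1, by push_cast; ring⟩

theorem range_arcMap {ε : ℝ} (hε : ε = 1 ∨ ε = -1) (T : ℝ ≃o ℝ) :
    Set.range (arcMap ε T) = unitCircle := by
  ext v
  constructor
  · rintro ⟨x, rfl⟩
    exact circlePoint_mem _
  · intro hv
    obtain ⟨t, rfl⟩ := exists_circlePoint hv
    refine ⟨T.symm (ε * t), ?_⟩
    rw [arcMap, T.apply_symm_apply, ← mul_assoc]
    rcases hε with rfl | rfl <;> norm_num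

theorem continuous_arcMap (ε : ℝ) (T : ℝ ≃o ℝ) : Continuous (arcMap ε T) := by
  have := T.continuous
  unfold arcMap circlePoint
  fun_prop

theorem arcMap_image (ε : ℝ) (T : ℝ ≃o ℝ) (A : Set ℝ) :
    arcMap ε T '' A = (fun t => circlePoint (ε * t)) '' (T '' A) := by
  rw [Set.image_image]; rfl

theorem circlePoint_neg_one_image (A : Set ℝ) :
    (fun t => circlePoint (-1 * t)) '' A = circlePoint '' (Neg.neg '' A) := by
  rw [Set.image_image]; simp

theorem T_lt_add {T : ℝ ≃o ℝ} (hT : IsCircleLift T) {a b : ℝ} (h : b < a + 2 * Real.pi) :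
    T b < T a + 2 * Real.pi := by
  rw [← hT a]; exact T.strictMono h

theorem isOpenArc_arcMap {ε : ℝ} (hε : ε = 1 ∨ ε = -1) {T : ℝ ≃o ℝ} (hT : IsCircleLift T) {a b : ℝ}
    (hab : a < b) (hb : b ≤ a + 2 * Real.pi) : IsOpenArc (arcMap ε T '' Set.Ioo a b) := by
  have h1 := T.strictMono hab
  have h2 : T b ≤ T a + 2 * Real.pi := by rw [← hT a]; exact T.monotone hb
  rw [arcMap_image, T.image_Ioo]
  rcases hε with rfl | rfl
  · exact ⟨T a, T b, h1, h2, by simp⟩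
  · refine ⟨-T b, -T a, by linarith, by linarith, ?_⟩
    rw [circlePoint_neg_one_image, Set.image_neg_eq_neg, Set.neg_Ioo]

theorem isClosedArc_arcMap {ε : ℝ} (hε : ε = 1 ∨ ε = -1) {T : ℝ ≃o ℝ} (hT : IsCircleLift T)
    {a b : ℝ} (hab : a < b) (hb : b < a + 2 * Real.pi) :
    IsClosedArc (arcMap ε T '' Set.Icc a b) := by
  have h1 := T.strictMono hab
  have h2 := T_lt_add hT hb
  rw [arcMap_image, T.image_Icc]
  rcases hε with rfl | rfl
  · exact ⟨T a, T b, h1, h2, by simp⟩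
  · refine ⟨-T b, -T a, by linarith, by linarith, ?_⟩
    rw [circlePoint_neg_one_image, Set.image_neg_eq_neg, Set.neg_Icc]

theorem isHalfOpenArc_arcMap_Ico {ε : ℝ} (hε : ε = 1 ∨ ε = -1) {T : ℝ ≃o ℝ} (hT : IsCircleLift T)
    {a b : ℝ} (hab : a < b) (hb : b < a + 2 * Real.pi) :
    IsHalfOpenArc (arcMap ε T '' Set.Ico a b) := by
  have h1 := T.strictMono hab
  have h2 := T_lt_add hT hb
  rw [arcMap_image, T.image_Ico]
  rcases hε with rfl | rfl
  · exact ⟨T a, T b, h1, h2, Or.inl (by simp)⟩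
  · refine ⟨-T b, -T a, by linarith, by linarith, Or.inr ?_⟩
    rw [circlePoint_neg_one_image, Set.image_neg_eq_neg, Set.neg_Ico]

theorem isHalfOpenArc_arcMap_Ioc {ε : ℝ} (hε : ε = 1 ∨ ε = -1) {T : ℝ ≃o ℝ} (hT : IsCircleLift T)
    {a b : ℝ} (hab : a < b) (hb : b < a + 2 * Real.pi) :
    IsHalfOpenArc (arcMap ε T '' Set.Ioc a b) := by
  have h1 := T.strictMono hab
  have h2 := T_lt_add hT hb
  rw [arcMap_image, T.image_Ioc]
  rcases hε with rfl | rfl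
  · exact ⟨T a, T b, h1, h2, Or.inr (by simp)⟩
  · refine ⟨-T b, -T a, by linarith, by linarith, Or.inl ?_⟩
    rw [circlePoint_neg_one_image, Set.image_neg_eq_neg, Set.neg_Ioc]

theorem closure_arcMap_image (ε : ℝ) (T : ℝ ≃o ℝ) {a b : ℝ} {A : Set ℝ} (hA : closure A = Set.Icc a b) :
    closure (arcMap ε T '' A) = arcMap ε T '' Set.Icc a b := by
  apply Set.Subset.antisymm
  · refine closure_minimal (Set.image_mono (hA ▸ subset_closure)) ?_
    exact (isCompact_Icc.image (continuous_arcMap ε T)).isClosed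
  · rw [← hA]
    exact image_closure_subset_closure_image (continuous_arcMap ε T)

/-- Parameters with the same image differ by a multiple of a full turn; as `c - a` is less than one
turn, the multiple is zero. -/
theorem arcMap_Icc_inter {ε : ℝ} (hε : ε = 1 ∨ ε = -1) {T : ℝ ≃o ℝ} (hT : IsCircleLift T)
    {a b c : ℝ} (hab : a ≤ b) (hbc : b ≤ c) (hc : c < a + 2 * Real.pi) :
    arcMap ε T '' Set.Icc a b ∩ arcMap ε T '' Set.Icc b c = {arcMap ε T b} := by
  ext v
  constructor
  · rintro ⟨⟨x, hx, rfl⟩, ⟨y, hy, hyx⟩⟩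
    obtain ⟨m, hm⟩ := (arcMap_eq_iff hε hT).1 hyx
    have hpi := Real.pi_pos
    have hm0 : m = 0 := by
      have h1 : (m : ℝ) < 1 := by
        by_contra! h
        have : 1 * (2 * Real.pi) ≤ m * (2 * Real.pi) := by gcongr
        linarith [hx.1, hy.2]
      have h2 : (-1 : ℝ) < m := by
        by_contra! h
        have : m * (2 * Real.pi) ≤ -1 * (2 * Real.pi) := by gcongr
        linarith [hx.2, hy.1]
      have h1' : m < 1 := by exact_mod_cast h1
      have h2' : -1 < m := by exact_mod_cast h2
      omega
    rw [hm0] at hm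
    simp only [Int.cast_zero, zero_mul, add_zero] at hm
    have : x = b := le_antisymm hx.2 (hm ▸ hy.1)
    rw [this]
    rfl
  · rintro rfl
    exact ⟨⟨b, ⟨hab, le_rfl⟩, rfl⟩, ⟨b, ⟨le_rfl, hbc⟩, rfl⟩⟩

theorem proj_of_eq_mul {x y ρ t : ℝ} (hρ : 0 < ρ) (hx : x = ρ * Real.cos t)
    (hy : y = ρ * Real.sin t) : proj (x, y) = circlePoint t := by
  have h : Real.sqrt (x ^ 2 + y ^ 2) = ρ := by
    rw [hx, hy, show (ρ * Real.cos t) ^ 2 + (ρ * Real.sin t) ^ 2 =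
      ρ ^ 2 * (Real.sin t ^ 2 + Real.cos t ^ 2) by ring, Real.sin_sq_add_cos_sq, mul_one,
      Real.sqrt_sq hρ.le]
  simp only [proj, h, circlePoint]
  rw [hx, hy, mul_div_cancel_left₀ _ hρ.ne', mul_div_cancel_left₀ _ hρ.ne']

/-- The preimages of the directions under an injective linear map of the plane are parametrized,
up to orientation, by a circle lift. -/
theorem exists_arcMap {M : ℝ × ℝ →ₗ[ℝ] ℝ × ℝ} (hM : Function.Injective M) :
    ∃ ε : ℝ, (ε = 1 ∨ ε = -1) ∧ ∃ T : ℝ ≃o ℝ, IsCircleLift T ∧ ∃ V : ℝ → ℝ × ℝ,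
      ∀ x, M (V x) = (Real.cos x, Real.sin x) ∧ V x ≠ 0 ∧ proj (V x) = arcMap ε T x := by
  have hMs : Function.Surjective M := LinearMap.injective_iff_surjective.1 hM
  obtain ⟨u₁, hu₁⟩ := hMs (1, 0)
  obtain ⟨u₂, hu₂⟩ := hMs (0, 1)
  have hD : u₁.1 * u₂.2 - u₁.2 * u₂.1 ≠ 0 := by
    intro h
    have h1 : M (u₂.2 • u₁ - u₁.2 • u₂) = M 0 := by
      congr 1
      ext
      · simp; linarith
      · simp; ring
    rw [map_sub, map_smul, map_smul, hu₁, hu₂, map_zero] at h1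
    have a1 : u₂.2 = 0 := by simpa using congrArg Prod.fst h1
    have a2 : u₁.2 = 0 := by simpa using congrArg Prod.snd h1
    have h2 : M (u₂.1 • u₁ - u₁.1 • u₂) = M 0 := by
      congr 1
      ext
      · simp; ring
      · simp [a1, a2]
    rw [map_sub, map_smul, map_smul, hu₁, hu₂, map_zero] at h2
    have a3 : u₂.1 = 0 := by simpa using congrArg Prod.fst h2
    have a4 : u₂ = 0 := by ext <;> simp [a1, a3]
    rw [a4, map_zero] at hu₂
    simpa using congrArg Prod.snd hu₂
  obtain ⟨ε, hε, T, hT, hTw⟩ := exists_angle_orderIso (e₁ := ⟨u₁.1, u₁.2⟩) (e₂ := ⟨u₂.1, u₂.2⟩) hD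
  have hMV : ∀ x : ℝ, M (Real.cos x • u₁ + Real.sin x • u₂) = (Real.cos x, Real.sin x) := fun x => by
    rw [map_add, map_smul, map_smul, hu₁, hu₂]
    simp
  refine ⟨ε, hε, T, hT, fun x => Real.cos x • u₁ + Real.sin x • u₂, fun x => ⟨hMV x, ?_, ?_⟩⟩
  · intro h
    have h1 := hMV x
    rw [show Real.cos x • u₁ + Real.sin x • u₂ = 0 from h, map_zero] at h1
    have h2 := Real.sin_sq_add_cos_sq x
    have a1 : Real.cos x = 0 := (congrArg Prod.fst h1).symm
    have a2 : Real.sin x = 0 := (congrArg Prod.snd h1).symm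
    rw [a1, a2] at h2
    norm_num at h2
  · have h := hTw x
    have hpos : 0 < ‖ellipse ⟨u₁.1, u₁.2⟩ ⟨u₂.1, u₂.2⟩ x‖ :=
      norm_pos_iff.2 (ellipse_ne_zero (e₁ := ⟨u₁.1, u₁.2⟩) (e₂ := ⟨u₂.1, u₂.2⟩) hD x)
    have hre := congrArg Complex.re h
    have him := congrArg Complex.im h
    rw [Complex.re_ofReal_mul, Complex.exp_ofReal_mul_I_re] at hre
    rw [Complex.im_ofReal_mul, Complex.exp_ofReal_mul_I_im] at him
    refine proj_of_eq_mul hpos ?_ ?_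
    · rw [← hre]; simp [ellipse, -Complex.ofReal_cos, -Complex.ofReal_sin]
    · rw [← him]; simp [ellipse, -Complex.ofReal_cos, -Complex.ofReal_sin]

/-! ### Words as ultimate signs -/

theorem hasUltimateSign_map_range {L : ℕ} (hL : 0 < L) {F : ℕ → SignType}
    (hF : ∀ n, F (n + L) = F n) (f : ℕ → ℝ) :
    HasUltimateSign f ((List.range L).map F) ↔ ∀ᶠ n in atTop, SignType.sign (f n) = F n := by
  have hmod : ∀ n, F (n % L) = F n := fun n => (show Function.Periodic F L from hF).map_mod_nat n
  have hget : ∀ n, ((List.range L).map F)[n % ((List.range L).map F).length]? = some (F n) :=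
    fun n => by
      have h := Nat.mod_lt n hL
      simp [h, hmod]
  rw [HasUltimateSign, eventually_atTop]
  refine exists_congr fun N => forall_congr' fun n => imp_congr_right fun _ => ?_
  rw [hget, Option.some_inj, eq_comm]

theorem HasUltimateSign.congr {f g : ℕ → ℝ} {s : List SignType} (hf : HasUltimateSign f s)
    (h : ∀ᶠ n in atTop, SignType.sign (f n) = SignType.sign (g n)) : HasUltimateSign g s := by
  obtain ⟨N, hN⟩ := hf
  obtain ⟨N', hN'⟩ := eventually_atTop.1 h
  exact ⟨max N N', fun n hn => by rw [← hN' n (le_of_max_le_right hn), hN n (le_of_max_le_left hn)]⟩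

/-- Eventual periodicity of the signs is all that the non-existence results for the `ℚ`-`Ω` elliptic
type use. -/
theorem HasUltimateSign.exists_period {f : ℕ → ℝ} {s : List SignType} (hf : HasUltimateSign f s) :
    ∃ τ > 0, ∀ᶠ n in atTop, SignType.sign (f (n + τ)) = SignType.sign (f n) := by
  obtain ⟨N, hN⟩ := hf
  have hpos : 0 < s.length := by
    rcases Nat.eq_zero_or_pos s.length with h | h
    · have := hN N le_rfl
      rw [List.length_eq_zero_iff.1 h] at this
      simp at this
    · exact h
  refine ⟨s.length, hpos, eventually_atTop.2 ⟨N, fun n hn => ?_⟩⟩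
  have h1 := hN n hn
  have h2 := hN (n + s.length) (by omega)
  rw [Nat.add_mod_right, h1, Option.some_inj] at h2
  exact h2.symm

/-- The sign sequences of the four words of the loxodromic types. -/
def loxSign (i : Fin 4) (n : ℕ) : SignType :=
  if n % 2 = 0 then ![1, -1, 1, -1] i else ![-1, 1, 1, -1] i

def loxWord : Fin 4 → List SignType := ![[1, -1], [-1, 1], [1], [-1]]

theorem loxSign_add_two (i : Fin 4) (n : ℕ) : loxSign i (n + 2) = loxSign i n := by
  simp [loxSign]

theorem hasUltimateSign_one (f : ℕ → ℝ) : HasUltimateSign f [1] ↔ ∀ᶠ n in atTop, 0 < f n := by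
  have := hasUltimateSign_map_range one_pos (F := fun _ => (1 : SignType)) (fun _ => rfl) f
  simpa [sign_eq_one_iff] using this

theorem hasUltimateSign_neg_one (f : ℕ → ℝ) : HasUltimateSign f [-1] ↔ ∀ᶠ n in atTop, f n < 0 := by
  have := hasUltimateSign_map_range one_pos (F := fun _ => (-1 : SignType)) (fun _ => rfl) f
  simpa [sign_eq_neg_one_iff] using this

theorem hasUltimateSign_loxWord (i : Fin 4) (f : ℕ → ℝ) :
    HasUltimateSign f (loxWord i) ↔ ∀ᶠ n in atTop, SignType.sign (f n) = loxSign i n := by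
  fin_cases i
  · exact hasUltimateSign_map_range two_pos (loxSign_add_two 0) f
  · exact hasUltimateSign_map_range two_pos (loxSign_add_two 1) f
  · exact hasUltimateSign_map_range one_pos (F := loxSign 2)
      (fun n => by simp [loxSign]) f
  · exact hasUltimateSign_map_range one_pos (F := loxSign 3)
      (fun n => by simp [loxSign]) f

theorem loxWord_incompatible {i j : Fin 4} (hij : i ≠ j) {f : ℕ → ℝ}
    (hi : HasUltimateSign f (loxWord i)) : ¬ HasUltimateSign f (loxWord j) := by
  intro hj
  rw [hasUltimateSign_loxWord] at hi hj
  obtain ⟨N, hN⟩ := eventually_atTop.1 (hi.and hj)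
  have h0 := hN (2 * N) (by omega)
  have h1 := hN (2 * N + 1) (by omega)
  rw [h0.1] at h0
  rw [h1.1] at h1
  have a0 := h0.2
  have a1 := h1.2
  have e0 : 2 * N % 2 = 0 := by omega
  have e1 : (2 * N + 1) % 2 = 1 := by omega
  simp only [loxSign, e0, e1] at a0 a1
  revert a0 a1 hij
  fin_cases i <;> fin_cases j <;> simp

/-! ### The words of the elliptic types -/

/-- The sign sequence of `t_j` (`y = 2 j`) or `s_j` (`y = 2 j + 1`). -/
def ellSign (k r : ℕ) (y : ℤ) (n : ℕ) : SignType :=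
  SignType.sign (Real.sin (((y : ℝ) - 2 * n * k) * (Real.pi / (2 * r))))

/-- The length `(k mod 2) r + r` times `k` is an even multiple of `r` for either parity of `k`, so
the argument of the sine shifts by a multiple of `2π`. -/
theorem ellSign_period {k r : ℕ} (hr : 0 < r) (y : ℤ) (n : ℕ) :
    ellSign k r y (n + ((k % 2) * r + r)) = ellSign k r y n := by
  obtain ⟨m, hm⟩ : ∃ m : ℕ, ((k % 2) * r + r) * k = 2 * r * m := by
    rcases Nat.even_or_odd k with ⟨l, hl⟩ | ⟨l, hl⟩
    · exact ⟨l, by rw [show k % 2 = 0 by omega, hl]; ring⟩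
    · exact ⟨k, by rw [show k % 2 = 1 by omega]; ring⟩
  have hm' : (((k % 2 : ℕ) : ℝ) * r + r) * k = 2 * r * m := by exact_mod_cast hm
  have hr' : (r : ℝ) ≠ 0 := by positivity
  rw [ellSign, ellSign]
  congr 1
  conv_rhs => rw [← Real.sin_sub_nat_mul_two_pi _ m]
  congr 1
  push_cast
  rw [show ((y : ℝ) - 2 * (n + (((k % 2 : ℕ) : ℝ) * r + r)) * k) =
    (y - 2 * n * k) - 2 * ((((k % 2 : ℕ) : ℝ) * r + r) * k) by ring, hm']
  field_simp

/-- In the definition the index is elaborated as a real number, so the range of naturals is cast as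
a list. This form has a natural index instead. -/
theorem sWord_eq (k r j : ℕ) : sWord k r j = (List.range ((k % 2) * r + r)).map fun i : ℕ =>
    SignType.sign (Real.sin (((j : ℝ) - (i : ℝ) * (k : ℝ) + 1 / 2) / (r : ℝ) * Real.pi)) := by
  have h : ∀ l : List ℕ, (do let a ← l; pure (a : ℝ)) = l.map (Nat.cast : ℕ → ℝ) := fun l =>
    List.map_eq_flatMap.symm
  rw [sWord, h, List.map_map]
  rfl

theorem tWord_eq (k r j : ℕ) : tWord k r j = (List.range ((k % 2) * r + r)).map fun i : ℕ =>
    SignType.sign (Real.sin (((j : ℝ) - (i : ℝ) * (k : ℝ)) / (r : ℝ) * Real.pi)) := by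
  have h : ∀ l : List ℕ, (do let a ← l; pure (a : ℝ)) = l.map (Nat.cast : ℕ → ℝ) := fun l =>
    List.map_eq_flatMap.symm
  rw [tWord, h, List.map_map]
  rfl

theorem hasUltimateSign_sWord {k r : ℕ} (hr : 0 < r) (j : ℕ) (f : ℕ → ℝ) :
    HasUltimateSign f (sWord k r j) ↔
      ∀ᶠ n in atTop, SignType.sign (f n) = ellSign k r (2 * j + 1) n := by
  rw [← hasUltimateSign_map_range (show 0 < (k % 2) * r + r by positivity) (ellSign_period hr _)]
  have : sWord k r j = (List.range ((k % 2) * r + r)).map (ellSign k r (2 * j + 1)) := by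
    rw [sWord_eq]
    refine List.map_congr_left fun n _ => ?_
    rw [ellSign]
    congr 2
    have hr' : (r : ℝ) ≠ 0 := by positivity
    push_cast
    field_simp
    ring
  rw [this]

theorem hasUltimateSign_tWord {k r : ℕ} (hr : 0 < r) (j : ℕ) (f : ℕ → ℝ) :
    HasUltimateSign f (tWord k r j) ↔
      ∀ᶠ n in atTop, SignType.sign (f n) = ellSign k r (2 * j) n := by
  rw [← hasUltimateSign_map_range (show 0 < (k % 2) * r + r by positivity) (ellSign_period hr _)]
  have : tWord k r j = (List.range ((k % 2) * r + r)).map (ellSign k r (2 * j)) := by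
    rw [tWord_eq]
    refine List.map_congr_left fun n _ => ?_
    rw [ellSign]
    congr 2
    have hr' : (r : ℝ) ≠ 0 := by positivity
    push_cast
    field_simp
  rw [this]

theorem sin_pos_of_int {r : ℕ} {z : ℤ} (h0 : 0 < z) (h1 : z < 2 * r) :
    0 < Real.sin (z * (Real.pi / (2 * r))) := by
  have hr : (0 : ℝ) < r := by
    have : 0 < (r : ℤ) := by omega
    exact_mod_cast this
  have h0' : (0 : ℝ) < z := by exact_mod_cast h0
  have h1' : (z : ℝ) < 2 * r := by exact_mod_cast h1
  apply Real.sin_pos_of_pos_of_lt_pi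
  · positivity
  · rw [← mul_div_assoc, div_lt_iff₀ (by positivity), mul_comm]
    exact mul_lt_mul_of_pos_left h1' Real.pi_pos

theorem sin_add_two_mul {r : ℕ} (hr : 0 < r) (z : ℤ) :
    Real.sin ((z + 2 * r : ℤ) * (Real.pi / (2 * r))) = - Real.sin (z * (Real.pi / (2 * r))) := by
  have hr' : (r : ℝ) ≠ 0 := by positivity
  rw [← Real.sin_add_pi]
  congr 1
  push_cast
  field_simp

/-- The sine is sampled at every second point of a grid of step `π/(2r)`. For even `y` one sample is
a zero, and `y'` has its zero there only at distance half a turn, where the neighbouring signs are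
opposite. For odd `y` the samples at `-1` and `1` show a change from `-` to `+`, which `y'` cannot
show at the same place. -/
theorem eq_of_sin_signs {r : ℕ} (hr : 2 ≤ r) {y y' : ℤ} (hy : y < y') (hyy : y' < y + 4 * r)
    (h : ∀ m : ℤ, SignType.sign (Real.sin ((y - 2 * m : ℤ) * (Real.pi / (2 * r)))) =
      SignType.sign (Real.sin ((y' - 2 * m : ℤ) * (Real.pi / (2 * r))))) : False := by
  have hr0 : 0 < r := by omega
  have hneg : ∀ z : ℤ, 2 * r < z → z < 4 * r → Real.sin (z * (Real.pi / (2 * r))) < 0 :=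
    fun z h1 h2 => by
      have h3 := sin_add_two_mul hr0 (z - 2 * r)
      rw [sub_add_cancel] at h3
      rw [h3, neg_lt_zero]
      exact sin_pos_of_int (by omega) (by omega)
  have hpos : ∀ z : ℤ, 0 < z → z < 2 * r → 0 < Real.sin (z * (Real.pi / (2 * r))) :=
    fun z => sin_pos_of_int
  have hr' : (r : ℝ) ≠ 0 := by positivity
  have hz0 : Real.sin (((0 : ℤ) : ℝ) * (Real.pi / (2 * r))) = 0 := by simp
  have hz2 : Real.sin (((2 * r : ℤ) : ℝ) * (Real.pi / (2 * r))) = 0 := by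
    have := sin_add_two_mul hr0 0
    rw [hz0, neg_zero, zero_add] at this
    exact this
  have hz4 : Real.sin (((4 * r : ℤ) : ℝ) * (Real.pi / (2 * r))) = 0 := by
    have := sin_add_two_mul hr0 (2 * r)
    rw [hz2, neg_zero, show (2 * r + 2 * r : ℤ) = 4 * r by ring] at this
    exact this
  have hm1 : Real.sin (((-1 : ℤ) : ℝ) * (Real.pi / (2 * r))) < 0 := by
    have := hpos 1 (by omega) (by omega)
    push_cast at *
    rw [neg_mul, Real.sin_neg]
    linarith
  rcases Int.even_or_odd y with ⟨m, hm⟩ | ⟨m, hm⟩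
  · have h1 := h m
    rw [show y - 2 * m = 0 by omega, hz0, sign_zero, eq_comm, sign_eq_zero_iff] at h1
    have hd : y' - 2 * m = 2 * r := by
      rcases lt_trichotomy (y' - 2 * m) (2 * r) with h2 | h2 | h2
      · exact absurd h1 (hpos _ (by omega) h2).ne'
      · exact h2
      · exact absurd h1 (hneg _ h2 (by omega)).ne
    have h3 := h (m - 1)
    rw [sign_pos (hpos _ (by omega) (by omega)), sign_neg (hneg _ (by omega) (by omega))] at h3
    exact absurd h3 (by decide)
  · have h1 := h (m + 1)
    rw [show y - 2 * (m + 1) = -1 by omega, sign_neg hm1, eq_comm, sign_eq_neg_one_iff] at h1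
    have h2 := h m
    rw [sign_pos (hpos _ (by omega) (by omega)), eq_comm, sign_eq_one_iff] at h2
    rcases lt_trichotomy (y' - 2 * (m + 1)) (2 * r) with h3 | h3 | h3
    · rcases (show (0 : ℤ) ≤ y' - 2 * (m + 1) by omega).lt_or_eq with h4 | h4
      · linarith [hpos _ h4 h3]
      · rw [← h4, hz0] at h1; exact lt_irrefl _ h1
    · rw [h3, hz2] at h1; exact lt_irrefl _ h1
    · rcases (show y' - 2 * m ≤ 4 * r by omega).lt_or_eq with h4 | h4
      · linarith [hneg _ (by omega) h4]
      · rw [h4, hz4] at h2; exact lt_irrefl _ h2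

/-- Bézout's identity, applied with a large multiple of `r` added to `n`. -/
theorem exists_mul_eq_add {k r : ℕ} (hkr : Nat.Coprime k r) (hr : 0 < r) (m : ℤ) (N : ℕ) :
    ∃ n ≥ N, ∃ l : ℤ, (n : ℤ) * k = m + l * r := by
  have hb := Nat.gcd_eq_gcd_ab k r
  rw [hkr.gcd_eq_one] at hb
  push_cast at hb
  set a := Nat.gcdA k r
  set b := Nat.gcdB k r
  refine ⟨(m * a + (N + |m * a|) * r).toNat, ?_, -(m * b) + (N + |m * a|) * k, ?_⟩
  · have h1 : (1 : ℤ) ≤ r := by omega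
    have h2 : (N + |m * a|) ≤ (N + |m * a|) * r :=
      le_mul_of_one_le_right (by positivity) h1
    have h3 := neg_abs_le (m * a)
    omega
  · have h1 : (1 : ℤ) ≤ r := by omega
    have h2 : (N + |m * a|) ≤ (N + |m * a|) * r :=
      le_mul_of_one_le_right (by positivity) h1
    have h3 := neg_abs_le (m * a)
    rw [Int.toNat_of_nonneg (by omega)]
    linear_combination (-m) * hb

/-- Since `k` is invertible modulo `r`, every `m` is congruent to some `n * k` with `n` large. The
sign sequence therefore determines the signs at all shifts `2m`, up to a factor `(-1)^l` common to
`y` and `y'`. -/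
theorem ellSign_eq_of_frequently {k r : ℕ} (hkr : Nat.Coprime k r) (hr : 2 ≤ r) {y y' : ℤ}
    (hyy : |y - y'| < 4 * r) (h : ∀ᶠ n in atTop, ellSign k r y n = ellSign k r y' n) : y = y' := by
  obtain ⟨N, hN⟩ := eventually_atTop.1 h
  have hr' : (r : ℝ) ≠ 0 := by positivity
  have key : ∀ m : ℤ, SignType.sign (Real.sin ((y - 2 * m : ℤ) * (Real.pi / (2 * r)))) =
      SignType.sign (Real.sin ((y' - 2 * m : ℤ) * (Real.pi / (2 * r)))) := fun m => by
    obtain ⟨n, hn, l, hl⟩ := exists_mul_eq_add hkr (by omega) m N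
    have h1 := hN n hn
    have hl' : (n : ℝ) * k = m + l * r := by exact_mod_cast hl
    have h2 : ∀ z : ℤ, ((z : ℝ) - 2 * n * k) * (Real.pi / (2 * r)) =
        (z - 2 * m : ℤ) * (Real.pi / (2 * r)) - l * Real.pi := fun z => by
      rw [mul_assoc 2, hl']
      push_cast
      field_simp
      ring
    rw [ellSign, ellSign, h2, h2, Real.sin_sub_int_mul_pi, Real.sin_sub_int_mul_pi] at h1
    rcases Int.even_or_odd l with hl2 | hl2
    · simpa [hl2.neg_one_zpow] using h1
    · simpa [hl2.neg_one_zpow, Left.sign_neg] using h1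
  rw [abs_lt] at hyy
  rcases lt_trichotomy y y' with h1 | h1 | h1
  · exact (eq_of_sin_signs hr h1 (by omega) key).elim
  · exact h1
  · exact (eq_of_sin_signs hr h1 (by omega) fun m => (key m).symm).elim

/-! ### Holonomic sequences in terms of their initial values -/

/-- The `n`-th term of the holonomic sequence as a linear function of the initial value. -/
def sol (P Q : RatFunc ℝ) : ℕ → (ℝ × ℝ →ₗ[ℝ] ℝ)
  | 0 => LinearMap.fst ℝ ℝ ℝ
  | 1 => LinearMap.snd ℝ ℝ ℝ
  | n + 2 => val P n • sol P Q (n + 1) + val Q n • sol P Q n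

theorem sol_succ_succ (P Q : RatFunc ℝ) (n : ℕ) (v : ℝ × ℝ) :
    sol P Q (n + 2) v = val P n * sol P Q (n + 1) v + val Q n * sol P Q n v := by
  simp [sol]

theorem isHolonomic_sol (P Q : RatFunc ℝ) (v : ℝ × ℝ) : IsHolonomic P Q fun n => sol P Q n v :=
  fun n => sol_succ_succ P Q n v

theorem IsHolonomic.eq_sol {P Q : RatFunc ℝ} {f : ℕ → ℝ} (hf : IsHolonomic P Q f) (n : ℕ) :
    f n = sol P Q n (f 0, f 1) := by
  induction n using Nat.twoStepInduction with
  | zero => rfl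
  | one => rfl
  | more n h1 h2 => rw [hf n, sol_succ_succ, ← h1, ← h2]

theorem initialValues_eq (P Q : RatFunc ℝ) (s : List SignType) :
    initialValues P Q s = {v | v ≠ 0 ∧ HasUltimateSign (fun n => sol P Q n v) s} := by
  ext v
  constructor
  · rintro ⟨hv, f, hf, rfl, hs⟩
    refine ⟨hv, ?_⟩
    rw [← show f = fun n => sol P Q n (f 0, f 1) from funext hf.eq_sol]
    exact hs
  · rintro ⟨hv, hs⟩
    exact ⟨hv, _, isHolonomic_sol P Q v, rfl, hs⟩

theorem val_ne_zero_of_noZerosOrPoles {R : RatFunc ℝ} (hR : NoZerosOrPoles R) (n : ℕ) :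
    val R n ≠ 0 := by
  rw [val_eq_div]
  exact div_ne_zero (hR n).1 (hR n).2

theorem ne_zero_of_noZerosOrPoles {R : RatFunc ℝ} (hR : NoZerosOrPoles R) : R ≠ 0 := by
  rintro rfl
  exact (hR 0).1 (by simp)

theorem eq_zero_of_sol_eq_zero {P Q : RatFunc ℝ} (hQ : NoZerosOrPoles Q) {v : ℝ × ℝ} (n : ℕ)
    (h0 : sol P Q n v = 0) (h1 : sol P Q (n + 1) v = 0) : v = 0 := by
  induction n with
  | zero => exact Prod.ext h0 h1
  | succ k ih =>
    refine ih ?_ h0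
    rw [sol_succ_succ, h0, mul_zero, zero_add] at h1
    exact (mul_eq_zero.1 h1).resolve_left (val_ne_zero_of_noZerosOrPoles hQ k)

/-! ### From initial values to directions. -/

theorem proj_smul {t : ℝ} (ht : 0 < t) (v : ℝ × ℝ) : proj (t • v) = proj v := by
  have h : Real.sqrt ((t • v).1 ^ 2 + (t • v).2 ^ 2) = t * Real.sqrt (v.1 ^ 2 + v.2 ^ 2) := by
    rw [Prod.smul_fst, Prod.smul_snd, smul_eq_mul, smul_eq_mul,
      show (t * v.1) ^ 2 + (t * v.2) ^ 2 = t ^ 2 * (v.1 ^ 2 + v.2 ^ 2) by ring,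
      Real.sqrt_mul (by positivity), Real.sqrt_sq ht.le]
  rw [proj, proj, h, Prod.smul_fst, Prod.smul_snd, smul_eq_mul, smul_eq_mul,
    mul_div_mul_left _ _ ht.ne', mul_div_mul_left _ _ ht.ne']

theorem exists_polar {v : ℝ × ℝ} (hv : v ≠ 0) :
    ∃ t > (0 : ℝ), ∃ x : ℝ, v = t • (Real.cos x, Real.sin x) := by
  have h : 0 < Real.sqrt (v.1 ^ 2 + v.2 ^ 2) := by
    apply Real.sqrt_pos.2
    by_contra! h
    apply hv
    ext
    · simp only [Prod.fst_zero]; nlinarith [sq_nonneg v.1, sq_nonneg v.2]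
    · simp only [Prod.snd_zero]; nlinarith [sq_nonneg v.1, sq_nonneg v.2]
  have h2 : proj v ∈ unitCircle := by
    have h3 := Real.sq_sqrt (show 0 ≤ v.1 ^ 2 + v.2 ^ 2 by positivity)
    have h4 : v.1 ^ 2 + v.2 ^ 2 ≠ 0 := (Real.sqrt_pos.1 h).ne'
    simp only [proj, unitCircle, Set.mem_ofPred_eq, div_pow, h3]
    field_simp
  obtain ⟨x, hx⟩ := exists_circlePoint h2
  refine ⟨_, h, x, ?_⟩
  rw [show (Real.cos x, Real.sin x) = proj v from hx.symm, proj]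
  ext <;> simp <;> field_simp

theorem pI_eq_image {P Q : RatFunc ℝ} {M : ℝ × ℝ →ₗ[ℝ] ℝ × ℝ} (hM : Function.Injective M)
    {ε : ℝ} {T : ℝ ≃o ℝ} {V : ℝ → ℝ × ℝ}
    (hV : ∀ x, M (V x) = (Real.cos x, Real.sin x) ∧ V x ≠ 0 ∧ proj (V x) = arcMap ε T x)
    (s : List SignType) :
    pI P Q s = arcMap ε T '' {x | HasUltimateSign (fun n => sol P Q n (V x)) s} := by
  rw [pI, initialValues_eq]
  ext p
  constructor
  · rintro ⟨v, ⟨hv, hs⟩, rfl⟩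
    obtain ⟨t, ht, x, hx⟩ := exists_polar (v := M v) (by rwa [Ne, map_eq_zero_iff M hM])
    have hvx : v = t • V x := hM (by rw [map_smul, (hV x).1, hx])
    refine ⟨x, hs.congr (Eventually.of_forall fun n => ?_), ?_⟩
    · rw [hvx, map_smul, smul_eq_mul, sign_mul, sign_pos ht, one_mul]
    · rw [hvx, proj_smul ht, (hV x).2.2]
  · rintro ⟨x, hx, rfl⟩
    exact ⟨V x, ⟨(hV x).2.1, hx⟩, (hV x).2.2⟩

/-- If the directions in suitable linear coordinates are classified by pairwise incompatible
words, then the sets of initial values are the corresponding arcs. -/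
theorem partition_of_classification {P Q : RatFunc ℝ} {M : ℝ × ℝ →ₗ[ℝ] ℝ × ℝ}
    (hM : Function.Injective M) {m : ℕ} (s : Fin m → List SignType) (A : Fin m → Set ℝ)
    (hA : ∀ i, ∀ x ∈ A i, ∀ v, M v = (Real.cos x, Real.sin x) →
      HasUltimateSign (fun n => sol P Q n v) (s i))
    (hcov : ∀ x, ∃ i, ∃ y ∈ A i, ∃ l : ℤ, x = y + l * (2 * Real.pi))
    (hinc : ∀ i j, i ≠ j → ∀ f, HasUltimateSign f (s i) → ¬ HasUltimateSign f (s j)) :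
    ∃ ε : ℝ, (ε = 1 ∨ ε = -1) ∧ ∃ T : ℝ ≃o ℝ, IsCircleLift T ∧
      (∀ i, pI P Q (s i) = arcMap ε T '' A i) ∧ PartitionsCircle fun i => pI P Q (s i) := by
  obtain ⟨ε, hε, T, hT, V, hV⟩ := exists_arcMap hM
  have hVeq : ∀ {x y}, arcMap ε T x = arcMap ε T y → V x = V y := fun {x y} h => by
    obtain ⟨l, hl⟩ := (arcMap_eq_iff hε hT).1 h
    apply hM
    rw [(hV x).1, (hV y).1, hl, Real.cos_add_int_mul_two_pi, Real.sin_add_int_mul_two_pi]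
  have hpI : ∀ i, pI P Q (s i) = arcMap ε T '' A i := fun i => by
    rw [pI_eq_image hM hV]
    apply Set.Subset.antisymm
    · rintro _ ⟨x, hx, rfl⟩
      obtain ⟨j, y, hy, hxy⟩ := hcov x
      have he := (arcMap_eq_iff hε hT).2 hxy
      have h1 := hA j y hy (V x) (by rw [hVeq he]; exact (hV y).1)
      have hij : i = j := by
        by_contra hij
        exact hinc i j hij _ hx h1
      subst hij
      exact ⟨y, hy, he.symm⟩
    · exact Set.image_mono fun x hx => hA i x hx _ (hV x).1
  refine ⟨ε, hε, T, hT, hpI, fun i j hij => ?_, ?_⟩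
  · rw [Function.onFun, Set.disjoint_left, pI_eq_image hM hV, pI_eq_image hM hV]
    rintro _ ⟨x, hx, rfl⟩ ⟨y, hy, hyx⟩
    refine hinc i j hij _ hx ?_
    rw [← hVeq hyx]
    exact hy
  · rw [← range_arcMap hε T]
    ext p
    simp only [Set.mem_iUnion, hpI]
    constructor
    · rintro ⟨i, x, _, rfl⟩
      exact ⟨x, rfl⟩
    · rintro ⟨x, rfl⟩
      obtain ⟨j, y, hy, hxy⟩ := hcov x
      exact ⟨j, y, hy, ((arcMap_eq_iff hε hT).2 hxy).symm⟩

/-! ### Rescaled recurrences -/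

/-- The factor `c n` is the inverse of `P(0) ⋯ P(n-2)`, up to finitely many corrections. It turns
the coefficient of the middle term into `1` and that of the last into `Q(n) / (P(n) P(n-1))`. -/
theorem exists_normalForm {P Q : RatFunc ℝ} (hP : P ≠ 0) (hpos : RatHasUltimateSign P [1]) :
    ∃ c : ℕ → ℝ, (∀ n, 0 < c n) ∧ ∀ᶠ n : ℕ in atTop, ∀ v, c (n + 2) * sol P Q (n + 2) v =
      c (n + 1) * sol P Q (n + 1) v + val (normQ P Q) n * (c n * sol P Q n v) := by
  rw [RatHasUltimateSign, hasUltimateSign_one] at hpos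
  -- The finitely many indices with `P(n) ≤ 0` contribute the factor `1`, so that all `c n` are
  -- positive.
  set p : ℕ → ℝ := fun n => if 0 < val P n then (val P n)⁻¹ else 1 with hp
  have hp0 : ∀ n, 0 < p n := fun n => by
    rw [hp]
    simp only
    split_ifs with h
    · exact inv_pos.2 h
    · exact one_pos
  refine ⟨fun n => ∏ i ∈ Finset.range (n - 1), p i, fun n => Finset.prod_pos fun i _ => hp0 i, ?_⟩
  have hR := (tendsto_natCast_atTop_atTop (R := ℝ)).eventually (eventually_val_normQ (Q := Q) hP)
  obtain ⟨N, hN⟩ := eventually_atTop.1 (hpos.and hR)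
  refine eventually_atTop.2 ⟨N + 1, fun n hn v => ?_⟩
  obtain ⟨m, rfl⟩ : ∃ m, n = m + 1 := ⟨n - 1, by omega⟩
  have h0 := (hN m (by omega)).1
  have h1 := (hN (m + 1) (by omega)).1
  have h2 := (hN (m + 1) (by omega)).2
  have e1 : ((m + 1 : ℕ) : ℝ) - 1 = m := by push_cast; ring
  rw [e1] at h2
  rw [h2, sol_succ_succ]
  simp only [Nat.add_sub_cancel, show m + 1 + 2 - 1 = m + 1 + 1 by omega]
  rw [Finset.prod_range_succ, Finset.prod_range_succ]
  have q0 : p m = (val P m)⁻¹ := if_pos h0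
  have q1 : p (m + 1) = (val P ((m + 1 : ℕ) : ℝ))⁻¹ := if_pos h1
  rw [q0, q1]
  field_simp

/-- Multiplying the normal form by the products of `b` puts the factor `b (n-1) * b n` in front of
`R(n)`. By balancing, only the sign `σ` of `R(n)` is left. -/
theorem exists_balancedForm {P Q : RatFunc ℝ} (hP : P ≠ 0) (hpos : RatHasUltimateSign P [1])
    {b : ℕ → ℝ} (hb : ∀ n, 0 < b n)
    (hbR : ∀ᶠ n : ℕ in atTop, b n * b (n + 1) * |val (normQ P Q) ((n + 1 : ℕ) : ℝ)| = 1)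
    {σ : ℝ} (hσ : ∀ᶠ n : ℕ in atTop, val (normQ P Q) n = σ * |val (normQ P Q) n|) :
    ∃ c : ℕ → ℝ, (∀ n, 0 < c n) ∧ ∀ᶠ n : ℕ in atTop, ∀ v, c (n + 2) * sol P Q (n + 2) v =
      b n * (c (n + 1) * sol P Q (n + 1) v) + σ * (c n * sol P Q n v) := by
  obtain ⟨c, hc, hrec⟩ := exists_normalForm (Q := Q) hP hpos
  refine ⟨fun n => (∏ i ∈ Finset.range (n - 1), b i) * c n,
    fun n => mul_pos (Finset.prod_pos fun i _ => hb i) (hc n), ?_⟩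
  obtain ⟨N, hN⟩ := eventually_atTop.1 (hbR.and (hrec.and hσ))
  refine eventually_atTop.2 ⟨N + 1, fun n hn v => ?_⟩
  obtain ⟨m, rfl⟩ : ∃ m, n = m + 1 := ⟨n - 1, by omega⟩
  have h0 := (hN m (by omega)).1
  have h1 := (hN (m + 1) (by omega)).2.1 v
  have h2 := (hN (m + 1) (by omega)).2.2
  simp only [Nat.add_sub_cancel, show m + 1 + 2 - 1 = m + 1 + 1 by omega]
  rw [Finset.prod_range_succ, Finset.prod_range_succ, mul_assoc, h1, h2]
  linear_combination (∏ i ∈ Finset.range m, b i) * σ * (c (m + 1) * sol P Q (m + 1) v) * h0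

theorem sign_mul_sol {P Q : RatFunc ℝ} {c : ℕ → ℝ} (hc : ∀ n, 0 < c n) (n : ℕ) (v : ℝ × ℝ) :
    SignType.sign (c n * sol P Q n v) = SignType.sign (sol P Q n v) := by
  rw [sign_mul, sign_pos (hc n), one_mul]

theorem eventually_of_shift {p : ℕ → Prop} (N : ℕ) (h : ∀ᶠ n in atTop, p (N + n)) :
    ∀ᶠ n in atTop, p n := by
  obtain ⟨K, hK⟩ := eventually_atTop.1 h
  refine eventually_atTop.2 ⟨N + K, fun n hn => ?_⟩
  have := hK (n - N) (by omega)
  rwa [show N + (n - N) = n by omega] at this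

/-- The solution of `u (n + 2) = A n * u (n + 1) + B n * u n` with initial value `(x, y)`. -/
def recSol (A B : ℕ → ℝ) (x y : ℝ) : ℕ → ℝ
  | 0 => x
  | 1 => y
  | n + 2 => A n * recSol A B x y (n + 1) + B n * recSol A B x y n

theorem eq_recSol {A B g : ℕ → ℝ} (hg : ∀ n, g (n + 2) = A n * g (n + 1) + B n * g n)
    {x₁ y₁ x₂ y₂ a b : ℝ} (h0 : g 0 = a * x₁ + b * x₂) (h1 : g 1 = a * y₁ + b * y₂) (n : ℕ) :
    g n = a * recSol A B x₁ y₁ n + b * recSol A B x₂ y₂ n := by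
  induction n using Nat.twoStepInduction with
  | zero => exact h0
  | one => exact h1
  | more n i1 i2 => rw [hg, i1, i2, recSol, recSol]; ring

/-! ### Non-oscillating recurrences -/

/-- The inequality on `y` makes `y` a lower barrier for the ratios of the solution `u` that starts
with ratio `y 0`, so `u` stays positive. For a second solution `w` the quotient `w / u` increases
strictly. A solution `a u + b w` is then positive for large `n` according to the behaviour of `a + b
(w/u)` at the limit of the quotient, and a tie is broken by the approach from below. -/
theorem exists_lex_coordinates {q y : ℕ → ℝ} (hq : ∀ n, 0 < q n) (hy : ∀ n, 0 < y n)
    (hqy : ∀ n, q n ≤ y n * (1 - y (n + 1))) {G : ℕ → (ℝ × ℝ →ₗ[ℝ] ℝ)}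
    (hG : ∀ n v, G (n + 2) v = G (n + 1) v - q n * G n v)
    (hinj : ∀ v, G 0 v = 0 → G 1 v = 0 → v = 0) :
    ∃ M : ℝ × ℝ →ₗ[ℝ] ℝ × ℝ, Function.Injective M ∧
      ∀ v, (0 < (M v).2 ∨ (M v).2 = 0 ∧ 0 < (M v).1) → ∀ᶠ n in atTop, 0 < G n v := by
  set u := recSol (fun _ => 1) (fun n => -q n) 1 (y 0) with hu
  set w := recSol (fun _ => 1) (fun n => -q n) 0 1 with hw
  have urec : ∀ n, u (n + 2) = u (n + 1) - q n * u n := fun n => by rw [hu, recSol]; ring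
  have wrec : ∀ n, w (n + 2) = w (n + 1) - q n * w n := fun n => by rw [hw, recSol]; ring
  have hupos : ∀ n, 0 < u n ∧ y n * u n ≤ u (n + 1) := fun n => by
    induction n with
    | zero => exact ⟨one_pos, by rw [hu]; simp [recSol]⟩
    | succ n ih =>
      have h1 : 0 < u (n + 1) := (mul_pos (hy n) ih.1).trans_le ih.2
      refine ⟨h1, ?_⟩
      rw [urec]
      have h2 := mul_le_mul_of_nonneg_right (hqy n) ih.1.le
      have h3 : 0 < 1 - y (n + 1) := by
        by_contra! h
        have := mul_nonpos_of_nonneg_of_nonpos (hy n).le h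
        linarith [hq n, hqy n]
      have h4 := mul_le_mul_of_nonneg_left ih.2 h3.le
      nlinarith
  -- The Casoratian is multiplied by `q n > 0` at each step.
  have hW : ∀ n, 0 < w (n + 1) * u n - w n * u (n + 1) := fun n => by
    induction n with
    | zero => rw [hu, hw]; simp [recSol]
    | succ n ih =>
      rw [wrec, urec]
      have := mul_pos (hq n) ih
      linarith
  set x : ℕ → ℝ := fun n => w n / u n with hx
  have hmono : StrictMono x := strictMono_nat_of_lt_succ fun n => by
    rw [hx]
    simp only
    rw [div_lt_div_iff₀ (hupos n).1 (hupos (n + 1)).1]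
    linarith [hW n]
  have hGuw : ∀ v n, G n v = u n * (G 0 v + (G 1 v - y 0 * G 0 v) * x n) := fun v n => by
    have h1 := eq_recSol (g := fun n => G n v) (A := fun _ => 1) (B := fun n => -q n)
      (fun n => by rw [hG]; ring) (x₁ := 1) (y₁ := y 0) (x₂ := 0) (y₂ := 1) (a := G 0 v)
      (b := G 1 v - y 0 * G 0 v) (by ring) (by ring) n
    rw [h1, ← hu, ← hw, hx]
    have := (hupos n).1.ne'
    field_simp
  set a : ℝ × ℝ →ₗ[ℝ] ℝ := G 0 with ha
  set b : ℝ × ℝ →ₗ[ℝ] ℝ := G 1 - y 0 • G 0 with hb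
  have hGab : ∀ v n, G n v = u n * (a v + b v * x n) := fun v n => by
    rw [hGuw]; simp [ha, hb]
  have hab : ∀ v, a v = 0 → b v = 0 → v = 0 := fun v h1 h2 => by
    refine hinj v h1 ?_
    simp only [hb, LinearMap.sub_apply, LinearMap.smul_apply, smul_eq_mul] at h2
    rw [show G 0 v = 0 from h1] at h2
    linarith
  rcases tendsto_atTop_of_monotone hmono.monotone with hlim | ⟨l, hl⟩
  -- Infinite limit: the sign of `b` decides, and that of `a` if `b = 0`.
  · refine ⟨a.prod b, fun v v' h => ?_, fun v hv => ?_⟩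
    · rw [← sub_eq_zero]
      have h1 := congrArg Prod.fst h
      have h2 := congrArg Prod.snd h
      exact hab _ (by rw [map_sub, sub_eq_zero]; exact h1) (by rw [map_sub, sub_eq_zero]; exact h2)
    · rcases hv with h | ⟨h, h'⟩
      · have h1 : Tendsto (fun n => a v + b v * x n) atTop atTop :=
          tendsto_atTop_add_const_left _ _ (hlim.const_mul_atTop (by exact h))
        filter_upwards [h1.eventually_gt_atTop 0] with n hn
        rw [hGab]
        exact mul_pos (hupos n).1 hn
      · refine Eventually.of_forall fun n => ?_
        have h2 : b v = 0 := h
        have h3 : 0 < a v := h'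
        rw [hGab, h2, zero_mul, add_zero]
        exact mul_pos (hupos n).1 h3
  · have hxl : ∀ n, x n < l := fun n =>
      (hmono n.lt_succ_self).trans_le (hmono.monotone.ge_of_tendsto hl _)
    -- Finite limit `l`: the sign of `a + l b` decides. If it vanishes, `a + b x = -b (l - x)` has
    -- the sign of `-b`.
    refine ⟨(-b).prod (a + l • b), fun v v' h => ?_, fun v hv => ?_⟩
    · rw [← sub_eq_zero]
      have h1 : -b v = -b v' := congrArg Prod.fst h
      have h2 : a v + l * b v = a v' + l * b v' := congrArg Prod.snd h
      have h3 : b v = b v' := neg_injective h1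
      rw [h3] at h2
      exact hab _ (by rw [map_sub]; linarith) (by rw [map_sub]; linarith)
    · rcases hv with h | ⟨h, h'⟩
      · have h1 : Tendsto (fun n => a v + b v * x n) atTop (𝓝 (a v + b v * l)) :=
          (hl.const_mul _).const_add _
        have h2 : 0 < a v + b v * l := by
          have : 0 < a v + l * b v := h
          linarith
        filter_upwards [h1.eventually_const_lt h2] with n hn
        rw [hGab]
        exact mul_pos (hupos n).1 hn
      · refine Eventually.of_forall fun n => ?_
        have h2 : a v + l * b v = 0 := h
        have h3 : 0 < -b v := h'
        rw [hGab]
        apply mul_pos (hupos n).1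
        have := mul_pos h3 (sub_pos.2 (hxl n))
        linarith

/-! ### Alternating recurrences -/

/-- Let `u`, `w` start with `(1, 0)` and `(0, 1)`, so that `g n = w n * (x n * g 0 + g 1)` with `x =
u / w` and `w > 0` from index `1` on. The Casoratian is alternately `-1` and `1`. Hence `x`
increases to `β` along odd indices and decreases to `α` along even ones, with gaps `1 / (w (2m+1) *
w (2m+2))`. So `β < α` amounts to boundedness of these products, that is, to summability of `b`. -/
theorem exists_alternating_limits {b : ℕ → ℝ} (hb : ∀ n, 0 < b n) :
    ∃ α β : ℝ, β ≤ α ∧ (Summable b ↔ β < α) ∧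
      ∀ g : ℕ → ℝ, (∀ n, g (n + 2) = b n * g (n + 1) + g n) →
        ((0 < α * g 0 + g 1 → 0 < β * g 0 + g 1 → ∀ᶠ n in atTop, 0 < g n) ∧
        (0 < g 0 → 0 ≤ α * g 0 + g 1 → β * g 0 + g 1 ≤ 0 →
          ∀ᶠ n in atTop, SignType.sign (g n) = loxSign 0 n)) := by
  set u := recSol b (fun _ => 1) 1 0 with hu
  set w := recSol b (fun _ => 1) 0 1 with hw
  have urec : ∀ n, u (n + 2) = b n * u (n + 1) + u n := fun n => by rw [hu, recSol]; ring
  have wrec : ∀ n, w (n + 2) = b n * w (n + 1) + w n := fun n => by rw [hw, recSol]; ring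
  have w0 : w 0 = 0 := rfl
  have w1 : w 1 = 1 := rfl
  have hwpos : ∀ n, 0 < w (n + 1) := fun n => by
    induction n using Nat.twoStepInduction with
    | zero => rw [w1]; exact one_pos
    | one => rw [wrec, w0, w1]; linarith [hb 0]
    | more n h1 h2 => rw [wrec]; exact add_pos (mul_pos (hb _) h2) h1
  have hW : ∀ n, u (n + 1) * w n - u n * w (n + 1) = -(-1) ^ n := fun n => by
    induction n with
    | zero => rw [hu, hw]; simp [recSol]
    | succ n ih => rw [wrec, urec, pow_succ]; linear_combination -ih
  have hW0 : ∀ m, u (2 * m + 1) * w (2 * m) - u (2 * m) * w (2 * m + 1) = -1 := fun m => by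
    rw [hW, pow_mul]; norm_num
  have hW1 : ∀ m, u (2 * m + 2) * w (2 * m + 1) - u (2 * m + 1) * w (2 * m + 2) = 1 := fun m => by
    rw [hW, pow_succ, pow_mul]; norm_num
  set x : ℕ → ℝ := fun n => u n / w n with hx
  have hdiff : ∀ m, x (2 * m + 2) - x (2 * m + 1) = 1 / (w (2 * m + 1) * w (2 * m + 2)) := fun m => by
    have a1 := hwpos (2 * m)
    have a2 := hwpos (2 * m + 1)
    rw [hx]
    simp only
    rw [div_sub_div _ _ a2.ne' a1.ne', ← hW1 m]
    congr 1 <;> ring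
  set E : ℕ → ℝ := fun m => x (2 * m + 2) with hE
  set O : ℕ → ℝ := fun m => x (2 * m + 1) with hO
  have hEanti : StrictAnti E := strictAnti_nat_of_succ_lt fun m => by
    have a1 := hwpos (2 * m + 1)
    have a2 := hwpos (2 * m + 3)
    rw [hE, hx]
    simp only
    rw [show 2 * (m + 1) + 2 = 2 * m + 4 by ring, div_lt_div_iff₀ a2 a1,
      urec (2 * m + 2), wrec (2 * m + 2)]
    have h2 := hW0 (m + 1)
    rw [show 2 * (m + 1) = 2 * m + 2 by ring] at h2
    have h3 := hb (2 * m + 2)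
    have : b (2 * m + 2) * (u (2 * m + 2 + 1) * w (2 * m + 2) - u (2 * m + 2) * w (2 * m + 2 + 1))
      = - b (2 * m + 2) := by rw [h2]; ring
    linarith
  have hOmono : StrictMono O := strictMono_nat_of_lt_succ fun m => by
    have a1 := hwpos (2 * m)
    have a2 := hwpos (2 * m + 2)
    rw [hO, hx]
    simp only
    rw [show 2 * (m + 1) + 1 = 2 * m + 1 + 2 by ring, div_lt_div_iff₀ a1 a2,
      urec (2 * m + 1), wrec (2 * m + 1)]
    have h2 := hW1 m
    have h3 := hb (2 * m + 1)
    have : b (2 * m + 1) * (u (2 * m + 2) * w (2 * m + 1) - u (2 * m + 1) * w (2 * m + 2))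
      = b (2 * m + 1) := by rw [h2]; ring
    have e : 2 * m + 1 + 1 = 2 * m + 2 := by ring
    rw [e]
    linarith
  have hOE : ∀ m, O m < E m := fun m => by
    have a1 := hwpos (2 * m)
    have a2 := hwpos (2 * m + 1)
    have := hdiff m
    have h2 : 0 < 1 / (w (2 * m + 1) * w (2 * m + 2)) := by positivity
    rw [← this] at h2
    exact sub_pos.1 h2
  obtain ⟨α, hα⟩ : ∃ α, Tendsto E atTop (𝓝 α) :=
    ⟨_, tendsto_atTop_ciInf hEanti.antitone ⟨O 0, by
      rintro _ ⟨m, rfl⟩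
      exact (hOmono.monotone (Nat.zero_le m)).trans (hOE m).le⟩⟩
  obtain ⟨β, hβ⟩ : ∃ β, Tendsto O atTop (𝓝 β) :=
    ⟨_, tendsto_atTop_ciSup hOmono.monotone ⟨E 0, by
      rintro _ ⟨m, rfl⟩
      exact (hOE m).le.trans (hEanti.antitone (Nat.zero_le m))⟩⟩
  have hEα : ∀ m, α < E m := fun m =>
    (hEanti.antitone.le_of_tendsto hα _).trans_lt (hEanti m.lt_succ_self)
  have hOβ : ∀ m, O m < β := fun m =>
    (hOmono m.lt_succ_self).trans_le (hOmono.monotone.ge_of_tendsto hβ _)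
  have hβα : β ≤ α := le_of_tendsto_of_tendsto' hβ hα fun m => (hOE m).le
  refine ⟨α, β, hβα, ⟨fun hs => ?_, fun hlt => ?_⟩, fun g hg => ?_⟩
  -- Each step enlarges the bound on consecutive terms by at most the factor `1 + b n ≤ exp (b n)`.
  · have hbd : ∀ n, w n ≤ Real.exp (∑ i ∈ Finset.range n, b i) ∧
        w (n + 1) ≤ Real.exp (∑ i ∈ Finset.range n, b i) := fun n => by
      induction n with
      | zero => simp [w0, w1]
      | succ n ih =>
        rw [Finset.sum_range_succ, Real.exp_add]
        have h1 := Real.add_one_le_exp (b n)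
        have h2 := Real.exp_pos (∑ i ∈ Finset.range n, b i)
        have h3 := hb n
        refine ⟨?_, ?_⟩
        · nlinarith [ih.2]
        · rw [wrec]
          nlinarith [ih.1, ih.2, mul_le_mul_of_nonneg_left ih.2 h3.le]
    set V := Real.exp (∑' i, b i) with hV
    have hVb : ∀ n, w n ≤ V := fun n =>
      (hbd n).1.trans (Real.exp_le_exp.2 (hs.sum_le_tsum _ fun i _ => (hb i).le))
    have hVpos : 0 < V := Real.exp_pos _
    have h1 : Tendsto (fun m => E m - O m) atTop (𝓝 (α - β)) := hα.sub hβ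
    have h2 : 1 / (V * V) ≤ α - β := ge_of_tendsto' h1 fun m => by
      rw [show E m - O m = _ from hdiff m]
      have a1 := hwpos (2 * m)
      have a2 := hwpos (2 * m + 1)
      exact one_div_le_one_div_of_le (by positivity) (mul_le_mul (hVb _) (hVb _) a2.le hVpos.le)
    have h3 : 0 < 1 / (V * V) := by positivity
    linarith
  -- Conversely `w (n+1) ≥ κ`, and `w (n+1) * w (n+2)` exceeds `w n * w (n+1)` by `b n * w (n+1) ^
  -- 2`. The bounded products thus dominate the partial sums of `b`.
  · set κ := min 1 (b 0) with hκ
    have hκ0 : 0 < κ := lt_min one_pos (hb 0)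
    have hκw : ∀ n, κ ≤ w (n + 1) := fun n => by
      induction n using Nat.twoStepInduction with
      | zero => rw [w1]; exact min_le_left _ _
      | one => rw [wrec, w0, w1]; simp [hκ]
      | more n h1 h2 => rw [wrec]; exact h1.trans (le_add_of_nonneg_left (mul_pos (hb _) (hwpos _)).le)
    have hsum : ∀ n, κ ^ 2 * ∑ i ∈ Finset.range n, b i ≤ w n * w (n + 1) := fun n => by
      induction n with
      | zero => simp [w0]
      | succ n ih =>
        rw [Finset.sum_range_succ, mul_add, wrec]
        have h1 : κ ^ 2 ≤ w (n + 1) ^ 2 := pow_le_pow_left₀ hκ0.le (hκw n) 2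
        nlinarith [hb n, mul_le_mul_of_nonneg_left h1 (hb n).le]
    have hp : ∀ m, w (2 * m + 1) * w (2 * m + 2) ≤ 1 / (α - β) := fun m => by
      have a1 := hwpos (2 * m)
      have a2 := hwpos (2 * m + 1)
      have a3 := sub_pos.2 hlt
      rw [le_div_iff₀ a3]
      have h1 : α - β ≤ 1 / (w (2 * m + 1) * w (2 * m + 2)) := by
        rw [← hdiff m]
        exact sub_le_sub (hEα m).le (hOβ m).le
      rw [le_div_iff₀ (by positivity)] at h1
      linarith
    refine summable_of_sum_range_le (c := 1 / (α - β) / κ ^ 2) (fun n => (hb n).le) fun n => ?_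
    rw [le_div_iff₀ (by positivity)]
    have h1 : ∑ i ∈ Finset.range n, b i ≤ ∑ i ∈ Finset.range (2 * n + 1), b i :=
      Finset.sum_le_sum_of_subset_of_nonneg (Finset.range_mono (by omega)) fun i _ _ => (hb i).le
    have h2 := (hsum (2 * n + 1)).trans (hp n)
    have h3 := mul_le_mul_of_nonneg_left h1 (sq_nonneg κ)
    linarith
  · have hgx : ∀ n, g (n + 1) = w (n + 1) * (x (n + 1) * g 0 + g 1) := fun n => by
      have h1 := eq_recSol (g := g) (A := b) (B := fun _ => 1) (fun n => by rw [hg]; ring)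
        (x₁ := 1) (y₁ := 0) (x₂ := 0) (y₂ := 1) (a := g 0) (b := g 1) (by ring) (by ring) (n + 1)
      rw [h1, ← hu, ← hw, hx]
      have := (hwpos n).ne'
      field_simp
    have heo : ∀ n, n = 0 ∨ (∃ m, n = 2 * m + 1) ∨ ∃ m, n = 2 * m + 2 := fun n => by
      rcases Nat.even_or_odd' n with ⟨m, h | h⟩
      · rcases Nat.eq_zero_or_pos m with h0 | h0
        · left; omega
        · right; right; exact ⟨m - 1, by omega⟩
      · right; left; exact ⟨m, h⟩
    refine ⟨fun h1 h2 => ?_, fun h0 h1 h2 => ?_⟩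
    · have t1 := ((hα.mul_const (g 0)).add_const (g 1)).eventually_const_lt h1
      have t2 := ((hβ.mul_const (g 0)).add_const (g 1)).eventually_const_lt h2
      obtain ⟨K, hK⟩ := eventually_atTop.1 (t1.and t2)
      refine eventually_atTop.2 ⟨2 * K + 2, fun n hn => ?_⟩
      rcases heo n with h | ⟨m, rfl⟩ | ⟨m, rfl⟩
      · omega
      · rw [hgx]; exact mul_pos (hwpos _) (hK m (by omega)).2
      · rw [hgx]; exact mul_pos (hwpos _) (hK m (by omega)).1
    · refine eventually_atTop.2 ⟨1, fun n hn => ?_⟩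
      rcases heo n with h | ⟨m, rfl⟩ | ⟨m, rfl⟩
      · omega
      · have : loxSign 0 (2 * m + 1) = -1 := by
          simp [loxSign, show (2 * m + 1) % 2 = 1 by omega]
        rw [this, sign_eq_neg_one_iff, hgx]
        apply mul_neg_of_pos_of_neg (hwpos _)
        have := mul_lt_mul_of_pos_right (hOβ m) h0
        exact lt_of_lt_of_le (add_lt_add_left this _) h2
      · have : loxSign 0 (2 * m + 2) = 1 := by
          simp [loxSign]
        rw [this, sign_eq_one_iff, hgx]
        apply mul_pos (hwpos _)
        have := mul_lt_mul_of_pos_right (hEα m) h0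
        exact lt_of_le_of_lt h1 (add_lt_add_left this _)

theorem exists_mod_two_pi_Ico (x : ℝ) :
    ∃ y ∈ Set.Ico 0 (2 * Real.pi), ∃ l : ℤ, x = y + l * (2 * Real.pi) := by
  obtain ⟨l, hl, -⟩ := existsUnique_sub_zsmul_mem_Ico Real.two_pi_pos x 0
  rw [zero_add, zsmul_eq_mul] at hl
  exact ⟨_, hl, l, by ring⟩

theorem exists_mod_two_pi_Ioc (x : ℝ) :
    ∃ y ∈ Set.Ioc 0 (2 * Real.pi), ∃ l : ℤ, x = y + l * (2 * Real.pi) := by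
  obtain ⟨l, hl, -⟩ := existsUnique_sub_zsmul_mem_Ioc Real.two_pi_pos x 0
  rw [zero_add, zsmul_eq_mul] at hl
  exact ⟨_, hl, l, by ring⟩

theorem normQ_ne_zero {P Q : RatFunc ℝ} (hP : P ≠ 0) (hQ : Q ≠ 0) : normQ P Q ≠ 0 :=
  div_ne_zero hQ (mul_ne_zero hP (shift_ne_zero hP))

/-! ### The loxodromic types -/

theorem loxSign_one (n : ℕ) : loxSign 1 n = -loxSign 0 n := by
  unfold loxSign
  split_ifs <;> rfl

theorem exists_lox_functionals {P Q : RatFunc ℝ} (hP : P ≠ 0) (hQ : NoZerosOrPoles Q)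
    (hpos : RatHasUltimateSign P [1]) (hR : RatHasUltimateSign (normQ P Q) [1]) :
    ∃ (X Y : ℝ × ℝ →ₗ[ℝ] ℝ) (α β : ℝ), (∀ v, X v = 0 → Y v = 0 → v = 0) ∧ β ≤ α ∧
      (2 < (normQ P Q).intDegree ↔ β < α) ∧
      (∀ v, 0 < α * X v + Y v → 0 < β * X v + Y v →
        HasUltimateSign (fun n => sol P Q n v) (loxWord 2)) ∧
      (∀ v, α * X v + Y v < 0 → β * X v + Y v < 0 →
        HasUltimateSign (fun n => sol P Q n v) (loxWord 3)) ∧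
      (∀ v, 0 < X v → 0 ≤ α * X v + Y v → β * X v + Y v ≤ 0 →
        HasUltimateSign (fun n => sol P Q n v) (loxWord 0)) ∧
      ∀ v, X v < 0 → α * X v + Y v ≤ 0 → 0 ≤ β * X v + Y v →
        HasUltimateSign (fun n => sol P Q n v) (loxWord 1) := by
  have hR0 := normQ_ne_zero hP (ne_zero_of_noZerosOrPoles hQ)
  obtain ⟨b, hb, hb1, hb2⟩ := exists_balanced hR0
  rw [RatHasUltimateSign, hasUltimateSign_one] at hR
  obtain ⟨c, hc, hrec⟩ := exists_balancedForm (σ := 1) hP hpos hb hb1 (by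
    filter_upwards [hR] with n hn
    rw [abs_of_pos hn, one_mul])
  obtain ⟨N, hN⟩ := eventually_atTop.1 hrec
  -- Starting at an even index keeps the parity of `n`, on which the alternating words depend.
  set K := 2 * N with hK
  obtain ⟨α, β, hβα, hsum, hcl⟩ := exists_alternating_limits (b := fun n => b (K + n))
    fun n => hb _
  set g : ℝ × ℝ → ℕ → ℝ := fun v n => c (K + n) * sol P Q (K + n) v with hg
  have hgrec : ∀ v n, g v (n + 2) = b (K + n) * g v (n + 1) + g v n := fun v n => by
    have := hN (K + n) (by omega) v
    rw [one_mul] at this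
    exact this
  have hsign : ∀ v n, SignType.sign (g v n) = SignType.sign (sol P Q (K + n) v) := fun v n =>
    sign_mul_sol hc _ v
  have key2 : ∀ v, 0 < α * g v 0 + g v 1 → 0 < β * g v 0 + g v 1 →
      ∀ᶠ n in atTop, 0 < sol P Q n v := fun v h1 h2 => by
    refine eventually_of_shift K ?_
    filter_upwards [(hcl _ (hgrec v)).1 h1 h2] with n hn
    rwa [← sign_eq_one_iff, ← hsign, sign_eq_one_iff]
  have key0 : ∀ v, 0 < g v 0 → 0 ≤ α * g v 0 + g v 1 → β * g v 0 + g v 1 ≤ 0 →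
      ∀ᶠ n in atTop, SignType.sign (sol P Q n v) = loxSign 0 n := fun v h0 h1 h2 => by
    refine eventually_of_shift K ?_
    filter_upwards [(hcl _ (hgrec v)).2 h0 h1 h2] with n hn
    rw [← hsign, hn, loxSign, loxSign, hK, show (2 * N + n) % 2 = n % 2 by omega]
  have hgneg : ∀ v n, g (-v) n = -g v n := fun v n => by simp [hg]
  refine ⟨c K • sol P Q K, c (K + 1) • sol P Q (K + 1), α, β, fun v h1 h2 => ?_, hβα, ?_,
    fun v h1 h2 => ?_, fun v h1 h2 => ?_, fun v h0 h1 h2 => ?_, fun v h0 h1 h2 => ?_⟩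
  · exact eq_zero_of_sol_eq_zero hQ K ((mul_eq_zero.1 h1).resolve_left (hc _).ne')
      ((mul_eq_zero.1 h2).resolve_left (hc _).ne')
  · rw [← hsum]
    constructor
    · intro hd
      exact (balanced_summable hR0 hd hb hb2).comp_injective (add_right_injective K)
    · intro hs
      by_contra! hd
      have hs' : Summable b := by
        rw [← summable_nat_add_iff K]
        simpa [add_comm] using hs
      obtain ⟨c', hc', hlow⟩ := balanced_lower_bound hR0 hd hb hb2
      refine Real.not_summable_one_div_natCast ?_
      have h1 : Summable fun n : ℕ => c' / (n : ℝ) := by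
        refine Summable.of_norm_bounded_eventually_nat hs' ?_
        filter_upwards [hlow] with n hn
        rwa [Real.norm_of_nonneg (by positivity)]
      have h2 := h1.mul_left c'⁻¹
      refine h2.congr fun n => ?_
      field_simp
  · rw [show loxWord 2 = [1] from rfl, hasUltimateSign_one]
    exact key2 v h1 h2
  · rw [show loxWord 3 = [-1] from rfl, hasUltimateSign_neg_one]
    have := key2 (-v) (by rw [hgneg, hgneg]; change α * g v 0 + g v 1 < 0 at h1; linarith)
      (by rw [hgneg, hgneg]; change β * g v 0 + g v 1 < 0 at h2; linarith)
    simpa using this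
  · rw [hasUltimateSign_loxWord]
    exact key0 v h0 h1 h2
  · rw [hasUltimateSign_loxWord]
    change g v 0 < 0 at h0
    change α * g v 0 + g v 1 ≤ 0 at h1
    change 0 ≤ β * g v 0 + g v 1 at h2
    have := key0 (-v) (by rw [hgneg]; linarith) (by rw [hgneg, hgneg]; linarith)
      (by rw [hgneg, hgneg]; linarith)
    filter_upwards [this] with n hn
    rw [loxSign_one, ← hn, map_neg, Left.sign_neg, neg_neg]

theorem fin_four_words (P Q : RatFunc ℝ) : (fun i => pI P Q (loxWord i)) =
    ![pI P Q [1, -1], pI P Q [-1, 1], pI P Q [1], pI P Q [-1]] := by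
  funext i
  fin_cases i <;> rfl

/-- For `β < α` the two functionals `α X + Y` and `β X + Y` are coordinates. The open first and
third quadrants give constant signs; the closed second and fourth ones give alternating signs. -/
theorem inftyO_loxodromic {P Q : RatFunc ℝ} (hP : P ≠ 0) (hQ : NoZerosOrPoles Q)
    (hpos : RatHasUltimateSign P [1]) (h : IsInftyOLoxodromic P Q) :
    PartitionsCircle ![pI P Q [1, -1], pI P Q [-1, 1], pI P Q [1], pI P Q [-1]] ∧
      IsClosedArc (pI P Q [1, -1]) ∧ IsClosedArc (pI P Q [-1, 1]) ∧
      IsOpenArc (pI P Q [1]) ∧ IsOpenArc (pI P Q [-1]) := by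
  obtain ⟨X, Y, α, β, hinj, -, hdeg, c2, c3, c0, c1⟩ := exists_lox_functionals hP hQ hpos h.1
  have hlt := hdeg.1 h.2
  have hpi := Real.pi_pos
  have hMinj : Function.Injective ((α • X + Y).prod (β • X + Y)) := fun v v' hv => by
    rw [← sub_eq_zero]
    have h1 : α * X v + Y v = α * X v' + Y v' := congrArg Prod.fst hv
    have h2 : β * X v + Y v = β * X v' + Y v' := congrArg Prod.snd hv
    have h3 : X v = X v' := by
      have : (α - β) * (X v - X v') = 0 := by linarith
      exact sub_eq_zero.1 ((mul_eq_zero.1 this).resolve_left (sub_pos.2 hlt).ne')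
    rw [h3] at h1
    exact hinj _ (by rw [map_sub, h3, sub_self]) (by rw [map_sub]; linarith)
  obtain ⟨ε, hε, T, hT, hpI, hpart⟩ := partition_of_classification (P := P) (Q := Q) hMinj loxWord
    ![Set.Icc (3 * Real.pi / 2) (2 * Real.pi), Set.Icc (Real.pi / 2) Real.pi,
      Set.Ioo 0 (Real.pi / 2), Set.Ioo Real.pi (3 * Real.pi / 2)]
    (fun i x hx v hv => by
      have hv1 : α * X v + Y v = Real.cos x := congrArg Prod.fst hv
      have hv2 : β * X v + Y v = Real.sin x := congrArg Prod.snd hv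
      have hX : (α - β) * X v = Real.cos x - Real.sin x := by linarith
      have hαβ := sub_pos.2 hlt
      have hsq := Real.sin_sq_add_cos_sq x
      fin_cases i
      · have hx : x ∈ Set.Icc (3 * Real.pi / 2) (2 * Real.pi) := hx
        have hc : 0 ≤ Real.cos x := by
          rw [← Real.cos_sub_two_pi]
          exact Real.cos_nonneg_of_mem_Icc ⟨by linarith [hx.1], by linarith [hx.2]⟩
        have hs : Real.sin x ≤ 0 := by
          rw [← Real.sin_sub_two_pi]
          exact Real.sin_nonpos_of_nonpos_of_neg_pi_le (by linarith [hx.2]) (by linarith [hx.1])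
        have : 0 < Real.cos x - Real.sin x := by
          by_contra! h
          have e1 : Real.cos x = 0 := by linarith
          have e2 : Real.sin x = 0 := by linarith
          rw [e1, e2] at hsq
          norm_num at hsq
        exact c0 v (pos_of_mul_pos_right (hX ▸ this) hαβ.le) (by linarith) (by linarith)
      · have hx : x ∈ Set.Icc (Real.pi / 2) Real.pi := hx
        have hc : Real.cos x ≤ 0 :=
          Real.cos_nonpos_of_pi_div_two_le_of_le hx.1 (by linarith [hx.2])
        have hs : 0 ≤ Real.sin x := Real.sin_nonneg_of_nonneg_of_le_pi (by linarith [hx.1]) hx.2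
        have : 0 < (α - β) * (-X v) := by
          by_contra! h
          have e1 : Real.cos x = 0 := by linarith
          have e2 : Real.sin x = 0 := by linarith
          rw [e1, e2] at hsq
          norm_num at hsq
        exact c1 v (neg_pos.1 (pos_of_mul_pos_right this hαβ.le)) (by linarith) (by linarith)
      · have hx : x ∈ Set.Ioo 0 (Real.pi / 2) := hx
        exact c2 v (hv1 ▸ Real.cos_pos_of_mem_Ioo ⟨by linarith [hx.1], hx.2⟩)
          (hv2 ▸ Real.sin_pos_of_pos_of_lt_pi hx.1 (by linarith [hx.2]))
      · have hx : x ∈ Set.Ioo Real.pi (3 * Real.pi / 2) := hx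
        refine c3 v ?_ ?_
        · rw [hv1]
          exact Real.cos_neg_of_pi_div_two_lt_of_lt (by linarith [hx.1]) (by linarith [hx.2])
        · rw [hv2, ← Real.sin_sub_two_pi]
          exact Real.sin_neg_of_neg_of_neg_pi_lt (by linarith [hx.2]) (by linarith [hx.1]))
    (fun x => by
      obtain ⟨y, hy, l, hl⟩ := exists_mod_two_pi_Ioc x
      rcases lt_or_ge y (Real.pi / 2) with h1 | h1
      · exact ⟨2, y, ⟨hy.1, h1⟩, l, hl⟩
      rcases le_or_gt y Real.pi with h2 | h2
      · exact ⟨1, y, ⟨h1, h2⟩, l, hl⟩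
      rcases lt_or_ge y (3 * Real.pi / 2) with h3 | h3
      · exact ⟨3, y, ⟨h2, h3⟩, l, hl⟩
      · exact ⟨0, y, ⟨h3, hy.2⟩, l, hl⟩)
    (fun i j hij f => loxWord_incompatible hij)
  rw [fin_four_words] at hpart
  refine ⟨hpart, ?_, ?_, ?_, ?_⟩
  · rw [show pI P Q [1, -1] = _ from hpI 0]
    exact isClosedArc_arcMap hε hT (by linarith) (by linarith)
  · rw [show pI P Q [-1, 1] = _ from hpI 1]
    exact isClosedArc_arcMap hε hT (by linarith) (by linarith)
  · rw [show pI P Q [1] = _ from hpI 2]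
    exact isOpenArc_arcMap hε hT (by linarith) (by linarith)
  · rw [show pI P Q [-1] = _ from hpI 3]
    exact isOpenArc_arcMap hε hT (by linarith) (by linarith)

/-- For `β = α` the two functionals coincide. The line on which they vanish carries the two
alternating directions, and the two open half planes carry the constant signs. -/
theorem inftyOmega_loxodromic {P Q : RatFunc ℝ} (hP : P ≠ 0) (hQ : NoZerosOrPoles Q)
    (hpos : RatHasUltimateSign P [1]) (h : IsInftyOmegaLoxodromic P Q) :
    PartitionsCircle ![pI P Q [1, -1], pI P Q [-1, 1], pI P Q [1], pI P Q [-1]] ∧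
      IsSingleton (pI P Q [1, -1]) ∧ IsSingleton (pI P Q [-1, 1]) ∧
      IsOpenArc (pI P Q [1]) ∧ IsOpenArc (pI P Q [-1]) := by
  obtain ⟨X, Y, α, β, hinj, hβα, hdeg, c2, c3, c0, c1⟩ := exists_lox_functionals hP hQ hpos h.1
  have heq : β = α := hβα.eq_of_not_lt fun h' => absurd (hdeg.2 h') (not_lt.2 h.2)
  subst heq
  have hpi := Real.pi_pos
  have hMinj : Function.Injective (X.prod (β • X + Y)) := fun v v' hv => by
    rw [← sub_eq_zero]
    have h1 : X v = X v' := congrArg Prod.fst hv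
    have h2 : β * X v + Y v = β * X v' + Y v' := congrArg Prod.snd hv
    rw [h1] at h2
    exact hinj _ (by rw [map_sub, h1, sub_self]) (by rw [map_sub]; linarith)
  obtain ⟨ε, hε, T, hT, hpI, hpart⟩ := partition_of_classification (P := P) (Q := Q) hMinj loxWord
    ![{0}, {Real.pi}, Set.Ioo 0 Real.pi, Set.Ioo Real.pi (2 * Real.pi)]
    (fun i x hx v hv => by
      have hv1 : X v = Real.cos x := congrArg Prod.fst hv
      have hv2 : β * X v + Y v = Real.sin x := congrArg Prod.snd hv
      fin_cases i
      · have hx : x = 0 := hx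
        rw [hx, Real.cos_zero] at hv1
        rw [hx, Real.sin_zero] at hv2
        exact c0 v (by linarith) hv2.ge hv2.le
      · have hx : x = Real.pi := hx
        rw [hx, Real.cos_pi] at hv1
        rw [hx, Real.sin_pi] at hv2
        exact c1 v (by linarith) hv2.le hv2.ge
      · have hx : x ∈ Set.Ioo 0 Real.pi := hx
        have := Real.sin_pos_of_pos_of_lt_pi hx.1 hx.2
        exact c2 v (by linarith) (by linarith)
      · have hx : x ∈ Set.Ioo Real.pi (2 * Real.pi) := hx
        have : Real.sin x < 0 := by
          rw [← Real.sin_sub_two_pi]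
          exact Real.sin_neg_of_neg_of_neg_pi_lt (by linarith [hx.2]) (by linarith [hx.1])
        exact c3 v (by linarith) (by linarith))
    (fun x => by
      obtain ⟨y, hy, l, hl⟩ := exists_mod_two_pi_Ico x
      rcases hy.1.eq_or_lt with h1 | h1
      · exact ⟨0, y, h1.symm, l, hl⟩
      rcases lt_trichotomy y Real.pi with h2 | h2 | h2
      · exact ⟨2, y, ⟨h1, h2⟩, l, hl⟩
      · exact ⟨1, y, h2, l, hl⟩
      · exact ⟨3, y, ⟨h2, hy.2⟩, l, hl⟩)
    (fun i j hij f => loxWord_incompatible hij)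
  rw [fin_four_words] at hpart
  refine ⟨hpart, ⟨_, (hpI 0).trans Set.image_singleton⟩, ⟨_, (hpI 1).trans Set.image_singleton⟩,
    ?_, ?_⟩
  · rw [show pI P Q [1] = _ from hpI 2]
    exact isOpenArc_arcMap hε hT (by linarith) (by linarith)
  · rw [show pI P Q [-1] = _ from hpI 3]
    exact isOpenArc_arcMap hε hT (by linarith) (by linarith)

/-! ### The hyperbolic type -/

theorem HasExpansion.exists_bound {R : RatFunc ℝ} {α₀ α₁ α₂ : ℝ} (h : HasExpansion R α₀ α₁ α₂) :
    ∃ K > 0, ∀ᶠ n : ℕ in atTop, |val R n - (α₀ + α₁ / n + α₂ / (n : ℝ) ^ 2)| ≤ K / (n : ℝ) ^ 3 := by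
  obtain ⟨K, hK, hb⟩ := h.exists_pos
  refine ⟨K, hK, ?_⟩
  filter_upwards [(tendsto_natCast_atTop_atTop (R := ℝ)).eventually hb.bound] with n hn
  have h2 : ‖(n : ℝ) ^ (-3 : ℤ)‖ = ((n : ℝ) ^ 3)⁻¹ := by
    rw [zpow_neg, norm_inv]
    norm_cast
  rw [h2, Real.norm_eq_abs] at hn
  exact hn

theorem lexGe_iff {α₀ α₁ α₂ : ℝ} : LexGe α₀ α₁ α₂ ↔ -(1 / 4) < α₀ ∨
    α₀ = -(1 / 4) ∧ (0 < α₁ ∨ α₁ = 0 ∧ -(1 / 16) ≤ α₂) := by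
  rw [LexGe, Prod.Lex.toLex_le_toLex]
  simp only [Prod.Lex.toLex_le_toLex, eq_comm]

theorem tendsto_expansion {R : RatFunc ℝ} {α₀ α₁ α₂ : ℝ} (h : HasExpansion R α₀ α₁ α₂) :
    Tendsto (fun n : ℕ => val R n) atTop (𝓝 α₀) := by
  obtain ⟨K, hK, hb⟩ := h.exists_bound
  have t1 : Tendsto (fun n : ℕ => α₁ / (n : ℝ)) atTop (𝓝 0) := tendsto_const_div_atTop_nhds_zero_nat _
  have t2 : Tendsto (fun n : ℕ => α₂ / (n : ℝ) ^ 2) atTop (𝓝 0) :=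
    (tendsto_pow_atTop two_ne_zero).comp (tendsto_natCast_atTop_atTop (R := ℝ))
      |>.const_div_atTop _
  have t3 : Tendsto (fun n : ℕ => K / (n : ℝ) ^ 3) atTop (𝓝 0) :=
    (tendsto_pow_atTop three_ne_zero).comp (tendsto_natCast_atTop_atTop (R := ℝ))
      |>.const_div_atTop _
  simp only [← Real.norm_eq_abs] at hb
  have t4 := squeeze_zero_norm' hb t3
  have t5 := t4.add ((t1.const_add α₀).add t2)
  simpa using t5

theorem exists_nonoscillation_bound {R : RatFunc ℝ} {α₀ α₁ α₂ : ℝ} (h : HasExpansion R α₀ α₁ α₂)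
    (hl : LexGe α₀ α₁ α₂) : ∃ K ≥ 0, ∀ᶠ n : ℕ in atTop,
      -val R n ≤ 1 / 4 + 1 / (16 * (n : ℝ) ^ 2) + K / (n : ℝ) ^ 3 := by
  rcases lexGe_iff.1 hl with h0 | ⟨h0, h1⟩
  · refine ⟨0, le_rfl, ?_⟩
    filter_upwards [(tendsto_expansion h).eventually_const_lt h0] with n hn
    have : 0 ≤ 1 / (16 * (n : ℝ) ^ 2) := by positivity
    rw [zero_div]
    linarith
  obtain ⟨K, hK, hb⟩ := h.exists_bound
  refine ⟨K, hK.le, ?_⟩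
  have hmain : ∀ᶠ n : ℕ in atTop, -(1 / (16 * (n : ℝ) ^ 2)) ≤ α₁ / n + α₂ / (n : ℝ) ^ 2 := by
    rcases h1 with h1 | ⟨h1, h2⟩
    · have ht : Tendsto (fun n : ℕ => α₁ * (n : ℝ) + α₂) atTop atTop :=
        tendsto_atTop_add_const_right _ _ (tendsto_natCast_atTop_atTop.const_mul_atTop h1)
      filter_upwards [ht.eventually_ge_atTop 0, eventually_gt_atTop 0] with n hn hn0
      have e : α₁ / n + α₂ / (n : ℝ) ^ 2 = (α₁ * n + α₂) / (n : ℝ) ^ 2 := by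
        have : (n : ℝ) ≠ 0 := by positivity
        field_simp
      rw [e]
      have e1 : 0 ≤ (α₁ * n + α₂) / (n : ℝ) ^ 2 := by positivity
      have e2 : 0 ≤ 1 / (16 * (n : ℝ) ^ 2) := by positivity
      linarith
    · filter_upwards with n
      rw [h1, zero_div, zero_add, show -(1 / (16 * (n : ℝ) ^ 2)) = (-(1 / 16)) / (n : ℝ) ^ 2 by
        rw [← div_div]; ring]
      gcongr
  filter_upwards [hb, hmain] with n hn hm
  rw [h0] at hn
  have := (abs_le.1 hn).1
  linarith

/-- Already `1/2 + 1/(4n)` gives `y(n) (1 - y(n+1)) = 1/4 + 1/(16n²)` up to order `n⁻³`; the term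
`c/n²` absorbs the error `K/n³`. -/
theorem exists_supersolution {q : ℕ → ℝ} {K : ℝ} (hK : 0 ≤ K)
    (hq : ∀ᶠ n : ℕ in atTop, q n ≤ 1 / 4 + 1 / (16 * (n : ℝ) ^ 2) + K / (n : ℝ) ^ 3) :
    ∃ y : ℕ → ℝ, ∀ᶠ n in atTop, 0 < y n ∧ q n ≤ y n * (1 - y (n + 1)) := by
  set c := 8 * K + 1 with hc
  refine ⟨fun n => 1 / 2 + 1 / (4 * n) + c / (n : ℝ) ^ 2, ?_⟩
  obtain ⟨N, hN⟩ := exists_nat_gt (c ^ 2 + c)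
  filter_upwards [hq, eventually_ge_atTop (16 * N), eventually_gt_atTop 0] with n hn hnN hn0
  have hx : (1 : ℝ) ≤ n := by exact_mod_cast hn0
  have hxN : c ^ 2 + c ≤ (n : ℝ) / 16 := by
    have : (16 * N : ℝ) ≤ n := by exact_mod_cast hnN
    linarith
  have hc0 : 0 < c := by linarith
  refine ⟨by positivity, hn.trans ?_⟩
  push_cast
  set x : ℝ := (n : ℝ)
  -- The leading coefficient of the numerator is `c/2 - 1/16 - K`, positive for `c = 8K + 1`. The
  -- generous constant leaves room for the crude bound `(x+1)² ≤ 4x²`.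
  have e : (1 / 2 + 1 / (4 * x) + c / x ^ 2) * (1 - (1 / 2 + 1 / (4 * (x + 1)) + c / (x + 1) ^ 2)) -
      (1 / 4 + 1 / (16 * x ^ 2) + K / x ^ 3) =
      (((2 * x + 1) * c / 4 - c ^ 2 - (x + 1) / 16) * x - K * (x + 1) ^ 2) /
        (x ^ 3 * (x + 1) ^ 2) := by
    field_simp
    ring
  have : 0 ≤ (((2 * x + 1) * c / 4 - c ^ 2 - (x + 1) / 16) * x - K * (x + 1) ^ 2) /
      (x ^ 3 * (x + 1) ^ 2) := by
    apply div_nonneg _ (by positivity)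
    have h1 : (x + 1) ^ 2 ≤ 4 * x * x := by nlinarith
    have h2 := mul_le_mul_of_nonneg_left h1 hK
    have h3 : K * (4 * x) ≤ (2 * x + 1) * c / 4 - c ^ 2 - (x + 1) / 16 := by
      rw [hc] at hxN ⊢
      nlinarith
    have h4 := mul_le_mul_of_nonneg_right h3 (show 0 ≤ x by linarith)
    linarith
  linarith

theorem hyperbolic {P Q : RatFunc ℝ} (hP : P ≠ 0) (hQ : NoZerosOrPoles Q)
    (hpos : RatHasUltimateSign P [1]) (h : IsHyperbolic P Q) :
    PartitionsCircle ![pI P Q [1], pI P Q [-1]] ∧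
      IsHalfOpenArc (pI P Q [1]) ∧ IsHalfOpenArc (pI P Q [-1]) := by
  obtain ⟨hR, -, α₀, α₁, α₂, hexp, hlex⟩ := h
  rw [RatHasUltimateSign, hasUltimateSign_neg_one] at hR
  obtain ⟨K, hK, hb⟩ := exists_nonoscillation_bound hexp hlex
  obtain ⟨y, hy⟩ := exists_supersolution (q := fun n => -val (normQ P Q) n) hK hb
  obtain ⟨c, hc, hrec⟩ := exists_normalForm (Q := Q) hP hpos
  obtain ⟨N, hN⟩ := eventually_atTop.1 (hrec.and (hy.and hR))
  obtain ⟨M, hM, hMc⟩ := exists_lex_coordinates (q := fun n => -val (normQ P Q) ((N + n : ℕ) : ℝ))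
    (y := fun n => y (N + n)) (fun n => neg_pos.2 (hN (N + n) (by omega)).2.2)
    (fun n => (hN (N + n) (by omega)).2.1.1) (fun n => (hN (N + n) (by omega)).2.1.2)
    (G := fun n => c (N + n) • sol P Q (N + n))
    (fun n v => by
      have := (hN (N + n) (by omega)).1 v
      simp only [LinearMap.smul_apply, smul_eq_mul, neg_mul, sub_neg_eq_add]
      exact this)
    (fun v h0 h1 => eq_zero_of_sol_eq_zero hQ N ((mul_eq_zero.1 h0).resolve_left (hc _).ne')
      ((mul_eq_zero.1 h1).resolve_left (hc _).ne'))
  have key : ∀ v, (0 < (M v).2 ∨ (M v).2 = 0 ∧ 0 < (M v).1) →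
      ∀ᶠ n in atTop, 0 < sol P Q n v := fun v hv => by
    refine eventually_of_shift N ?_
    filter_upwards [hMc v hv] with n hn
    exact (pos_iff_pos_of_mul_pos hn).1 (hc _)
  have hpi := Real.pi_pos
  obtain ⟨ε, hε, T, hT, hpI, hpart⟩ := partition_of_classification (P := P) (Q := Q) hM
    ![[1], [-1]] ![Set.Ico 0 Real.pi, Set.Ico Real.pi (2 * Real.pi)]
    (fun i x hx v hv => by
      have hv1 : (M v).1 = Real.cos x := congrArg Prod.fst hv
      have hv2 : (M v).2 = Real.sin x := congrArg Prod.snd hv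
      fin_cases i
      · have hx : x ∈ Set.Ico 0 Real.pi := hx
        refine (hasUltimateSign_one _).2 (key v ?_)
        rcases hx.1.eq_or_lt with h0 | h0
        · right
          rw [hv1, hv2, ← h0]
          simp
        · left
          rw [hv2]
          exact Real.sin_pos_of_pos_of_lt_pi h0 hx.2
      · have hx : x ∈ Set.Ico Real.pi (2 * Real.pi) := hx
        refine (hasUltimateSign_neg_one _).2 ?_
        have := key (-v) (by
          rw [map_neg, Prod.fst_neg, Prod.snd_neg, hv1, hv2]
          rcases hx.1.eq_or_lt with h0 | h0
          · right
            rw [← h0]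
            simp
          · left
            rw [neg_pos, ← Real.sin_sub_two_pi]
            exact Real.sin_neg_of_neg_of_neg_pi_lt (by linarith [hx.2]) (by linarith [hx.1]))
        simpa using this)
    (fun x => by
      obtain ⟨y, hy, l, hl⟩ := exists_mod_two_pi_Ico x
      rcases lt_or_ge y Real.pi with h1 | h1
      · exact ⟨0, y, ⟨hy.1, h1⟩, l, hl⟩
      · exact ⟨1, y, ⟨h1, hy.2⟩, l, hl⟩)
    (fun i j hij f hi hj => by
      fin_cases i <;> fin_cases j
      · exact hij rfl
      · exact loxWord_incompatible (i := 2) (j := 3) (by decide) hi hj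
      · exact loxWord_incompatible (i := 3) (j := 2) (by decide) hi hj
      · exact hij rfl)
  have hw : (fun i => pI P Q (![[1], [-1]] i)) = ![pI P Q [1], pI P Q [-1]] := by
    funext i
    fin_cases i <;> rfl
  rw [hw] at hpart
  refine ⟨hpart, ?_, ?_⟩
  · rw [show pI P Q [1] = _ from hpI 0]
    exact isHalfOpenArc_arcMap_Ico hε hT (by linarith) (by linarith)
  · rw [show pI P Q [-1] = _ from hpI 1]
    exact isHalfOpenArc_arcMap_Ico hε hT (by linarith) (by linarith)

/-! ### Slowly rotating sequences -/

/-- The unit complex number at angle `t`. -/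
def cis (t : ℝ) : ℂ := Complex.exp (t * Complex.I)

theorem cis_add (s t : ℝ) : cis (s + t) = cis s * cis t := by
  rw [cis, cis, cis, ← Complex.exp_add]
  push_cast
  ring_nf

theorem cis_zero : cis 0 = 1 := by simp [cis]

theorem norm_cis (t : ℝ) : ‖cis t‖ = 1 := Complex.norm_exp_ofReal_mul_I t

theorem cis_re (t : ℝ) : (cis t).re = Real.cos t := Complex.exp_ofReal_mul_I_re t

theorem cis_im (t : ℝ) : (cis t).im = Real.sin t := Complex.exp_ofReal_mul_I_im t

theorem cis_ne_zero (t : ℝ) : cis t ≠ 0 := Complex.exp_ne_zero _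

theorem conj_cis (t : ℝ) : (starRingEnd ℂ) (cis t) = cis (-t) := by
  apply Complex.ext
  · rw [Complex.conj_re, cis_re, cis_re, Real.cos_neg]
  · rw [Complex.conj_im, cis_im, cis_im, Real.sin_neg]

theorem cis_nat_mul (n : ℕ) (t : ℝ) : cis (n * t) = cis t ^ n := by
  rw [cis, cis, ← Complex.exp_nat_mul]
  push_cast
  ring_nf

theorem polar_eq (z : ℂ) : z = (‖z‖ : ℂ) * cis z.arg := (Complex.norm_mul_exp_arg_mul_I z).symm

theorem im_mul_cis_neg (z : ℂ) (t : ℝ) : (z * cis (-t)).im = ‖z‖ * Real.sin (z.arg - t) := by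
  conv_lhs => rw [polar_eq z, mul_assoc, ← cis_add, Complex.im_ofReal_mul, cis_im]
  rw [sub_eq_add_neg]

theorem im_mul_conj (z z' : ℂ) : (z' * (starRingEnd ℂ) z).im =
    ‖z'‖ * ‖z‖ * Real.sin (z'.arg - z.arg) := by
  conv_lhs => rw [polar_eq z, polar_eq z']
  rw [map_mul, Complex.conj_ofReal, conj_cis, mul_mul_mul_comm, ← cis_add, ← Complex.ofReal_mul,
    Complex.im_ofReal_mul, cis_im, sub_eq_add_neg]

theorem abs_im_mul_conj_le (z z' : ℂ) : |(z' * (starRingEnd ℂ) z).im| ≤ ‖z'‖ * ‖z‖ := by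
  refine (Complex.abs_im_le_norm _).trans ?_
  rw [norm_mul, RCLike.norm_conj]

theorem tendsto_ratio_shift {δ : ℕ → ℝ} (hδ : Tendsto (fun n => δ (n + 1) / δ n) atTop (𝓝 1))
    (j : ℕ) : Tendsto (fun n => δ (n + j) / δ n) atTop (𝓝 1) := by
  have hne : ∀ᶠ n in atTop, δ n ≠ 0 := by
    filter_upwards [hδ.eventually_const_lt one_pos] with n hn h
    rw [h, div_zero] at hn
    exact lt_irrefl _ hn
  induction j with
  | zero =>
    refine tendsto_const_nhds.congr' ?_
    filter_upwards [hne] with n hn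
    rw [add_zero, div_self hn]
  | succ j ih =>
    have h := (hδ.comp (tendsto_add_atTop_nat j)).mul ih
    rw [mul_one] at h
    refine h.congr' ?_
    filter_upwards [(tendsto_add_atTop_nat j).eventually hne] with n hn
    simp only [Function.comp]
    rw [show n + (j + 1) = n + j + 1 by ring]
    field_simp

theorem exists_sign_of_ratio {δ : ℕ → ℝ} (hδ : Tendsto (fun n => δ (n + 1) / δ n) atTop (𝓝 1)) :
    ∃ σ : ℝ, (σ = 1 ∨ σ = -1) ∧ ∀ᶠ n in atTop, 0 < σ * δ n := by
  obtain ⟨N, hN⟩ := eventually_atTop.1 (hδ.eventually_const_lt one_pos)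
  have hN0 : δ N ≠ 0 := fun h => by
    have := hN N le_rfl
    rw [h, div_zero] at this
    exact lt_irrefl _ this
  obtain ⟨σ, hσ, h0⟩ : ∃ σ : ℝ, (σ = 1 ∨ σ = -1) ∧ 0 < σ * δ N := by
    rcases lt_or_gt_of_ne hN0 with h | h
    · exact ⟨-1, Or.inr rfl, by linarith⟩
    · exact ⟨1, Or.inl rfl, by linarith⟩
  refine ⟨σ, hσ, eventually_atTop.2 ⟨N, fun n hn => ?_⟩⟩
  induction n, hn using Nat.le_induction with
  | base => exact h0
  | succ n hn ih =>
    have h1 := mul_pos (hN n hn) ih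
    have h2 : δ n ≠ 0 := fun h => by rw [h, mul_zero] at ih; exact lt_irrefl _ ih
    have h3 : δ (n + 1) / δ n * (σ * δ n) = σ * δ (n + 1) := by field_simp
    rwa [h3] at h1

/-- Over any fixed number of steps a slowly varying vector stays nearly constant in the relative
sense. -/
theorem tendsto_relative_variation {w : ℕ → ℂ} {β : ℕ → ℝ} {N : ℕ}
    (hw : ∀ n ≥ N, ‖w (n + 1) - w n‖ ≤ β n * ‖w n‖) (hw0 : ∀ n ≥ N, w n ≠ 0)
    (hβ : Tendsto β atTop (𝓝 0)) (j : ℕ) :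
    Tendsto (fun n => ‖w (n + j) - w n‖ / ‖w n‖) atTop (𝓝 0) := by
  induction j with
  | zero => simp
  | succ j ih =>
    have h1 : Tendsto (fun n => ‖w (n + j) - w n‖ / ‖w n‖ +
        β (n + j) * (1 + ‖w (n + j) - w n‖ / ‖w n‖)) atTop (𝓝 (0 + 0 * (1 + 0))) :=
      ih.add ((hβ.comp (tendsto_add_atTop_nat j)).mul (ih.const_add 1))
    rw [zero_mul, add_zero] at h1
    refine squeeze_zero' (Eventually.of_forall fun n => by positivity) ?_ h1
    filter_upwards [eventually_ge_atTop N] with n hn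
    have hpos : 0 < ‖w n‖ := norm_pos_iff.2 (hw0 n hn)
    have hpos' : 0 < ‖w (n + j)‖ := norm_pos_iff.2 (hw0 (n + j) (by omega))
    have h2 := hw (n + j) (by omega)
    have hβ0 : 0 ≤ β (n + j) := by
      by_contra! h
      have := mul_neg_of_neg_of_pos h hpos'
      linarith [norm_nonneg (w (n + j + 1) - w (n + j))]
    have h3 : ‖w (n + j)‖ ≤ ‖w n‖ + ‖w (n + j) - w n‖ := by
      have := norm_add_le (w n) (w (n + j) - w n)
      rwa [add_sub_cancel] at this
    have h4 : ‖w (n + (j + 1)) - w n‖ ≤ ‖w (n + j) - w n‖ + β (n + j) * ‖w (n + j)‖ := by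
      have := norm_add_le (w (n + j + 1) - w (n + j)) (w (n + j) - w n)
      rw [sub_add_sub_cancel] at this
      rw [← add_assoc]
      linarith
    have h5 := mul_le_mul_of_nonneg_left h3 hβ0
    rw [div_le_iff₀ hpos, add_mul, div_mul_cancel₀ _ hpos.ne', mul_assoc, add_mul, one_mul,
      div_mul_cancel₀ _ hpos.ne']
    linarith

/-- A linear perturbation whose average over `T` steps is a positive rotation. -/
structure IsRotating (ell : ℕ → ℂ → ℂ) (C : ℝ) (T : ℕ) (κ : ℝ) : Prop where
  map_zero : ∀ n, ell n 0 = 0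
  lipschitz : ∀ n z z', ‖ell n z - ell n z'‖ ≤ C * ‖z - z'‖
  pos : 0 < κ
  average : ∀ n z, ∑ j ∈ Finset.range T, (ell (n + j) z * (starRingEnd ℂ) z).im = κ * ‖z‖ ^ 2

theorem IsRotating.norm_le {ell : ℕ → ℂ → ℂ} {C : ℝ} {T : ℕ} {κ : ℝ} (h : IsRotating ell C T κ)
    (n : ℕ) (z : ℂ) : ‖ell n z‖ ≤ C * ‖z‖ := by
  have := h.lipschitz n z 0
  rwa [h.map_zero, sub_zero, sub_zero] at this

theorem IsRotating.nonneg {ell : ℕ → ℂ → ℂ} {C : ℝ} {T : ℕ} {κ : ℝ} (h : IsRotating ell C T κ) :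
    0 ≤ C := by
  have := h.norm_le 0 1
  rw [norm_one, mul_one] at this
  exact (norm_nonneg _).trans this

theorem IsRotating.variation {ell : ℕ → ℂ → ℂ} {C : ℝ} {T : ℕ} {κ : ℝ} (h : IsRotating ell C T κ)
    {w : ℕ → ℂ} {δ : ℕ → ℝ} {N : ℕ} (hw : ∀ n ≥ N, w (n + 1) = w n + δ n * ell n (w n)) :
    ∀ n ≥ N, ‖w (n + 1) - w n‖ ≤ (C * |δ n|) * ‖w n‖ := fun n hn => by
  rw [hw n hn, add_sub_cancel_left, norm_mul, Complex.norm_real, Real.norm_eq_abs]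
  have := mul_le_mul_of_nonneg_left (h.norm_le n (w n)) (abs_nonneg (δ n))
  linarith

/-- Over `T` steps `w` changes by about `δ n` times the sum of the `ell (n + j) (w n)`, because `δ`
and `w` hardly vary in relative terms. The errors are `o(δ n)`, so half of the averaged rotation
survives. The extra factor `δ n` on both sides covers both signs of `δ`. -/
theorem IsRotating.drift {ell : ℕ → ℂ → ℂ} {C : ℝ} {T : ℕ} {κ : ℝ} (h : IsRotating ell C T κ)
    {w : ℕ → ℂ} {δ : ℕ → ℝ} {N : ℕ} (hw : ∀ n ≥ N, w (n + 1) = w n + δ n * ell n (w n))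
    (hw0 : ∀ n ≥ N, w n ≠ 0) (hδ : Tendsto δ atTop (𝓝 0))
    (hδ1 : Tendsto (fun n => δ (n + 1) / δ n) atTop (𝓝 1)) :
    ∀ᶠ n in atTop, κ / 2 * δ n ^ 2 * ‖w n‖ ^ 2 ≤ δ n * (w (n + T) * (starRingEnd ℂ) (w n)).im := by
  have hC := h.nonneg
  have hβ : Tendsto (fun n => C * |δ n|) atTop (𝓝 0) := by
    simpa using hδ.abs.const_mul C
  have hD := tendsto_relative_variation (h.variation hw) hw0 hβ
  set D : ℕ → ℕ → ℝ := fun j n => ‖w (n + j) - w n‖ / ‖w n‖ with hDdef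
  have hE : Tendsto (fun n => ∑ j ∈ Finset.range T,
      C * (|δ (n + j) / δ n - 1| + |δ (n + j) / δ n| * D j n)) atTop (𝓝 0) := by
    rw [← Finset.sum_const_zero (s := Finset.range T)]
    refine tendsto_finsetSum _ fun j _ => ?_
    have h1 := tendsto_ratio_shift hδ1 j
    have h2 := (((h1.sub_const 1).abs).add (h1.abs.mul (hD j))).const_mul C
    simpa using h2
  have hne : ∀ᶠ n in atTop, δ n ≠ 0 := by
    filter_upwards [hδ1.eventually_const_lt one_pos] with n hn h
    rw [h, div_zero] at hn
    exact lt_irrefl _ hn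
  filter_upwards [hE.eventually_lt_const (half_pos h.pos), hne, eventually_ge_atTop N]
    with n hn hne hnN
  have hpos : 0 < ‖w n‖ := norm_pos_iff.2 (hw0 n hnN)
  have hsum : w (n + T) - w n = ∑ j ∈ Finset.range T, δ (n + j) * ell (n + j) (w (n + j)) := by
    have : ∀ j ∈ Finset.range T, (δ (n + j) : ℂ) * ell (n + j) (w (n + j)) =
        w (n + (j + 1)) - w (n + j) := fun j _ => by
      rw [← add_assoc, hw (n + j) (by omega), add_sub_cancel_left]
    rw [Finset.sum_congr rfl this, Finset.sum_range_sub (fun j => w (n + j)), add_zero]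
  have him : (w (n + T) * (starRingEnd ℂ) (w n)).im =
      ∑ j ∈ Finset.range T, δ (n + j) * (ell (n + j) (w (n + j)) * (starRingEnd ℂ) (w n)).im := by
    have h1 : (w (n + T) * (starRingEnd ℂ) (w n)).im =
        ((w (n + T) - w n) * (starRingEnd ℂ) (w n)).im := by
      rw [sub_mul, Complex.sub_im, Complex.mul_conj, Complex.ofReal_im, sub_zero]
    rw [h1, hsum, Finset.sum_mul, Complex.im_sum]
    refine Finset.sum_congr rfl fun j _ => ?_
    rw [mul_assoc, Complex.im_ofReal_mul]
  have havg := h.average n (w n)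
  have hdiff : |(w (n + T) * (starRingEnd ℂ) (w n)).im - δ n * (κ * ‖w n‖ ^ 2)| ≤
      |δ n| * ‖w n‖ ^ 2 * ∑ j ∈ Finset.range T,
        C * (|δ (n + j) / δ n - 1| + |δ (n + j) / δ n| * D j n) := by
    rw [him, ← havg, Finset.mul_sum, ← Finset.sum_sub_distrib, Finset.mul_sum]
    refine (Finset.abs_sum_le_sum_abs _ _).trans (Finset.sum_le_sum fun j _ => ?_)
    have e : δ (n + j) * (ell (n + j) (w (n + j)) * (starRingEnd ℂ) (w n)).im -
        δ n * (ell (n + j) (w n) * (starRingEnd ℂ) (w n)).im =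
        δ (n + j) * ((ell (n + j) (w (n + j)) - ell (n + j) (w n)) * (starRingEnd ℂ) (w n)).im +
        (δ (n + j) - δ n) * (ell (n + j) (w n) * (starRingEnd ℂ) (w n)).im := by
      rw [sub_mul, Complex.sub_im]
      ring
    rw [e]
    refine (abs_add_le _ _).trans ?_
    rw [abs_mul, abs_mul]
    have b1 : |((ell (n + j) (w (n + j)) - ell (n + j) (w n)) * (starRingEnd ℂ) (w n)).im| ≤
        C * (D j n * ‖w n‖) * ‖w n‖ := by
      refine (abs_im_mul_conj_le _ _).trans (mul_le_mul_of_nonneg_right ?_ hpos.le)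
      rw [hDdef]
      simp only
      rw [div_mul_cancel₀ _ hpos.ne']
      exact h.lipschitz _ _ _
    have b2 : |(ell (n + j) (w n) * (starRingEnd ℂ) (w n)).im| ≤ C * ‖w n‖ * ‖w n‖ :=
      (abs_im_mul_conj_le _ _).trans (mul_le_mul_of_nonneg_right (h.norm_le _ _) hpos.le)
    have c1 : |δ (n + j)| = |δ n| * |δ (n + j) / δ n| := by
      rw [← abs_mul, mul_div_cancel₀ _ hne]
    have c2 : |δ (n + j) - δ n| = |δ n| * |δ (n + j) / δ n - 1| := by
      rw [← abs_mul, mul_sub, mul_div_cancel₀ _ hne, mul_one]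
    have d1 := mul_le_mul_of_nonneg_left b1 (abs_nonneg (δ (n + j)))
    have d2 := mul_le_mul_of_nonneg_left b2 (abs_nonneg (δ (n + j) - δ n))
    refine (add_le_add d1 d2).trans (le_of_eq ?_)
    rw [c1, c2]
    ring
  have hfin : |δ n| * |(w (n + T) * (starRingEnd ℂ) (w n)).im - δ n * (κ * ‖w n‖ ^ 2)| ≤
      |δ n| * (|δ n| * ‖w n‖ ^ 2 * (κ / 2)) := by
    refine mul_le_mul_of_nonneg_left (hdiff.trans ?_) (abs_nonneg _)
    exact mul_le_mul_of_nonneg_left hn.le (by positivity)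
  rw [← abs_mul] at hfin
  have h3 := (abs_le.1 hfin).1
  have h4 : |δ n| * (|δ n| * ‖w n‖ ^ 2 * (κ / 2)) = δ n ^ 2 * ‖w n‖ ^ 2 * (κ / 2) := by
    rw [← sq_abs (δ n)]
    ring
  rw [h4] at h3
  linarith

/-- From an index `m` on where the tail of `β` is below `1/4`, the vector stays within `‖w m‖ / 2`
of `w m`. So it is Cauchy, and its limit vanishes only if `w m` does. -/
theorem exists_limit_of_summable_variation {w : ℕ → ℂ} {β : ℕ → ℝ} {N : ℕ} (hβ0 : ∀ n, 0 ≤ β n)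
    (hβ : Summable β) (hw : ∀ n ≥ N, ‖w (n + 1) - w n‖ ≤ β n * ‖w n‖) :
    ∃ z, Tendsto w atTop (𝓝 z) ∧ (z = 0 → ∃ n ≥ N, w n = 0) := by
  obtain ⟨m, hmN, hm⟩ : ∃ m ≥ N, ∑' i, β (i + m) < 1 / 4 := by
    have h1 := (tendsto_sum_nat_add β).eventually_lt_const (show (0 : ℝ) < 1 / 4 by norm_num)
    obtain ⟨m, hm⟩ := (h1.and (eventually_ge_atTop N)).exists
    exact ⟨m, hm.2, hm.1⟩
  have hs : Summable fun i => β (i + m) := (summable_nat_add_iff m).2 hβ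
  have hpart : ∀ k, ∑ i ∈ Finset.range k, β (i + m) ≤ 1 / 4 := fun k =>
    (hs.sum_le_tsum _ fun i _ => hβ0 _).trans hm.le
  have hbound : ∀ k, ‖w (k + m) - w m‖ ≤ 2 * ‖w m‖ * ∑ i ∈ Finset.range k, β (i + m) := fun k => by
    induction k with
    | zero => simp
    | succ k ih =>
      have h1 := hw (k + m) (by omega)
      have h2 : ‖w (k + m)‖ ≤ 2 * ‖w m‖ := by
        have h3 := norm_add_le (w m) (w (k + m) - w m)
        rw [add_sub_cancel] at h3
        have h4 := mul_le_mul_of_nonneg_left (hpart k) (show 0 ≤ 2 * ‖w m‖ by positivity)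
        linarith [norm_nonneg (w m)]
      have h5 := mul_le_mul_of_nonneg_left h2 (hβ0 (k + m))
      have h6 := norm_add_le (w (k + m + 1) - w (k + m)) (w (k + m) - w m)
      rw [sub_add_sub_cancel] at h6
      rw [Finset.sum_range_succ, mul_add, show k + 1 + m = k + m + 1 by ring]
      linarith
  have hhalf : ∀ k, ‖w (k + m) - w m‖ ≤ 1 / 2 * ‖w m‖ := fun k => by
    have h4 := mul_le_mul_of_nonneg_left (hpart k) (show 0 ≤ 2 * ‖w m‖ by positivity)
    linarith [hbound k]
  have hcauchy : CauchySeq fun k => w (k + m) := by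
    refine cauchySeq_of_dist_le_of_summable (fun k => 2 * ‖w m‖ * β (k + m)) (fun k => ?_)
      (hs.mul_left _)
    have h1 := hw (k + m) (by omega)
    have h2 : ‖w (k + m)‖ ≤ 2 * ‖w m‖ := by
      have h3 := norm_add_le (w m) (w (k + m) - w m)
      rw [add_sub_cancel] at h3
      linarith [hhalf k, norm_nonneg (w m)]
    have h5 := mul_le_mul_of_nonneg_left h2 (hβ0 (k + m))
    rw [dist_comm, dist_eq_norm, show k.succ + m = k + m + 1 by omega]
    linarith
  obtain ⟨z, hz⟩ := cauchySeq_tendsto_of_complete hcauchy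
  refine ⟨z, (tendsto_add_atTop_iff_nat m).1 hz, fun hz0 => ⟨m, hmN, ?_⟩⟩
  have h1 : ‖z - w m‖ ≤ 1 / 2 * ‖w m‖ :=
    le_of_tendsto' ((hz.sub_const (w m)).norm) hhalf
  rw [hz0, zero_sub, norm_neg] at h1
  have h2 : ‖w m‖ = 0 := by linarith [norm_nonneg (w m)]
  exact norm_eq_zero.1 h2

/-- A sequence rotating in the direction `σ` approaches its limit from the side `-σ`. -/
theorem side_of_rotation {w : ℕ → ℂ} {z : ℂ} (hz : z ≠ 0) (hwz : Tendsto w atTop (𝓝 z)) {T : ℕ}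
    (hT : 0 < T) {σ : ℝ}
    (hrot : ∀ᶠ n in atTop, 0 < σ * (w (n + T) * (starRingEnd ℂ) (w n)).im) :
    ∀ᶠ n in atTop, σ * (w n * (starRingEnd ℂ) z).im < 0 := by
  have h1 : Tendsto (fun n => w n * (starRingEnd ℂ) z) atTop (𝓝 ((‖z‖ ^ 2 : ℝ) : ℂ)) := by
    have := hwz.mul_const ((starRingEnd ℂ) z)
    rwa [Complex.mul_conj, Complex.normSq_eq_norm_sq] at this
  have hre := (Complex.continuous_re.tendsto _).comp h1
  have him := (Complex.continuous_im.tendsto _).comp h1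
  rw [Complex.ofReal_re] at hre
  rw [Complex.ofReal_im] at him
  have hzpos : 0 < ‖z‖ ^ 2 := by
    have := norm_pos_iff.2 hz
    positivity
  obtain ⟨K, hK⟩ := eventually_atTop.1 (hrot.and (hre.eventually_const_lt hzpos))
  have ht := (him.const_mul σ).div hre hzpos.ne'
  rw [mul_zero, zero_div] at ht
  -- Up to the sign `σ`, `t n` is the tangent of the angle from `z` to `w n`. It increases along
  -- steps of `T` and tends to `0`, so it is negative.
  set t : ℕ → ℝ := fun n => σ * (w n * (starRingEnd ℂ) z).im / (w n * (starRingEnd ℂ) z).re with htdef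
  have ht : Tendsto t atTop (𝓝 0) := ht
  have hstep : ∀ n ≥ K, t n < t (n + T) := fun n hn => by
    have r0 : 0 < (w n * (starRingEnd ℂ) z).re := (hK n hn).2
    have r1 : 0 < (w (n + T) * (starRingEnd ℂ) z).re := (hK (n + T) (by omega)).2
    have hrn := mul_pos (hK n hn).1 hzpos
    rw [htdef]
    simp only
    rw [div_lt_div_iff₀ r0 r1, ← sub_pos]
    refine lt_of_lt_of_eq hrn ?_
    rw [← Complex.normSq_eq_norm_sq, Complex.normSq_apply]
    simp only [Complex.mul_im, Complex.mul_re, Complex.conj_re, Complex.conj_im]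
    ring
  refine eventually_atTop.2 ⟨K, fun n hn => ?_⟩
  have hmono : StrictMono fun m => t (n + m * T) := strictMono_nat_of_lt_succ fun m => by
    have := hstep (n + m * T) (by omega)
    rwa [show n + (m + 1) * T = n + m * T + T by ring]
  have hlim : Tendsto (fun m => t (n + m * T)) atTop (𝓝 0) := by
    refine ht.comp (tendsto_atTop_mono (fun m => ?_) tendsto_id)
    exact (Nat.le_mul_of_pos_right m hT).trans (Nat.le_add_left _ _)
  have hneg : t n < 0 := by
    have h2 := hmono.monotone.ge_of_tendsto hlim 1
    have h3 := hmono zero_lt_one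
    simp only [zero_mul, add_zero] at h3
    exact h3.trans_le h2
  have r0 : 0 < (w n * (starRingEnd ℂ) z).re := (hK n hn).2
  exact (div_neg_iff.1 hneg).elim (fun h => absurd r0 (not_lt.2 h.2.le)) fun h => h.1

/-- A sequence in a half plane cannot rotate in one direction by a divergent total angle. -/
theorem not_rotating_in_halfPlane {ζ : ℕ → ℂ} {c σ s : ℝ} (hc : 0 < c) (hσ : σ = 1 ∨ σ = -1)
    (hs : s = 1 ∨ s = -1) (hζ0 : ∀ m, ζ m ≠ 0) (hζ : ∀ m, 0 ≤ s * (ζ m).im)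
    (hnorm : ∀ m, ‖ζ (m + 1)‖ ≤ 2 * ‖ζ m‖)
    (hrot : ∀ m : ℕ, c / ((m : ℝ) + 1) * ‖ζ m‖ ^ 2 ≤ σ * (ζ (m + 1) * (starRingEnd ℂ) (ζ m)).im) :
    False := by
  set a : ℕ → ℝ := fun m => ((s : ℂ) * ζ m).arg with ha
  have hpi := Real.pi_pos
  have hamem : ∀ m, 0 ≤ a m ∧ a m ≤ Real.pi := fun m => by
    refine ⟨Complex.arg_nonneg_iff.2 ?_, Complex.arg_le_pi _⟩
    rw [Complex.im_ofReal_mul]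
    exact hζ m
  have hs2 : s * s = 1 := by rcases hs with rfl | rfl <;> norm_num
  have hsabs : ‖(s : ℂ)‖ = 1 := by
    rw [Complex.norm_real]; rcases hs with rfl | rfl <;> simp
  -- The hypothesis bounds the sine of the angle gained below; the factor `2` comes from the ratio
  -- of consecutive norms. All angles lie in `[0, π]`, so the gains cannot sum to a divergent
  -- harmonic series.
  have hstep : ∀ m : ℕ, c / 2 * (1 / ((m : ℝ) + 1)) ≤ σ * (a (m + 1) - a m) := fun m => by
    have h1 := im_mul_conj ((s : ℂ) * ζ m) ((s : ℂ) * ζ (m + 1))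
    rw [map_mul, Complex.conj_ofReal, mul_mul_mul_comm, ← Complex.ofReal_mul, hs2,
      Complex.ofReal_one, one_mul, norm_mul, norm_mul, hsabs, one_mul, one_mul] at h1
    have h2 := hrot m
    rw [h1] at h2
    have hpos := norm_pos_iff.2 (hζ0 m)
    have hpos' := norm_pos_iff.2 (hζ0 (m + 1))
    change _ ≤ σ * (‖ζ (m + 1)‖ * ‖ζ m‖ * Real.sin (a (m + 1) - a m)) at h2
    have hsin : σ * Real.sin (a (m + 1) - a m) = Real.sin (σ * (a (m + 1) - a m)) := by
      rcases hσ with rfl | rfl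
      · simp
      · rw [neg_one_mul, neg_one_mul, Real.sin_neg]
    set S := Real.sin (σ * (a (m + 1) - a m)) with hS
    have h3 : c / ((m : ℝ) + 1) * ‖ζ m‖ ^ 2 ≤ ‖ζ (m + 1)‖ * ‖ζ m‖ * S := by
      rw [← hsin]; linarith
    have hc1 : 0 < c / ((m : ℝ) + 1) := by positivity
    have hS0 : 0 < S := by
      have : 0 < ‖ζ (m + 1)‖ * ‖ζ m‖ * S := lt_of_lt_of_le (by positivity) h3
      exact (pos_iff_pos_of_mul_pos this).1 (by positivity)
    have h4 : c / 2 * (1 / ((m : ℝ) + 1)) ≤ S := by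
      have h5 : ‖ζ (m + 1)‖ * ‖ζ m‖ * S ≤ 2 * ‖ζ m‖ * ‖ζ m‖ * S := by
        have := hnorm m
        gcongr
      have h6 : c / ((m : ℝ) + 1) * ‖ζ m‖ ^ 2 ≤ (2 * S) * ‖ζ m‖ ^ 2 := by linarith
      have h7 := le_of_mul_le_mul_right h6 (by positivity)
      have : c / 2 * (1 / ((m : ℝ) + 1)) = c / ((m : ℝ) + 1) / 2 := by field_simp
      linarith
    have hdpos : 0 < σ * (a (m + 1) - a m) := by
      by_contra! hle
      have hge : -Real.pi ≤ σ * (a (m + 1) - a m) := by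
        have := hamem m
        have := hamem (m + 1)
        rcases hσ with rfl | rfl <;> linarith
      exact absurd hS0 (not_lt.2 (Real.sin_nonpos_of_nonpos_of_neg_pi_le hle hge))
    exact h4.trans (Real.sin_lt hdpos).le
  have hsum : ∀ M, ∑ m ∈ Finset.range M, c / 2 * (1 / ((m : ℝ) + 1)) ≤ σ * (a M - a 0) := fun M => by
    induction M with
    | zero => simp
    | succ M ih => rw [Finset.sum_range_succ]; linarith [hstep M]
  have hsm : Summable fun m : ℕ => c / 2 * (1 / ((m : ℝ) + 1)) := by
    refine summable_of_sum_range_le (c := Real.pi) (fun m => by positivity) fun M => ?_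
    refine (hsum M).trans ?_
    have := hamem M
    have := hamem 0
    rcases hσ with rfl | rfl <;> linarith
  have h2 := hsm.mul_left (c / 2)⁻¹
  have h3 : Summable fun m : ℕ => 1 / ((m : ℝ) + 1) := by
    refine h2.congr fun m => ?_
    field_simp
  refine Real.not_summable_one_div_natCast ((summable_nat_add_iff 1).1 ?_)
  simpa using h3

/-! ### Trigonometric sums -/

theorem norm_geom_sum_le {x : ℂ} (hx : ‖x‖ = 1) (hx1 : x ≠ 1) (M : ℕ) :
    ‖∑ m ∈ Finset.range M, x ^ m‖ ≤ 2 / ‖x - 1‖ := by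
  rw [geom_sum_eq hx1, norm_div]
  gcongr
  refine (norm_sub_le _ _).trans ?_
  rw [norm_pow, hx, one_pow, norm_one]
  norm_num

theorem cis_neg_eq_one_iff {η : ℝ} : cis (-η) = 1 ↔ cis η = 1 := by
  rw [← conj_cis]
  constructor
  · intro h
    have := congrArg (starRingEnd ℂ) h
    simpa using this
  · intro h
    rw [h, map_one]

theorem abs_sum_re_cis_le {η : ℝ} (hη : cis η ≠ 1) (x : ℝ) (M : ℕ) :
    ‖∑ m ∈ Finset.range M, cis (x - m * η)‖ ≤ 2 / ‖cis (-η) - 1‖ := by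
  have h : ∀ m : ℕ, cis (x - m * η) = cis x * cis (-η) ^ m := fun m => by
    rw [← cis_nat_mul, ← cis_add]
    congr 1
    ring
  simp only [h]
  rw [← Finset.mul_sum, norm_mul, norm_cis, one_mul]
  exact norm_geom_sum_le (norm_cis _) (fun h => hη (cis_neg_eq_one_iff.1 h)) M

theorem sum_cos_eq_zero {η : ℝ} (hη : cis η ≠ 1) {T : ℕ} (hT : cis (T * η) = 1) (x : ℝ) :
    ∑ m ∈ Finset.range T, Real.cos (x - m * η) = 0 := by
  have h : ∀ m : ℕ, cis (x - m * η) = cis x * cis (-η) ^ m := fun m => by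
    rw [← cis_nat_mul, ← cis_add]
    congr 1
    ring
  have h2 : ∑ m ∈ Finset.range T, cis (x - m * η) = 0 := by
    simp only [h]
    rw [← Finset.mul_sum, geom_sum_eq (fun h => hη (cis_neg_eq_one_iff.1 h)), ← cis_nat_mul,
      mul_neg, cis_neg_eq_one_iff.2 hT, sub_self, zero_div, mul_zero]
  have h3 := congrArg Complex.re h2
  rw [Complex.re_sum] at h3
  simpa [cis_re] using h3

/-- If all `M` sines were at least `-1/8`, then `sin² ≤ sin + 1/4` would hold for each of them.
Summation contradicts that the squares sum to `M/2` and the sines to `0`, both up to bounded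
geometric sums. -/
theorem exists_sin_lt {η : ℝ} (hη : cis (2 * η) ≠ 1) :
    ∃ M : ℕ, ∀ φ, ∃ m < M, Real.sin (φ - m * η) < -(1 / 8) := by
  have hη1 : cis η ≠ 1 := fun h => hη (by rw [two_mul, cis_add, h, one_mul])
  set B := 2 / ‖cis (-(2 * η)) - 1‖ with hB
  set B' := 2 / ‖cis (-η) - 1‖ with hB'
  obtain ⟨M, hM⟩ := exists_nat_gt (4 * (B / 2 + B'))
  refine ⟨M, fun φ => ?_⟩
  by_contra! h
  have h1 : ∑ m ∈ Finset.range M, Real.sin (φ - m * η) ≤ B' := by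
    have := (Complex.abs_im_le_norm _).trans (abs_sum_re_cis_le hη1 φ M)
    rw [Complex.im_sum] at this
    simp only [cis_im] at this
    exact (le_abs_self _).trans this
  have h2 : ∑ m ∈ Finset.range M, Real.cos (2 * φ - m * (2 * η)) ≤ B := by
    have := (Complex.abs_re_le_norm _).trans (abs_sum_re_cis_le hη (2 * φ) M)
    rw [Complex.re_sum] at this
    simp only [cis_re] at this
    exact (le_abs_self _).trans this
  have h3 : ∑ m ∈ Finset.range M, (1 / 2 - Real.cos (2 * φ - m * (2 * η)) / 2) ≤
      ∑ m ∈ Finset.range M, (Real.sin (φ - m * η) + 1 / 4) := by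
    refine Finset.sum_le_sum fun m hm => ?_
    have e1 := h m (Finset.mem_range.1 hm)
    have e2 := Real.sin_le_one (φ - m * η)
    have e3 : 1 / 2 - Real.cos (2 * φ - m * (2 * η)) / 2 = Real.sin (φ - m * η) ^ 2 := by
      rw [Real.sin_sq_eq_half_sub]
      congr 3
      ring
    rw [e3]
    nlinarith
  have h4 := Finset.sum_div (Finset.range M) (fun m : ℕ => Real.cos (2 * φ - m * (2 * η))) 2
  rw [Finset.sum_sub_distrib, Finset.sum_add_distrib, ← h4] at h3
  simp only [Finset.sum_const, Finset.card_range, nsmul_eq_mul] at h3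
  linarith

/-! ### The perturbation terms of elliptic recurrences -/

/-- The perturbation `z ↦ -C Im (z e^{-i (n + a) θ}) e^{i (n + 1) θ}`. -/
def rotTerm (C θ : ℝ) (a n : ℕ) (z : ℂ) : ℂ :=
  -((C * (z * cis (-((n + a) * θ))).im : ℝ) : ℂ) * cis ((n + 1) * θ)

/-- The tangential part of one increment is a product of two sines of angles that differ by `(1 - a)
θ`. It equals half of `cos ((1 - a) θ)` minus an oscillating cosine, which sums to zero over `T`
steps. -/
theorem isRotating_rotTerm {C θ : ℝ} {a T : ℕ} (hC : 0 < C) (hT : 0 < T)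
    (hcos : 0 < Real.cos ((1 - a) * θ)) (hθ : cis (2 * θ) ≠ 1) (hTθ : cis (T * (2 * θ)) = 1) :
    IsRotating (rotTerm C θ a) C T (C * T / 2 * Real.cos ((1 - a) * θ)) where
  map_zero n := by simp [rotTerm]
  lipschitz n z z' := by
    have h : rotTerm C θ a n z - rotTerm C θ a n z' =
        -((C * ((z - z') * cis (-((n + a) * θ))).im : ℝ) : ℂ) * cis ((n + 1) * θ) := by
      rw [rotTerm, rotTerm, sub_mul z, Complex.sub_im]
      push_cast
      ring
    rw [h, norm_mul, norm_neg, norm_cis, mul_one, Complex.norm_real, norm_mul,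
      Real.norm_of_nonneg hC.le]
    refine mul_le_mul_of_nonneg_left ((Complex.abs_im_le_norm _).trans ?_) hC.le
    rw [norm_mul, norm_cis, mul_one]
  pos := by positivity
  average n z := by
    have h : ∀ j : ℕ, (rotTerm C θ a (n + j) z * (starRingEnd ℂ) z).im =
        C * ‖z‖ ^ 2 / 2 * Real.cos ((1 - a) * θ) -
          C * ‖z‖ ^ 2 / 2 * Real.cos ((2 * z.arg - (2 * n + a + 1) * θ) - j * (2 * θ)) := fun j => by
      have h1 : (cis (((n + j : ℕ) + 1) * θ) * (starRingEnd ℂ) z).im =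
          -(‖z‖ * Real.sin (z.arg - ((n + j : ℕ) + 1) * θ)) := by
        rw [← im_mul_cis_neg, ← conj_cis, ← Complex.conj_im, map_mul, Complex.conj_conj, mul_comm]
      have h2 : (rotTerm C θ a (n + j) z * (starRingEnd ℂ) z).im =
          (C * (‖z‖ * Real.sin (z.arg - ((n + j : ℕ) + a) * θ))) *
            (‖z‖ * Real.sin (z.arg - ((n + j : ℕ) + 1) * θ)) := by
        rw [rotTerm, im_mul_cis_neg, mul_assoc, neg_mul, Complex.neg_im, Complex.im_ofReal_mul, h1]
        ring
      have h3 : Real.cos ((1 - a) * θ) -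
          Real.cos ((2 * z.arg - (2 * n + a + 1) * θ) - j * (2 * θ)) =
          2 * (Real.sin (z.arg - ((n + j : ℕ) + a) * θ) *
            Real.sin (z.arg - ((n + j : ℕ) + 1) * θ)) := by
        rw [show (1 - (a : ℝ)) * θ = (z.arg - ((n + j : ℕ) + a) * θ) -
          (z.arg - ((n + j : ℕ) + 1) * θ) by ring,
          show (2 * z.arg - (2 * n + a + 1) * θ) - j * (2 * θ) = (z.arg - ((n + j : ℕ) + a) * θ) +
          (z.arg - ((n + j : ℕ) + 1) * θ) by push_cast; ring, Real.cos_sub, Real.cos_add]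
        ring
      rw [h2, ← mul_sub, h3]
      ring
    simp only [h]
    rw [Finset.sum_sub_distrib, ← Finset.mul_sum, ← Finset.mul_sum, sum_cos_eq_zero hθ hTθ]
    simp only [Finset.sum_const, Finset.card_range, nsmul_eq_mul]
    ring

/-- The holonomic sequences are, up to positive factors, the coordinates in a uniformly rotating
frame of vectors which satisfy a slowly rotating recurrence. -/
structure IsRotationForm (P Q : RatFunc ℝ) (θ : ℝ) (δ : ℕ → ℝ) (W : ℕ → (ℝ × ℝ →ₗ[ℝ] ℂ)) (C : ℝ)
    (a N : ℕ) : Prop where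
  pos : 0 < C
  cos_pos : 0 < Real.cos ((1 - a) * θ)
  cis_ne : cis (2 * θ) ≠ 1
  sign_eq : ∀ n v, SignType.sign (sol P Q n v) = SignType.sign (W n v * cis (-(n * θ))).im
  eq_zero : ∀ n v, W n v = 0 → v = 0
  step : ∀ n ≥ N, ∀ v, W (n + 1) v = W n v + δ n * rotTerm C θ a n (W n v)

theorem IsRotationForm.isRotating {P Q : RatFunc ℝ} {θ : ℝ} {δ : ℕ → ℝ} {W : ℕ → (ℝ × ℝ →ₗ[ℝ] ℂ)}
    {C : ℝ} {a N : ℕ} (h : IsRotationForm P Q θ δ W C a N) {T : ℕ} (hT : 0 < T)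
    (hTθ : cis (T * (2 * θ)) = 1) :
    IsRotating (rotTerm C θ a) C T (C * T / 2 * Real.cos ((1 - a) * θ)) :=
  isRotating_rotTerm h.pos hT h.cos_pos h.cis_ne hTθ

theorem IsRotationForm.variation {P Q : RatFunc ℝ} {θ : ℝ} {δ : ℕ → ℝ} {W : ℕ → (ℝ × ℝ →ₗ[ℝ] ℂ)}
    {C : ℝ} {a N : ℕ} (h : IsRotationForm P Q θ δ W C a N) (v : ℝ × ℝ) :
    ∀ n ≥ N, ‖W (n + 1) v - W n v‖ ≤ (C * |δ n|) * ‖W n v‖ := fun n hn => by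
  rw [h.step n hn, add_sub_cancel_left, norm_mul, rotTerm, norm_mul, norm_neg, norm_cis, mul_one,
    Complex.norm_real, Complex.norm_real, norm_mul, Real.norm_of_nonneg h.pos.le, Real.norm_eq_abs,
    Real.norm_eq_abs]
  have h1 : |(W n v * cis (-((n + a) * θ))).im| ≤ ‖W n v‖ := by
    refine (Complex.abs_im_le_norm _).trans ?_
    rw [norm_mul, norm_cis, mul_one]
  have h2 := mul_le_mul_of_nonneg_left h1 (mul_nonneg h.pos.le (abs_nonneg (δ n)))
  linarith

theorem cis_int_mul_two_pi (l : ℤ) : cis (l * (2 * Real.pi)) = 1 := by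
  rw [cis, Complex.exp_eq_one_iff]
  exact ⟨l, by push_cast; ring⟩

/-- Slow rotation relative to a frame rotating by an irrational angle. -/
theorem IsRotationForm.no_sign_of_irrational {P Q : RatFunc ℝ} {θ : ℝ} {δ : ℕ → ℝ}
    {W : ℕ → (ℝ × ℝ →ₗ[ℝ] ℂ)} {C : ℝ} {a N : ℕ} (h : IsRotationForm P Q θ δ W C a N)
    (hδ : Tendsto δ atTop (𝓝 0)) (hirr : ∀ τ : ℕ, 0 < τ → cis (2 * (τ * θ)) ≠ 1) {v : ℝ × ℝ}
    (hv : v ≠ 0) (s : List SignType) : ¬ HasUltimateSign (fun n => sol P Q n v) s := by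
  intro hs
  obtain ⟨τ, hτ, hper⟩ := hs.exists_period
  obtain ⟨M, hM⟩ := exists_sin_lt (hirr τ hτ)
  have hβ : Tendsto (fun n => C * |δ n|) atTop (𝓝 0) := by simpa using hδ.abs.const_mul C
  have hne : ∀ n, W n v ≠ 0 := fun n h0 => hv (h.eq_zero n v h0)
  have hD := tendsto_relative_variation (h.variation v) (fun n _ => hne n) hβ
  have hD' : ∀ᶠ n in atTop, ∀ m < M, ‖W (n + m * τ) v - W n v‖ / ‖W n v‖ < 1 / 8 := by
    have : ∀ᶠ n in atTop, ∀ m ∈ Finset.range M,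
        ‖W (n + m * τ) v - W n v‖ / ‖W n v‖ < 1 / 8 :=
      (Filter.eventually_all_finset _).2 fun m _ =>
        (hD (m * τ)).eventually_lt_const (by norm_num)
    filter_upwards [this] with n hn m hm
    exact hn m (Finset.mem_range.2 hm)
  obtain ⟨K, hK⟩ := eventually_atTop.1 hper
  obtain ⟨n, hn, hnK⟩ := (hD'.and (eventually_ge_atTop K)).exists
  have hsame : ∀ m : ℕ, SignType.sign (W (n + m * τ) v * cis (-((n + m * τ : ℕ) * θ))).im =
      SignType.sign (sol P Q n v) := fun m => by
    rw [← h.sign_eq]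
    induction m with
    | zero => simp
    | succ m ih =>
      rw [← ih, ← hK (n + m * τ) (hnK.trans (Nat.le_add_right _ _))]
      congr 2
      ring_nf
  -- While `W` moves by less than an eighth of its length, the normalized term `n + m τ` is within
  -- `1/8` of a pure sine. That sine drops below `-1/8` for some `m < M`, whatever the phase.
  have happ : ∀ m < M, |(W (n + m * τ) v * cis (-((n + m * τ : ℕ) * θ))).im / ‖W n v‖ -
      Real.sin ((W n v).arg - n * θ - m * (τ * θ))| ≤ 1 / 8 := fun m hm => by
    have hpos : 0 < ‖W n v‖ := norm_pos_iff.2 (hne n)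
    have h1 := im_mul_cis_neg (W n v) ((n + m * τ : ℕ) * θ)
    have h2 : Real.sin ((W n v).arg - n * θ - m * (τ * θ)) =
        (W n v * cis (-((n + m * τ : ℕ) * θ))).im / ‖W n v‖ := by
      rw [h1, mul_div_cancel_left₀ _ hpos.ne']
      congr 1
      push_cast
      ring
    rw [h2, ← sub_div, ← Complex.sub_im, ← sub_mul, abs_div, abs_of_pos hpos]
    refine le_trans ?_ (hn m hm).le
    gcongr
    refine (Complex.abs_im_le_norm _).trans ?_
    rw [norm_mul, norm_cis, mul_one]
  have hpos : 0 < ‖W n v‖ := norm_pos_iff.2 (hne n)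
  rcases le_or_gt 0 (sol P Q n v) with h0 | h0
  · obtain ⟨m, hm, hlt⟩ := hM ((W n v).arg - n * θ)
    have h1 : 0 ≤ (W (n + m * τ) v * cis (-((n + m * τ : ℕ) * θ))).im := by
      rw [← sign_nonneg_iff, hsame, sign_nonneg_iff]
      exact h0
    have h2 := div_nonneg h1 hpos.le
    have h3 := (abs_le.1 (happ m hm)).2
    linarith
  · obtain ⟨m, hm, hlt⟩ := hM ((W n v).arg - n * θ + Real.pi)
    have h1 : (W (n + m * τ) v * cis (-((n + m * τ : ℕ) * θ))).im ≤ 0 := by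
      rw [← sign_nonpos_iff, hsame, sign_nonpos_iff]
      exact h0.le
    have h2 := div_nonpos_of_nonpos_of_nonneg h1 hpos.le
    have h3 := (abs_le.1 (happ m hm)).1
    rw [show (W n v).arg - n * θ + Real.pi - m * (τ * θ) =
      (W n v).arg - n * θ - m * (τ * θ) + Real.pi by ring, Real.sin_add_pi] at hlt
    linarith

/-- Slow rotation by a divergent total angle relative to a frame rotating by a rational angle. -/
theorem IsRotationForm.no_sign_of_divergent {P Q : RatFunc ℝ} {θ : ℝ} {δ : ℕ → ℝ}
    {W : ℕ → (ℝ × ℝ →ₗ[ℝ] ℂ)} {C : ℝ} {a N : ℕ} (h : IsRotationForm P Q θ δ W C a N)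
    (hδ : Tendsto δ atTop (𝓝 0)) (hδ1 : Tendsto (fun n => δ (n + 1) / δ n) atTop (𝓝 1))
    {c : ℝ} (hc : 0 < c) (hlow : ∀ᶠ n : ℕ in atTop, c / n ≤ |δ n|)
    {T₀ : ℕ} (hT₀ : 0 < T₀) (hrat : cis (T₀ * θ) = 1) {v : ℝ × ℝ}
    (hv : v ≠ 0) (s : List SignType) : ¬ HasUltimateSign (fun n => sol P Q n v) s := by
  intro hs
  obtain ⟨τ, hτ, hper⟩ := hs.exists_period
  -- Along multiples of `T` the frame returns to its initial position and the sign repeats, so these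
  -- samples of `W` stay in one closed half plane.
  set T := T₀ * τ with hTdef
  have hT : 0 < T := Nat.mul_pos hT₀ hτ
  have hTmul : ∀ l : ℕ, cis ((l * T : ℕ) * θ) = 1 := fun l => by
    rw [hTdef, show ((l * (T₀ * τ) : ℕ) : ℝ) * θ = (l * τ : ℕ) * (T₀ * θ) by push_cast; ring,
      cis_nat_mul, hrat, one_pow]
  have hTθ : cis (T * (2 * θ)) = 1 := by
    rw [show (T : ℝ) * (2 * θ) = (2 * T : ℕ) * θ by push_cast; ring, hTmul]
  have hrot := h.isRotating hT hTθ
  set κ := C * T / 2 * Real.cos ((1 - a) * θ) with hκ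
  have hκ0 := hrot.pos
  have hne : ∀ n, W n v ≠ 0 := fun n h0 => hv (h.eq_zero n v h0)
  have hβ : Tendsto (fun n => C * |δ n|) atTop (𝓝 0) := by simpa using hδ.abs.const_mul C
  have hdrift := hrot.drift (w := fun n => W n v) (fun n hn => h.step n hn v) (fun n _ => hne n)
    hδ hδ1
  have hrel := (tendsto_relative_variation (h.variation v) (fun n _ => hne n) hβ T).eventually_lt_const
    one_pos
  obtain ⟨σ, hσ, hσδ⟩ := exists_sign_of_ratio hδ1
  obtain ⟨K, hK⟩ := eventually_atTop.1 (hper.and (hlow.and (hdrift.and (hrel.and hσδ))))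
  set m₀ := K + 1 with hm₀
  have hKm : ∀ m, K ≤ (m + m₀) * T := fun m =>
    (show K ≤ m + m₀ by omega).trans (Nat.le_mul_of_pos_right _ hT)
  set ζ : ℕ → ℂ := fun m => W ((m + m₀) * T) v with hζ
  have hsign : ∀ m, SignType.sign (ζ m).im = SignType.sign (ζ 0).im := fun m => by
    have hW : ∀ m, SignType.sign (ζ m).im = SignType.sign (sol P Q ((m + m₀) * T) v) := fun m => by
      rw [h.sign_eq, cis_neg_eq_one_iff.2 (hTmul (m + m₀)), mul_one]
    have hT' : ∀ n ≥ K, ∀ l : ℕ, SignType.sign (sol P Q (n + l * τ) v) =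
        SignType.sign (sol P Q n v) := fun n hn l => by
      induction l with
      | zero => simp
      | succ l ih =>
        rw [← ih, ← (hK (n + l * τ) (by omega)).1]
        congr 2
        ring_nf
    rw [hW, hW, ← hT' ((0 + m₀) * T) (hKm 0) (m * T₀)]
    congr 2
    rw [hTdef]
    ring_nf
  obtain ⟨s, hs, hζs⟩ : ∃ s : ℝ, (s = 1 ∨ s = -1) ∧ ∀ m, 0 ≤ s * (ζ m).im := by
    rcases le_or_gt 0 (ζ 0).im with h0 | h0
    · refine ⟨1, Or.inl rfl, fun m => ?_⟩
      rw [one_mul, ← sign_nonneg_iff, hsign, sign_nonneg_iff]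
      exact h0
    · refine ⟨-1, Or.inr rfl, fun m => ?_⟩
      have : (ζ m).im ≤ 0 := by
        rw [← sign_nonpos_iff, hsign, sign_nonpos_iff]
        exact h0.le
      linarith
  have hnext : ∀ m, ζ (m + 1) = W ((m + m₀) * T + T) v := fun m => by
    rw [hζ]
    simp only
    congr 2
    ring
  -- The constant converts the drift `κ/2 * c/n` at `n = (m + m₀) T` into a multiple of `1/(m+1)`,
  -- by `m + m₀ ≤ m₀ (m + 1)`.
  refine not_rotating_in_halfPlane (ζ := ζ) (c := κ * c / (2 * T * m₀)) (by positivity) hσ hs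
    (fun m => hne _) hζs (fun m => ?_) fun m => ?_
  · have h1 := (hK _ (hKm m)).2.2.2.1
    have hpos : 0 < ‖ζ m‖ := norm_pos_iff.2 (hne _)
    rw [div_lt_one hpos] at h1
    rw [hnext]
    have h2 := norm_add_le (W ((m + m₀) * T + T) v - ζ m) (ζ m)
    rw [sub_add_cancel] at h2
    linarith
  · obtain ⟨-, h1, h2, -, h3⟩ := hK _ (hKm m)
    rw [hnext]
    set n := (m + m₀) * T with hn
    change κ * c / (2 * T * m₀) / ((m : ℝ) + 1) * ‖W n v‖ ^ 2 ≤
      σ * (W (n + T) v * (starRingEnd ℂ) (W n v)).im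
    set I := (W (n + T) v * (starRingEnd ℂ) (W n v)).im with hI
    have hσ2 : σ * σ = 1 := by rcases hσ with rfl | rfl <;> norm_num
    have hδabs : |δ n| = σ * δ n := by
      rw [← abs_of_pos h3, abs_mul]
      rcases hσ with rfl | rfl <;> simp
    have h4 : κ / 2 * (σ * δ n) * ‖W n v‖ ^ 2 ≤ σ * I := by
      have h5 : (σ * δ n) * (κ / 2 * (σ * δ n) * ‖W n v‖ ^ 2) ≤ (σ * δ n) * (σ * I) := by
        calc (σ * δ n) * (κ / 2 * (σ * δ n) * ‖W n v‖ ^ 2)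
            = (σ * σ) * (κ / 2 * δ n ^ 2 * ‖W n v‖ ^ 2) := by ring
          _ ≤ (σ * σ) * (δ n * I) := mul_le_mul_of_nonneg_left h2 (by rw [hσ2]; norm_num)
          _ = (σ * δ n) * (σ * I) := by ring
      exact le_of_mul_le_mul_left h5 h3
    refine le_trans ?_ h4
    have h6 : κ * c / (2 * T * m₀) / ((m : ℝ) + 1) ≤ κ / 2 * (σ * δ n) := by
      rw [← hδabs]
      have h7 := mul_le_mul_of_nonneg_left h1 (show 0 ≤ κ / 2 by positivity)
      refine le_trans ?_ h7
      have hm1 : (1 : ℝ) ≤ m₀ := by rw [hm₀]; push_cast; linarith [K.cast_nonneg (α := ℝ)]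
      rw [hn, div_div, ← mul_div_assoc, div_le_div_iff₀ (by positivity) (by positivity)]
      push_cast
      have h8 : ((m : ℝ) + m₀) ≤ m₀ * (m + 1) := by nlinarith [m.cast_nonneg (α := ℝ)]
      have h9 : 0 ≤ κ * c * T := by positivity
      nlinarith [mul_le_mul_of_nonneg_left h8 h9]
    exact mul_le_mul_of_nonneg_right h6 (by positivity)

/-! ### Limits and sectors -/

theorem IsRotationForm.exists_limit {P Q : RatFunc ℝ} {θ : ℝ} {δ : ℕ → ℝ}
    {W : ℕ → (ℝ × ℝ →ₗ[ℝ] ℂ)} {C : ℝ} {a N : ℕ} (h : IsRotationForm P Q θ δ W C a N)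
    (hδ : Summable fun n => |δ n|) :
    ∃ M : ℝ × ℝ →ₗ[ℝ] ℝ × ℝ, Function.Injective M ∧
      ∀ v, Tendsto (fun n => W n v) atTop (𝓝 (⟨(M v).1, (M v).2⟩ : ℂ)) := by
  have hex : ∀ v, ∃ z, Tendsto (fun n => W n v) atTop (𝓝 z) ∧ (z = 0 → ∃ n ≥ N, W n v = 0) :=
    fun v => exists_limit_of_summable_variation
      (fun n => mul_nonneg h.pos.le (abs_nonneg _)) (hδ.mul_left C) (h.variation v)
  choose z hz hz0 using hex
  set L : ℝ × ℝ →ₗ[ℝ] ℂ := linearMapOfTendsto z W (tendsto_pi_nhds.2 hz) with hL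
  have hLz : ∀ v, L v = z v := fun v => rfl
  refine ⟨(Complex.reLm ∘ₗ L).prod (Complex.imLm ∘ₗ L), ?_, fun v => hz v⟩
  rw [injective_iff_map_eq_zero]
  intro v hv
  have h1 : (L v).re = 0 := congrArg Prod.fst hv
  have h2 : (L v).im = 0 := congrArg Prod.snd hv
  obtain ⟨n, -, hn⟩ := hz0 v (Complex.ext h1 h2)
  exact h.eq_zero n v hn

theorem IsRotationForm.exists_side {P Q : RatFunc ℝ} {θ : ℝ} {δ : ℕ → ℝ}
    {W : ℕ → (ℝ × ℝ →ₗ[ℝ] ℂ)} {C : ℝ} {a N : ℕ} (h : IsRotationForm P Q θ δ W C a N)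
    (hδ : Tendsto δ atTop (𝓝 0)) (hδ1 : Tendsto (fun n => δ (n + 1) / δ n) atTop (𝓝 1))
    {T : ℕ} (hT : 0 < T) (hTθ : cis (T * (2 * θ)) = 1) {σ : ℝ}
    (hσ : σ = 1 ∨ σ = -1) (hσδ : ∀ᶠ n in atTop, 0 < σ * δ n) {v : ℝ × ℝ} {z : ℂ} (hz0 : z ≠ 0)
    (hz : Tendsto (fun n => W n v) atTop (𝓝 z)) :
    ∀ᶠ n in atTop, σ * (W n v * (starRingEnd ℂ) z).im < 0 := by
  have hv : v ≠ 0 := by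
    rintro rfl
    simp only [map_zero] at hz
    exact hz0 (tendsto_nhds_unique hz tendsto_const_nhds)
  have hne : ∀ n, W n v ≠ 0 := fun n h0 => hv (h.eq_zero n v h0)
  have hrot := h.isRotating hT hTθ
  have hdrift := hrot.drift (w := fun n => W n v) (fun n hn => h.step n hn v) (fun n _ => hne n)
    hδ hδ1
  refine side_of_rotation hz0 hz hT (σ := σ) ?_
  filter_upwards [hdrift, hσδ] with n h1 h2
  have hσ2 : σ * σ = 1 := by rcases hσ with rfl | rfl <;> norm_num
  have hpos : 0 < ‖W n v‖ := norm_pos_iff.2 (hne n)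
  have hδ0 : δ n ≠ 0 := fun h => by rw [h, mul_zero] at h2; exact lt_irrefl _ h2
  have h3 := hrot.pos
  have h4 := lt_of_lt_of_le (by positivity) h1
  have h5 : 0 < (σ * δ n) * (σ * (W (n + T) v * (starRingEnd ℂ) (W n v)).im) := by
    calc 0 < (σ * σ) * (δ n * (W (n + T) v * (starRingEnd ℂ) (W n v)).im) := by
          rw [hσ2, one_mul]; exact h4
      _ = _ := by ring
  exact (pos_iff_pos_of_mul_pos h5).1 h2

/-- Reducing `l` modulo `r` takes the same factor `(-1)^q` out of every sine. For `0 ≤ l < r` the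
two sines on the left are non-negative and not both zero, and the one on the right is positive. -/
theorem sign_sin_combination {r : ℕ} (hr : 2 ≤ r) {A B : ℝ} (hA : 0 < A) (hB : 0 < B) (l : ℤ) :
    SignType.sign (A * Real.sin ((l + 1 : ℤ) * (Real.pi / r)) + B * Real.sin (l * (Real.pi / r))) =
      SignType.sign (Real.sin ((2 * l + 1 : ℤ) * (Real.pi / (2 * r)))) := by
  have hr0 : (0 : ℝ) < r := by positivity
  have hpi := Real.pi_pos
  set q := l / r with hq
  set l₀ := l % r with hl₀
  have hl : l = l₀ + r * q := (Int.emod_add_mul_ediv l r).symm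
  have hl0 : 0 ≤ l₀ := Int.emod_nonneg _ (by omega)
  have hlr : l₀ < r := Int.emod_lt_of_pos _ (by omega)
  have e1 : ((l + 1 : ℤ) : ℝ) * (Real.pi / r) = (l₀ + 1 : ℤ) * (Real.pi / r) + q * Real.pi := by
    rw [hl]; push_cast; field_simp; ring
  have e2 : (l : ℝ) * (Real.pi / r) = l₀ * (Real.pi / r) + q * Real.pi := by
    rw [hl]; push_cast; field_simp
  have e3 : ((2 * l + 1 : ℤ) : ℝ) * (Real.pi / (2 * r)) =
      (2 * l₀ + 1 : ℤ) * (Real.pi / (2 * r)) + q * Real.pi := by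
    rw [hl]; push_cast; field_simp; ring
  rw [e1, e2, e3, Real.sin_add_int_mul_pi, Real.sin_add_int_mul_pi, Real.sin_add_int_mul_pi]
  have p3 : 0 < Real.sin ((2 * l₀ + 1 : ℤ) * (Real.pi / (2 * r))) :=
    sin_pos_of_int (by omega) (by omega)
  have half : ∀ z : ℤ, (z : ℝ) * (Real.pi / r) = (2 * z : ℤ) * (Real.pi / (2 * r)) := fun z => by
    push_cast; field_simp
  have p12 : 0 < A * Real.sin ((l₀ + 1 : ℤ) * (Real.pi / r)) + B * Real.sin (l₀ * (Real.pi / r)) := by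
    have s1 : 0 ≤ Real.sin ((l₀ + 1 : ℤ) * (Real.pi / r)) := by
      apply Real.sin_nonneg_of_nonneg_of_le_pi
      · have : (0 : ℝ) ≤ (l₀ + 1 : ℤ) := by exact_mod_cast (by omega : (0 : ℤ) ≤ l₀ + 1)
        positivity
      · have : ((l₀ + 1 : ℤ) : ℝ) ≤ r := by exact_mod_cast (by omega : l₀ + 1 ≤ (r : ℤ))
        rw [← mul_div_assoc, div_le_iff₀ hr0]
        nlinarith
    rcases hl0.eq_or_lt with h0 | h0
    · rw [← h0, half (0 + 1)]
      have s2 : 0 < Real.sin ((2 * (0 + 1) : ℤ) * (Real.pi / (2 * r))) :=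
        sin_pos_of_int (by omega) (by omega)
      simp only [Int.cast_zero, zero_mul, Real.sin_zero, mul_zero, add_zero]
      exact mul_pos hA s2
    · have s2 : 0 < Real.sin (l₀ * (Real.pi / r)) := by
        rw [half]
        exact sin_pos_of_int (by omega) (by omega)
      have := mul_pos hB s2
      have := mul_nonneg hA.le s1
      linarith
  have hfac : A * ((-1) ^ q * Real.sin ((l₀ + 1 : ℤ) * (Real.pi / r))) +
      B * ((-1) ^ q * Real.sin (l₀ * (Real.pi / r))) = (-1) ^ q *
      (A * Real.sin ((l₀ + 1 : ℤ) * (Real.pi / r)) + B * Real.sin (l₀ * (Real.pi / r))) := by ring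
  rw [hfac, sign_mul, sign_mul, sign_pos p12, sign_pos p3]

/-- By the addition theorem, `Im (z e^{-imπ/r})` is a combination of the two functionals that bound
the sector, with sines as coefficients. The two inequalities thus fix its sign for every `m`. -/
theorem sign_im_of_sector {r : ℕ} (hr : 2 ≤ r) {z : ℂ} {j : ℕ}
    (h1 : 0 < (z * cis (-(j * (Real.pi / r)))).im)
    (h2 : (z * cis (-((j + 1) * (Real.pi / r)))).im < 0) (m : ℕ) :
    SignType.sign (z * cis (-(m * (Real.pi / r)))).im =
      SignType.sign (Real.sin ((2 * j + 1 - 2 * m : ℤ) * (Real.pi / (2 * r)))) := by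
  have hr0 : (0 : ℝ) < r := by positivity
  have hs : 0 < Real.sin (Real.pi / r) := by
    have := sin_pos_of_int (r := r) (z := 2) (by omega) (by omega)
    rwa [show ((2 : ℤ) : ℝ) * (Real.pi / (2 * r)) = Real.pi / r by push_cast; field_simp] at this
  set A := (z * cis (-(j * (Real.pi / r)))).im with hA
  set B := -(z * cis (-((j + 1) * (Real.pi / r)))).im with hB
  have hB0 : 0 < B := by rw [hB]; linarith
  have hid : Real.sin (Real.pi / r) * (z * cis (-(m * (Real.pi / r)))).im =
      A * Real.sin (((j - m : ℤ) + 1 : ℤ) * (Real.pi / r)) +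
      B * Real.sin ((j - m : ℤ) * (Real.pi / r)) := by
    rw [hA, hB, im_mul_cis_neg, im_mul_cis_neg, im_mul_cis_neg]
    set φ := z.arg
    set β := Real.pi / r
    push_cast
    rw [show φ - m * β = (φ - j * β) + (j - m) * β by ring,
      show φ - (j + 1) * β = (φ - j * β) - β by ring,
      show ((j : ℝ) - m + 1) * β = (j - m) * β + β by ring]
    generalize φ - j * β = x
    generalize ((j : ℝ) - m) * β = y
    rw [Real.sin_add, Real.sin_add, Real.sin_sub]
    ring
  have h3 : SignType.sign (z * cis (-(m * (Real.pi / r)))).im =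
      SignType.sign (Real.sin (Real.pi / r) * (z * cis (-(m * (Real.pi / r)))).im) := by
    rw [sign_mul, sign_pos hs, one_mul]
  rw [h3, hid, sign_sin_combination hr h1 hB0]
  congr 3
  push_cast
  ring

/-! ### Rotating frames for elliptic recurrences -/

/-- `ρ⁻ⁿ e^{i n θ} (ρ e^{iθ} G n v - G (n + 1) v)`. -/
def frame (ρ θ : ℝ) (G : ℕ → (ℝ × ℝ →ₗ[ℝ] ℝ)) (n : ℕ) : ℝ × ℝ →ₗ[ℝ] ℂ where
  toFun v := ((ρ⁻¹ ^ n : ℝ) : ℂ) * cis (n * θ) * (ρ * cis θ * (G n v : ℝ) - (G (n + 1) v : ℝ))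
  map_add' v v' := by simp only [map_add, Complex.ofReal_add]; ring
  map_smul' t v := by
    simp only [map_smul, smul_eq_mul, Complex.ofReal_mul, RingHom.id_apply, Complex.real_smul]; ring

theorem frame_apply (ρ θ : ℝ) (G : ℕ → (ℝ × ℝ →ₗ[ℝ] ℝ)) (n : ℕ) (v : ℝ × ℝ) :
    frame ρ θ G n v = ((ρ⁻¹ ^ n : ℝ) : ℂ) * cis (n * θ) *
      (ρ * cis θ * (G n v : ℝ) - (G (n + 1) v : ℝ)) := rfl

theorem frame_im (ρ θ : ℝ) (G : ℕ → (ℝ × ℝ →ₗ[ℝ] ℝ)) (n : ℕ) (v : ℝ × ℝ) :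
    (frame ρ θ G n v * cis (-(n * θ))).im = ρ⁻¹ ^ n * (ρ * Real.sin θ * G n v) := by
  have h : frame ρ θ G n v * cis (-(n * θ)) =
      ((ρ⁻¹ ^ n : ℝ) : ℂ) * (ρ * cis θ * (G n v : ℝ) - (G (n + 1) v : ℝ)) := by
    have : cis (n * θ) * cis (-(n * θ)) = 1 := by rw [← cis_add, add_neg_cancel, cis_zero]
    rw [frame_apply]
    linear_combination ((ρ⁻¹ ^ n : ℝ) : ℂ) * (ρ * cis θ * (G n v : ℝ) - (G (n + 1) v : ℝ)) * this
  rw [h, Complex.im_ofReal_mul, Complex.sub_im, Complex.ofReal_im, sub_zero, mul_assoc (ρ : ℂ),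
    Complex.im_ofReal_mul, Complex.im_mul_ofReal, cis_im, mul_assoc]

theorem frame_eq_zero {ρ θ : ℝ} (hρ : 0 < ρ) (hθ : 0 < Real.sin θ) {G : ℕ → (ℝ × ℝ →ₗ[ℝ] ℝ)}
    {n : ℕ} {v : ℝ × ℝ} (h : frame ρ θ G n v = 0) : G n v = 0 ∧ G (n + 1) v = 0 := by
  have h1 := frame_im ρ θ G n v
  rw [h, zero_mul, Complex.zero_im] at h1
  have h2 : G n v = 0 := by
    have : ρ⁻¹ ^ n * (ρ * Real.sin θ) ≠ 0 := by positivity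
    have h3 : ρ⁻¹ ^ n * (ρ * Real.sin θ) * G n v = 0 := by linarith
    exact (mul_eq_zero.1 h3).resolve_left this
  refine ⟨h2, ?_⟩
  rw [frame_apply, h2, Complex.ofReal_zero, mul_zero, zero_sub, mul_eq_zero] at h
  have h4 : ((ρ⁻¹ ^ n : ℝ) : ℂ) * cis (n * θ) ≠ 0 :=
    mul_ne_zero (by exact_mod_cast (by positivity : ρ⁻¹ ^ n ≠ 0)) (cis_ne_zero _)
  have h5 := neg_eq_zero.1 (h.resolve_left h4)
  exact_mod_cast h5

/-- The frame is constant along the recurrence with roots `ρ e^{±iθ}`, that is, for `A = 2ρ cos θ`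
and `B = ρ²`. Only the deviation from these coefficients remains. -/
theorem frame_succ {ρ θ : ℝ} (hρ : 0 < ρ) {G : ℕ → (ℝ × ℝ →ₗ[ℝ] ℝ)} {n : ℕ} {v : ℝ × ℝ} {A B : ℝ}
    (hG : G (n + 2) v = A * G (n + 1) v - B * G n v) :
    frame ρ θ G (n + 1) v = frame ρ θ G n v +
      ((ρ⁻¹ ^ (n + 1) * ((2 * ρ * Real.cos θ - A) * G (n + 1) v + (B - ρ ^ 2) * G n v) : ℝ) : ℂ) *
        cis ((n + 1) * θ) := by
  have h1 : cis (n * θ) = cis ((n + 1) * θ) * cis (-θ) := by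
    rw [← cis_add]; congr 1; ring
  have h2 : cis θ * cis (-θ) = 1 := by rw [← cis_add, add_neg_cancel, cis_zero]
  have h3 : cis θ + cis (-θ) = ((2 * Real.cos θ : ℝ) : ℂ) := by
    apply Complex.ext
    · rw [Complex.add_re, cis_re, cis_re, Real.cos_neg, Complex.ofReal_re]; ring
    · rw [Complex.add_im, cis_im, cis_im, Real.sin_neg, Complex.ofReal_im]; ring
  have h4 : ρ⁻¹ ^ n = ρ⁻¹ ^ (n + 1) * ρ := by
    rw [pow_succ, mul_assoc, inv_mul_cancel₀ hρ.ne', mul_one]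
  rw [frame_apply, frame_apply, hG, h1, h4]
  push_cast at *
  linear_combination ((ρ : ℂ)⁻¹ ^ (n + 1) * cis ((n + 1) * θ) * ρ * (G (n + 1) v : ℝ)) * h3 -
    ((ρ : ℂ)⁻¹ ^ (n + 1) * cis ((n + 1) * θ) * ρ ^ 2 * (G n v : ℝ)) * h2

theorem cis_two_mul_ne_one {θ : ℝ} (h : 0 < Real.sin θ) : cis (2 * θ) ≠ 1 := fun h1 => by
  have h2 := congrArg Complex.re h1
  rw [cis_re, Complex.one_re, Real.cos_two_mul, Real.cos_sq'] at h2
  nlinarith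

/-- In the normal form the middle coefficient is `1`, which forces `2ρ cos θ = 1`; then `ρ² = 1/(4
cos² θ)` is minus the limiting value of `R`. The deviation multiplies the term of index `n`, whence
`a = 0`. -/
theorem exists_rotationForm_of_lt {P Q : RatFunc ℝ} (hP : P ≠ 0) (hQ : NoZerosOrPoles Q)
    (hpos : RatHasUltimateSign P [1]) {θ : ℝ} (h0 : 0 < θ) (h1 : θ < Real.pi / 2) :
    ∃ W C N, IsRotationForm P Q θ (fun n => val (normQ P Q) n + 1 / (4 * Real.cos θ ^ 2)) W C 0 N := by
  obtain ⟨c, hc, hrec⟩ := exists_normalForm (Q := Q) hP hpos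
  obtain ⟨N, hN⟩ := eventually_atTop.1 hrec
  have hcos : 0 < Real.cos θ := Real.cos_pos_of_mem_Ioo ⟨by linarith, h1⟩
  have hsin : 0 < Real.sin θ := Real.sin_pos_of_pos_of_lt_pi h0 (by linarith [Real.pi_pos])
  set ρ := 1 / (2 * Real.cos θ) with hρ
  have hρ0 : 0 < ρ := by positivity
  set G : ℕ → (ℝ × ℝ →ₗ[ℝ] ℝ) := fun n => c n • sol P Q n with hG
  refine ⟨frame ρ θ G, 1 / (ρ ^ 2 * Real.sin θ), N, by positivity, by simpa using hcos,
    cis_two_mul_ne_one hsin, fun n v => ?_, fun n v h => ?_, fun n hn v => ?_⟩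
  · rw [frame_im, sign_mul, sign_mul, sign_pos (by positivity : 0 < ρ⁻¹ ^ n),
      sign_pos (by positivity : 0 < ρ * Real.sin θ), one_mul, one_mul]
    exact (sign_mul_sol hc n v).symm
  · obtain ⟨a, b⟩ := frame_eq_zero hρ0 hsin h
    exact eq_zero_of_sol_eq_zero hQ n ((mul_eq_zero.1 a).resolve_left (hc _).ne')
      ((mul_eq_zero.1 b).resolve_left (hc _).ne')
  · have hstep : G (n + 2) v = 1 * G (n + 1) v - (-val (normQ P Q) n) * G n v := by
      have := hN n hn v
      simp only [hG, LinearMap.smul_apply, smul_eq_mul, one_mul, neg_mul, sub_neg_eq_add]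
      exact this
    rw [frame_succ hρ0 hstep, rotTerm, Nat.cast_zero, add_zero, frame_im]
    have e1 : 2 * ρ * Real.cos θ = 1 := by rw [hρ]; field_simp
    have e2 : ρ ^ 2 = 1 / (4 * Real.cos θ ^ 2) := by rw [hρ]; field_simp; ring
    have hs := hsin.ne'
    rw [e1, ← e2, ← mul_assoc]
    congr 2
    rw [← Complex.ofReal_neg, ← Complex.ofReal_mul]
    congr 1
    rw [pow_succ]
    field_simp
    ring

/-- The balanced form `h(n+2) = b n * h(n+1) - h(n)` perturbs a quarter turn, with `ρ = 1`. The
deviation multiplies the term of index `n + 1`, whence `a = 1`. -/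
theorem exists_rotationForm_of_pos_degree {P Q : RatFunc ℝ} (hP : P ≠ 0) (hQ : NoZerosOrPoles Q)
    (hpos : RatHasUltimateSign P [1]) (hR : RatHasUltimateSign (normQ P Q) [-1]) {b : ℕ → ℝ}
    (hb : ∀ n, 0 < b n)
    (hbR : ∀ᶠ n : ℕ in atTop, b n * b (n + 1) * |val (normQ P Q) ((n + 1 : ℕ) : ℝ)| = 1) :
    ∃ W N, IsRotationForm P Q (Real.pi / 2) b W 1 1 N := by
  rw [RatHasUltimateSign, hasUltimateSign_neg_one] at hR
  obtain ⟨c, hc, hrec⟩ := exists_balancedForm (σ := -1) hP hpos hb hbR (by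
    filter_upwards [hR] with n hn
    rw [abs_of_neg hn]
    ring)
  obtain ⟨N, hN⟩ := eventually_atTop.1 hrec
  set G : ℕ → (ℝ × ℝ →ₗ[ℝ] ℝ) := fun n => c n • sol P Q n with hG
  have hsin : 0 < Real.sin (Real.pi / 2) := by rw [Real.sin_pi_div_two]; exact one_pos
  refine ⟨frame 1 (Real.pi / 2) G, N, one_pos, by simp,
    cis_two_mul_ne_one hsin, fun n v => ?_, fun n v h => ?_, fun n hn v => ?_⟩
  · rw [frame_im, Real.sin_pi_div_two, inv_one, one_pow, one_mul, one_mul, one_mul]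
    exact (sign_mul_sol hc n v).symm
  · obtain ⟨a, b⟩ := frame_eq_zero one_pos hsin h
    exact eq_zero_of_sol_eq_zero hQ n ((mul_eq_zero.1 a).resolve_left (hc _).ne')
      ((mul_eq_zero.1 b).resolve_left (hc _).ne')
  · have hstep : G (n + 2) v = b n * G (n + 1) v - 1 * G n v := by
      have := hN n hn v
      simp only [hG, LinearMap.smul_apply, smul_eq_mul]
      linarith
    have him : (frame 1 (Real.pi / 2) G n v * cis (-((n + (1 : ℕ)) * (Real.pi / 2)))).im =
        G (n + 1) v := by
      have h1 : cis (n * (Real.pi / 2)) * cis (-((n + (1 : ℕ)) * (Real.pi / 2))) = -Complex.I := by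
        rw [← cis_add, show (n : ℝ) * (Real.pi / 2) + -((n + (1 : ℕ)) * (Real.pi / 2)) =
          -(Real.pi / 2) by push_cast; ring]
        apply Complex.ext
        · rw [cis_re, Real.cos_neg, Real.cos_pi_div_two]; simp
        · rw [cis_im, Real.sin_neg, Real.sin_pi_div_two]; simp
      have h2 : cis (Real.pi / 2) = Complex.I := by
        apply Complex.ext
        · rw [cis_re, Real.cos_pi_div_two]; simp
        · rw [cis_im, Real.sin_pi_div_two]; simp
      have h3 : frame 1 (Real.pi / 2) G n v * cis (-((n + (1 : ℕ)) * (Real.pi / 2))) =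
          (G n v : ℝ) + (G (n + 1) v : ℝ) * Complex.I := by
        rw [frame_apply, h2, inv_one, one_pow, Complex.ofReal_one]
        linear_combination (Complex.I * (G n v : ℝ) - (G (n + 1) v : ℝ)) * h1 -
          (G n v : ℝ) * Complex.I_sq
      rw [h3]
      simp
    rw [frame_succ one_pos hstep, rotTerm, him, Real.cos_pi_div_two]
    push_cast
    ring

/-! ### The parabolic boundary case -/

/-- Riccati comparison: `y_j = 1/2 + 1/(4(j+1))` satisfies `y_j (1 - y_{j+1}) = 1/4 +
1/(16(j+1)(j+2))`, which dominates `q` as long as `j` does not exceed `L`. Up to there the ratios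
stay above `y_j`. -/
theorem positive_run {g q : ℕ → ℝ} {n L : ℕ}
    (hg : ∀ m ≥ n, g (m + 2) = g (m + 1) - q m * g m) (hq0 : ∀ m ≥ n, 0 ≤ q m)
    (hq : ∀ m ≥ n, q m ≤ 1 / 4 + 1 / (16 * ((L : ℝ) + 2) ^ 2)) (h0 : g n ≤ 0) (h1 : 0 < g (n + 1)) :
    ∀ j ≤ L, 0 < g (n + 1 + j) ∧ (1 / 2 + 1 / (4 * ((j : ℝ) + 1))) * g (n + 1 + j) ≤ g (n + 2 + j) := by
  intro j
  induction j with
  | zero =>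
    intro _
    refine ⟨h1, ?_⟩
    have h2 := mul_nonneg (hq0 n le_rfl) (neg_nonneg.2 h0)
    have h3 := hg n le_rfl
    norm_num
    linarith
  | succ j ih =>
    intro hj
    obtain ⟨i1, i2⟩ := ih (by omega)
    have hy : 0 < 1 / 2 + 1 / (4 * ((j : ℝ) + 1)) := by positivity
    have h2 : 0 < g (n + 1 + (j + 1)) := by
      rw [show n + 1 + (j + 1) = n + 2 + j by ring]
      exact (mul_pos hy i1).trans_le i2
    refine ⟨h2, ?_⟩
    have h3 := hg (n + 1 + j) (by omega)
    rw [show n + 2 + (j + 1) = n + 1 + j + 2 by ring, h3, show n + 1 + (j + 1) = n + 2 + j by ring,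
      show n + 1 + j + 1 = n + 2 + j by ring]
    have hjL : (j : ℝ) + 1 ≤ L := by exact_mod_cast hj
    have h4 : q (n + 1 + j) ≤
        (1 / 2 + 1 / (4 * ((j : ℝ) + 1))) * (1 - (1 / 2 + 1 / (4 * ((j : ℝ) + 1 + 1)))) := by
      have e : (1 / 2 + 1 / (4 * ((j : ℝ) + 1))) * (1 - (1 / 2 + 1 / (4 * ((j : ℝ) + 1 + 1)))) =
          1 / 4 + 1 / (16 * (((j : ℝ) + 1) * (j + 1 + 1))) := by field_simp; ring
      rw [e]
      refine (hq _ (by omega)).trans ?_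
      have : ((j : ℝ) + 1) * (j + 1 + 1) ≤ (L + 2) ^ 2 := by nlinarith [j.cast_nonneg (α := ℝ)]
      gcongr
    have hy1 : 0 ≤ 1 - (1 / 2 + 1 / (4 * ((j : ℝ) + 1 + 1))) := by
      have : 1 / (4 * ((j : ℝ) + 1 + 1)) ≤ 1 / 4 := by
        apply one_div_le_one_div_of_le (by norm_num)
        nlinarith [j.cast_nonneg (α := ℝ)]
      linarith
    have h5 := mul_le_mul_of_nonneg_right h4 i1.le
    have h6 := mul_le_mul_of_nonneg_left i2 hy1
    push_cast
    nlinarith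

/-- For a positive solution let `x` be the ratio of consecutive terms and `v n = n (x n - 1/2)`. The
Riccati equation makes `v` lose `2 (v - 1/4)² + 2ε`, divided by `2 n x`, at each step. So `v` falls
below `-1` and then at least quadratically in `n`, which contradicts `x > 0`. -/
theorem no_positive_solution {g q : ℕ → ℝ} {N : ℕ} {ε : ℝ} (hε : 0 < ε)
    (hg : ∀ n ≥ N, g (n + 2) = g (n + 1) - q n * g n) (hq0 : ∀ n ≥ N, 0 ≤ q n)
    (hq : ∀ n ≥ N, 1 / 16 + ε ≤ (q n - 1 / 4) * ((n : ℝ) * (n + 1))) (hpos : ∀ n ≥ N, 0 < g n) :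
    False := by
  set x : ℕ → ℝ := fun n => g (n + 1) / g n with hx
  have hxpos : ∀ n ≥ N, 0 < x n := fun n hn => div_pos (hpos _ (by omega)) (hpos n hn)
  have hxrec : ∀ n ≥ N, x (n + 1) * x n = x n - q n := fun n hn => by
    have h1 := (hpos n hn).ne'
    have h2 := (hpos (n + 1) (by omega)).ne'
    rw [hx]
    simp only
    rw [show n + 1 + 1 = n + 2 by ring, hg n hn]
    field_simp
  have hxle : ∀ n ≥ N + 1, x n ≤ 1 := fun n hn => by
    obtain ⟨m, rfl⟩ : ∃ m, n = m + 1 := ⟨n - 1, by omega⟩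
    have h1 := hxrec m (by omega)
    have h2 := hxpos m (by omega)
    have h3 := hq0 m (by omega)
    by_contra! h
    nlinarith
  set v : ℕ → ℝ := fun n => n * (x n - 1 / 2) with hv
  have hvrec : ∀ n ≥ N, 2 * n * x n * (v (n + 1) - v n) =
      -(2 * (v n - 1 / 4) ^ 2) + 1 / 8 - 2 * ((q n - 1 / 4) * ((n : ℝ) * (n + 1))) := fun n hn => by
    have h1 := hxrec n hn
    rw [hv]
    simp only
    push_cast
    linear_combination 2 * (n : ℝ) * (n + 1) * h1
  have hvle : ∀ n ≥ N, 2 * n * x n * (v (n + 1) - v n) ≤ -(2 * (v n - 1 / 4) ^ 2) - 2 * ε :=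
    fun n hn => by rw [hvrec n hn]; linarith [hq n hn]
  have hdec : ∀ n ≥ N + 1, v (n + 1) - v n ≤ -(ε / n) := fun n hn => by
    have h1 := hvle n (by omega)
    have h2 := hxle n hn
    have h3 := hxpos n (by omega)
    have hn0 : (0 : ℝ) < n := by
      have : 0 < n := by omega
      exact_mod_cast this
    have h4 : v (n + 1) - v n < 0 := by
      by_contra! h
      have := mul_nonneg (show 0 ≤ 2 * n * x n by positivity) h
      nlinarith [sq_nonneg (v n - 1 / 4)]
    have h5 : n * (v (n + 1) - v n) ≤ -ε := by
      have h6 : n * x n * (v (n + 1) - v n) ≥ n * 1 * (v (n + 1) - v n) := by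
        have := mul_le_mul_of_nonneg_left h2 hn0.le
        nlinarith
      nlinarith [sq_nonneg (v n - 1 / 4)]
    rw [← neg_div, le_div_iff₀ hn0]
    linarith
  -- Otherwise the losses `ε / n` would have a bounded sum.
  obtain ⟨m, hm, hvm⟩ : ∃ m ≥ N + 1, v m ≤ -1 := by
    by_contra! hcon
    have hsum : ∀ M, ∑ i ∈ Finset.range M, ε / ((i + (N + 1) : ℕ) : ℝ) ≤ v (N + 1) - v (M + (N + 1)) :=
      fun M => by
        induction M with
        | zero => simp
        | succ M ih =>
          rw [Finset.sum_range_succ, show M + 1 + (N + 1) = M + (N + 1) + 1 by ring]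
          linarith [hdec (M + (N + 1)) (by omega)]
    have hs : Summable fun i : ℕ => ε / ((i + (N + 1) : ℕ) : ℝ) :=
      summable_of_sum_range_le (c := v (N + 1) + 1) (fun i => by positivity) fun M => by
        linarith [hsum M, hcon (M + (N + 1)) (by omega)]
    have hs' := ((summable_nat_add_iff (f := fun i : ℕ => ε / (i : ℝ)) (N + 1)).1 hs).mul_left ε⁻¹
    refine Real.not_summable_one_div_natCast (hs'.congr fun i => ?_)
    field_simp
  have hvneg : ∀ n ≥ m, v n ≤ -1 := fun n hn => by
    induction n, hn using Nat.le_induction with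
    | base => exact hvm
    | succ n hn ih =>
      have h1 := hdec n (by omega)
      have : 0 ≤ ε / (n : ℝ) := by positivity
      linarith
  have hn0 : ∀ n ≥ m, (0 : ℝ) < n := fun n hn => by
    have : 0 < n := by omega
    exact_mod_cast this
  -- Equivalently, `-v n / (n (n+1))` does not decrease.
  have hgrow : ∀ n ≥ m, -v n * ((n : ℝ) + 2) ≤ -v (n + 1) * n := fun n hn => by
    have h1 := hvle n (by omega)
    have h2 := hxpos n (by omega)
    have h3 := hvneg n hn
    have h4 := hn0 n hn
    have h5 : 2 * n * x n ≤ n := by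
      have : 2 * n * x n = n + 2 * v n := by rw [hv]; ring
      linarith
    have h6 : v (n + 1) - v n ≤ 0 := by
      have h7 := hdec n (by omega)
      have : 0 ≤ ε / (n : ℝ) := by positivity
      linarith
    have h8 : n * (v (n + 1) - v n) ≤ 2 * n * x n * (v (n + 1) - v n) :=
      mul_le_mul_of_nonpos_right h5 h6
    nlinarith
  set c := -v m / (m * (m + 1)) with hc
  have hm0 := hn0 m le_rfl
  have hc0 : 0 < c := div_pos (by linarith) (by positivity)
  have hlow : ∀ n ≥ m, c * (n * (n + 1)) ≤ -v n := fun n hn => by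
    induction n, hn using Nat.le_induction with
    | base => rw [hc]; field_simp; rfl
    | succ n hn ih =>
      have h1 := hgrow n hn
      have h2 := hn0 n hn
      have h3 := mul_le_mul_of_nonneg_right ih (show (0 : ℝ) ≤ n + 2 by positivity)
      have h4 : (c * (((n + 1 : ℕ) : ℝ) * ((n + 1 : ℕ) + 1))) * n ≤ -v (n + 1) * n := by
        push_cast
        linarith
      exact le_of_mul_le_mul_right h4 h2
  obtain ⟨n, hn⟩ := exists_nat_gt (1 / c)
  have h1 := hlow (n + m) (by omega)
  have h2 := hxpos (n + m) (by omega)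
  have h3 := hn0 (n + m) (by omega)
  have h4 : -v (n + m) < ((n + m : ℕ) : ℝ) := by
    rw [hv]
    simp only
    nlinarith
  have h5 : c * (((n + m : ℕ) : ℝ) + 1) < 1 := by
    have : (c * (((n + m : ℕ) : ℝ) + 1)) * ((n + m : ℕ) : ℝ) < 1 * ((n + m : ℕ) : ℝ) := by linarith
    exact lt_of_mul_lt_mul_right this h3.le
  rw [div_lt_iff₀ hc0] at hn
  push_cast at h5
  have h6 : 0 ≤ c * (m : ℝ) := by positivity
  linarith

/-- A passage from `g n ≤ 0` to `g (n+1) > 0` would keep `g` positive up to index `n + τ`, where the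
sign must be that of `g n`. Applied to `g` and `-g`, this shows that `g` stays positive once it is
positive, which is impossible. -/
theorem no_periodic_sign {g q : ℕ → ℝ} {N τ : ℕ} {ε : ℝ} (hε : 0 < ε) (hτ : 0 < τ)
    (hg : ∀ n ≥ N, g (n + 2) = g (n + 1) - q n * g n) (hq0 : ∀ n ≥ N, 0 ≤ q n)
    (hq : ∀ n ≥ N, 1 / 16 + ε ≤ (q n - 1 / 4) * ((n : ℝ) * (n + 1)))
    (hqτ : ∀ m ≥ N, q m ≤ 1 / 4 + 1 / (16 * ((τ : ℝ) + 2) ^ 2))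
    (hper : ∀ n ≥ N, SignType.sign (g (n + τ)) = SignType.sign (g n))
    (hnz : ∀ n ≥ N, g n = 0 → g (n + 1) ≠ 0) {n₀ : ℕ} (hn₀ : N ≤ n₀) (h₀ : 0 < g n₀) : False := by
  have hrun : ∀ f : ℕ → ℝ, (∀ n ≥ N, f (n + 2) = f (n + 1) - q n * f n) →
      (∀ n ≥ N, SignType.sign (f (n + τ)) = SignType.sign (f n)) →
      ∀ n ≥ N, f n ≤ 0 → f (n + 1) ≤ 0 := fun f hf hfp n hn h0 => by
    by_contra! h1
    have h2 := (positive_run (L := τ) (fun m hm => hf m (by omega)) (fun m hm => hq0 m (by omega))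
      (fun m hm => hqτ m (by omega)) h0 h1 (τ - 1) (by omega)).1
    rw [show n + 1 + (τ - 1) = n + τ by omega, ← sign_eq_one_iff, hfp n hn, sign_eq_one_iff] at h2
    exact absurd h2 (not_lt.2 h0)
  have hneg := hrun (fun n => -g n) (fun n hn => by rw [hg n hn]; ring)
    (fun n hn => by rw [Left.sign_neg, Left.sign_neg, hper n hn])
  have hnonneg : ∀ n ≥ n₀, 0 ≤ g n := fun n hn => by
    induction n, hn using Nat.le_induction with
    | base => exact h₀.le
    | succ n hn ih => exact neg_nonpos.1 (hneg n (by omega) (neg_nonpos.2 ih))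
  refine no_positive_solution hε (N := n₀) (fun n hn => hg n (by omega))
    (fun n hn => hq0 n (by omega)) (fun n hn => hq n (by omega)) fun n hn => ?_
  refine (hnonneg n hn).lt_of_ne fun h => ?_
  have h1 := hrun g hg hper n (by omega) h.ge
  exact hnz n (by omega) h.symm (le_antisymm h1 (hnonneg (n + 1) (by omega)))

theorem exists_oscillation_bound {R : RatFunc ℝ} {α₁ α₂ : ℝ}
    (h : HasExpansion R (-(1 / 4)) α₁ α₂) (hl : α₁ < 0 ∨ α₁ = 0 ∧ α₂ < -(1 / 16)) :
    ∃ ε > 0, ∀ᶠ n : ℕ in atTop, 1 / 16 + ε ≤ (-val R n - 1 / 4) * ((n : ℝ) * (n + 1)) := by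
  obtain ⟨K, hK, hb⟩ := h.exists_bound
  obtain ⟨ε, hε, hmain⟩ : ∃ ε > 0, ∀ᶠ n : ℕ in atTop, 1 / 16 + ε ≤ -α₁ * n - α₂ - K / n := by
    have tK : Tendsto (fun n : ℕ => K / (n : ℝ)) atTop (𝓝 0) := tendsto_const_div_atTop_nhds_zero_nat _
    rcases hl with h1 | ⟨h1, h2⟩
    · refine ⟨1, one_pos, ?_⟩
      have t1 : Tendsto (fun n : ℕ => -α₁ * (n : ℝ)) atTop atTop :=
        tendsto_natCast_atTop_atTop.const_mul_atTop (neg_pos.2 h1)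
      filter_upwards [t1.eventually_ge_atTop (1 / 16 + 1 + α₂ + 1),
        tK.eventually_lt_const one_pos] with n h3 h4
      linarith
    -- Half of the gap between `α₂` and `-1/16` serves as `ε`; the other half absorbs `K / n`.
    · refine ⟨(-(1 / 16) - α₂) / 2, by linarith, ?_⟩
      filter_upwards [tK.eventually_lt_const (show 0 < (-(1 / 16) - α₂) / 2 by linarith)] with n h4
      rw [h1]
      linarith
  refine ⟨ε, hε, ?_⟩
  filter_upwards [hb, hmain, eventually_gt_atTop 0] with n h1 h2 hn
  have hx : (0 : ℝ) < n := by exact_mod_cast hn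
  have h3 := (abs_le.1 h1).2
  set x : ℝ := (n : ℝ)
  have h4 : (-α₁ * x - α₂ - K / x) / x ^ 2 ≤ -val R x - 1 / 4 := by
    have e : (-α₁ * x - α₂ - K / x) / x ^ 2 = -(α₁ / x) - α₂ / x ^ 2 - K / x ^ 3 := by field_simp
    rw [e]
    linarith
  have h5 : (1 / 16 + ε) / x ^ 2 ≤ -val R x - 1 / 4 :=
    (div_le_div_of_nonneg_right h2 (by positivity)).trans h4
  calc 1 / 16 + ε = (1 / 16 + ε) / x ^ 2 * (x * x) := by field_simp
    _ ≤ (-val R x - 1 / 4) * (x * (x + 1)) := by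
        have : 0 ≤ (1 / 16 + ε) / x ^ 2 := by positivity
        apply mul_le_mul h5 _ (by positivity) (by linarith)
        nlinarith

theorem no_sign_of_parabolic {P Q : RatFunc ℝ} (hP : P ≠ 0) (hQ : NoZerosOrPoles Q)
    (hpos : RatHasUltimateSign P [1]) {α₁ α₂ : ℝ}
    (h : HasExpansion (normQ P Q) (-(1 / 4)) α₁ α₂) (hl : α₁ < 0 ∨ α₁ = 0 ∧ α₂ < -(1 / 16))
    {v : ℝ × ℝ} (hv : v ≠ 0) (s : List SignType) : ¬ HasUltimateSign (fun n => sol P Q n v) s := by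
  intro hs
  obtain ⟨τ, hτ, hper⟩ := hs.exists_period
  obtain ⟨ε, hε, hosc⟩ := exists_oscillation_bound h hl
  obtain ⟨c, hc, hrec⟩ := exists_normalForm (Q := Q) hP hpos
  have hlim := tendsto_expansion h
  have hneg := hlim.eventually_lt_const (show -(1 / 4) < (0 : ℝ) by norm_num)
  have hgt := hlim.eventually_const_lt
    (show -(1 / 4) - 1 / (16 * ((τ : ℝ) + 2) ^ 2) < -(1 / 4) by
      have : 0 < 1 / (16 * ((τ : ℝ) + 2) ^ 2) := by positivity
      linarith)
  obtain ⟨N, hN⟩ := eventually_atTop.1 (hper.and (hosc.and (hrec.and (hneg.and hgt))))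
  have key : ∀ u : ℝ × ℝ, (∀ n ≥ N, SignType.sign (sol P Q (n + τ) u) = SignType.sign (sol P Q n u)) →
      u ≠ 0 → ∀ n₀ ≥ N, ¬ 0 < sol P Q n₀ u := fun u hu hu0 n₀ hn₀ h0 => by
    refine no_periodic_sign (g := fun n => c n * sol P Q n u) (q := fun n => -val (normQ P Q) n)
      (N := N) hε hτ (fun n hn => ?_) (fun n hn => ?_) (fun n hn => (hN n hn).2.1) (fun n hn => ?_)
      (fun n hn => ?_) (fun n hn h0 h1 => ?_) hn₀ (mul_pos (hc _) h0)
    · rw [neg_mul, sub_neg_eq_add]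
      exact (hN n hn).2.2.1 u
    · exact (neg_pos.2 (hN n hn).2.2.2.1).le
    · linarith [(hN n hn).2.2.2.2]
    · rw [sign_mul_sol hc, sign_mul_sol hc, hu n hn]
    · exact hu0 (eq_zero_of_sol_eq_zero hQ n ((mul_eq_zero.1 h0).resolve_left (hc _).ne')
        ((mul_eq_zero.1 h1).resolve_left (hc _).ne'))
  have hper' : ∀ n ≥ N, SignType.sign (sol P Q (n + τ) v) = SignType.sign (sol P Q n v) :=
    fun n hn => (hN n hn).1
  have k1 := key v hper' hv
  have k2 := key (-v) (fun n hn => by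
    rw [(sol P Q (n + τ)).map_neg, (sol P Q n).map_neg, Left.sign_neg, Left.sign_neg, hper' n hn]) (neg_ne_zero.2 hv)
  have hz : ∀ n ≥ N, sol P Q n v = 0 := fun n hn => by
    have a1 := k1 n hn
    have a2 := k2 n hn
    rw [map_neg] at a2
    linarith
  exact hv (eq_zero_of_sol_eq_zero hQ N (hz N le_rfl) (hz (N + 1) (by omega)))

/-! ### Elliptic types with summable rotation -/

theorem val_C (c x : ℝ) : val (RatFunc.C c) x = c := by simp [val]

theorem HasExpansion.eq_C_of_isConstant {R : RatFunc ℝ} {α₀ α₁ α₂ : ℝ}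
    (h : HasExpansion R α₀ α₁ α₂) (hc : IsConstant R) : R = RatFunc.C α₀ := by
  obtain ⟨c, rfl⟩ := hc
  have h1 := tendsto_expansion h
  simp only [val_C] at h1
  rw [tendsto_nhds_unique tendsto_const_nhds h1]

theorem tendsto_ratio_sub_const {R : RatFunc ℝ} {a : ℝ} (h : R ≠ RatFunc.C a) :
    Tendsto (fun n : ℕ => (val R ((n + 1 : ℕ) : ℝ) - a) / (val R n - a)) atTop (𝓝 1) := by
  refine (tendsto_val_succ_div (sub_ne_zero.2 h)).congr' ?_
  have h1 := tendsto_natCast_atTop_atTop.eventually (eventually_val_sub_C R a)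
  filter_upwards [h1, (tendsto_add_atTop_nat 1).eventually h1] with n h2 h3
  rw [h2, h3]

theorem HasExpansion.summable {R : RatFunc ℝ} {α₀ α₂ : ℝ} (h : HasExpansion R α₀ 0 α₂) :
    Summable fun n : ℕ => |val R n - α₀| := by
  obtain ⟨K, hK, hb⟩ := h.exists_bound
  have hs : Summable fun n : ℕ => (|α₂| + K) * (1 / (n : ℝ) ^ 2) :=
    (Real.summable_one_div_nat_pow.2 one_lt_two).mul_left _
  refine Summable.of_norm_bounded_eventually_nat hs ?_
  filter_upwards [hb, eventually_ge_atTop 1] with n h1 hn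
  have hn1 : (1 : ℝ) ≤ n := by exact_mod_cast hn
  rw [Real.norm_eq_abs, abs_abs]
  have h2 : |α₂ / (n : ℝ) ^ 2| = |α₂| * (1 / (n : ℝ) ^ 2) := by
    rw [abs_div, abs_of_pos (show 0 < (n : ℝ) ^ 2 by positivity), div_eq_mul_one_div]
  have h3 : K / (n : ℝ) ^ 3 ≤ K * (1 / (n : ℝ) ^ 2) := by
    rw [div_eq_mul_one_div]
    gcongr
    norm_num
  have h4 := abs_add_le (val R n - (α₀ + 0 / n + α₂ / (n : ℝ) ^ 2)) (α₂ / (n : ℝ) ^ 2)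
  rw [show val R n - (α₀ + 0 / n + α₂ / (n : ℝ) ^ 2) + α₂ / (n : ℝ) ^ 2 = val R n - α₀ by ring] at h4
  linarith

theorem EventuallyIncreasing.eventually_lt {R : RatFunc ℝ} (h : EventuallyIncreasing R) {a : ℝ}
    (ha : Tendsto (fun n : ℕ => val R n) atTop (𝓝 a)) : ∀ᶠ n : ℕ in atTop, val R n < a := by
  obtain ⟨N, hN⟩ := h
  filter_upwards [tendsto_natCast_atTop_atTop.eventually (eventually_ge_atTop N)] with n hn
  have hn1 : N ≤ ((n + 1 : ℕ) : ℝ) := by push_cast; linarith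
  refine (hN hn hn1 (by push_cast; linarith)).trans_le (ge_of_tendsto ha ?_)
  filter_upwards [eventually_ge_atTop (n + 1)] with m hm
  have hm' : ((n + 1 : ℕ) : ℝ) ≤ m := by exact_mod_cast hm
  exact hN.monotoneOn hn1 (hn1.trans hm') hm'

theorem EventuallyDecreasing.eventually_gt {R : RatFunc ℝ} (h : EventuallyDecreasing R) {a : ℝ}
    (ha : Tendsto (fun n : ℕ => val R n) atTop (𝓝 a)) : ∀ᶠ n : ℕ in atTop, a < val R n := by
  obtain ⟨N, hN⟩ := h
  filter_upwards [tendsto_natCast_atTop_atTop.eventually (eventually_ge_atTop N)] with n hn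
  have hn1 : N ≤ ((n + 1 : ℕ) : ℝ) := by push_cast; linarith
  refine lt_of_le_of_lt (le_of_tendsto ha ?_) (hN hn hn1 (by push_cast; linarith))
  filter_upwards [eventually_ge_atTop (n + 1)] with m hm
  have hm' : ((n + 1 : ℕ) : ℝ) ≤ m := by exact_mod_cast hm
  exact hN.antitoneOn hn1 (hn1.trans hm') hm'

/-- A negative, eventually increasing `R` is bounded near infinity, whereas `b → 0` forces `|R|` to
be unbounded. So for `θ = 1/2` the increasing case is void, in accordance with `δ = b > 0`. -/
theorem not_eventuallyIncreasing_of_balanced {R : RatFunc ℝ} (hneg : RatHasUltimateSign R [-1])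
    {b : ℕ → ℝ} (hb : ∀ n, 0 < b n)
    (hbR : ∀ᶠ n : ℕ in atTop, b n * b (n + 1) * |val R ((n + 1 : ℕ) : ℝ)| = 1)
    (hb0 : Tendsto b atTop (𝓝 0)) : ¬ EventuallyIncreasing R := by
  rintro ⟨N, hN⟩
  rw [RatHasUltimateSign, hasUltimateSign_neg_one] at hneg
  have hlim : Tendsto (fun n => b n * b (n + 1) * |val R N|) atTop (𝓝 0) := by
    simpa using (hb0.mul ((tendsto_add_atTop_iff_nat 1).2 hb0)).mul_const |val R N|
  obtain ⟨n, h1, h2, h3, h4⟩ := (hbR.and ((hlim.eventually_lt_const one_pos).and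
    (((tendsto_add_atTop_nat 1).eventually hneg).and
      (tendsto_natCast_atTop_atTop.eventually (eventually_ge_atTop N))))).exists
  have h5 : N ≤ ((n + 1 : ℕ) : ℝ) := by push_cast; linarith
  have h6 := hN.monotoneOn Set.self_mem_Ici h5 h5
  have h7 : |val R ((n + 1 : ℕ) : ℝ)| ≤ |val R N| := by
    rw [abs_of_neg h3, abs_of_neg (h6.trans_lt h3)]
    linarith
  have := mul_le_mul_of_nonneg_left h7 (mul_pos (hb n) (hb (n + 1))).le
  linarith

theorem exists_rotationForm_of_isOElliptic {P Q : RatFunc ℝ} (hP : P ≠ 0) (hQ : NoZerosOrPoles Q)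
    (hpos : RatHasUltimateSign P [1]) {k r : ℕ} (hk : 0 < k) (hr : 0 < r) (hkr : Nat.Coprime k r)
    (h : IsOElliptic P Q ((k : ℚ) / (r : ℚ))) :
    2 ≤ r ∧ ∃ δ W C a N, IsRotationForm P Q (k * (Real.pi / r)) δ W C a N ∧
      (Summable fun n => |δ n|) ∧ (IsConstant (normQ P Q) → ∀ n, δ n = 0) ∧
      (¬ IsConstant (normQ P Q) → Tendsto (fun n => δ (n + 1) / δ n) atTop (𝓝 1) ∧
        (EventuallyIncreasing (normQ P Q) → ∀ᶠ n in atTop, δ n < 0) ∧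
        (EventuallyDecreasing (normQ P Q) → ∀ᶠ n in atTop, 0 < δ n)) := by
  have hr0 : (0 : ℝ) < r := by exact_mod_cast hr
  have hk0 : (0 : ℝ) < k := by exact_mod_cast hk
  have hrq : (0 : ℚ) < r := by exact_mod_cast hr
  obtain ⟨hneg, ⟨-, α₀, α₁, α₂, hexp, -, -, hθ, hα₀, rfl⟩ | ⟨hd, hθ⟩⟩ := h
  · have hlt : 2 * k < r := by
      rw [div_lt_iff₀ hrq] at hθ
      have : (2 * k : ℚ) < r := by linarith
      exact_mod_cast this
    have hlt' : 2 * (k : ℝ) < r := by exact_mod_cast hlt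
    have e : (((k : ℚ) / (r : ℚ) : ℚ) : ℝ) * Real.pi = k * (Real.pi / r) := by
      push_cast; ring
    rw [e] at hα₀
    obtain ⟨W, C, N, hform⟩ := exists_rotationForm_of_lt hP hQ hpos
      (θ := k * (Real.pi / r)) (by have := Real.pi_pos; positivity) (by
        rw [← mul_div_assoc, div_lt_iff₀ hr0]
        nlinarith [Real.pi_pos])
    have hδ : (fun n : ℕ => val (normQ P Q) n + 1 / (4 * Real.cos (k * (Real.pi / r)) ^ 2)) =
        fun n : ℕ => val (normQ P Q) n - α₀ := by
      funext n; rw [hα₀]; ring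
    rw [hδ] at hform
    refine ⟨by omega, _, W, C, 0, N, hform, hexp.summable, fun hc n => ?_, fun hc =>
      ⟨tendsto_ratio_sub_const fun h => hc ⟨α₀, h⟩, fun hi => ?_, fun hdec => ?_⟩⟩
    · rw [hexp.eq_C_of_isConstant hc, val_C, sub_self]
    · filter_upwards [hi.eventually_lt (tendsto_expansion hexp)] with n hn
      exact sub_neg.2 hn
    · filter_upwards [hdec.eventually_gt (tendsto_expansion hexp)] with n hn
      exact sub_pos.2 hn
  · have hrk : r = 2 * k := by
      rw [div_eq_div_iff hrq.ne' two_ne_zero] at hθ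
      have : k * 2 = 1 * r := by exact_mod_cast hθ
      omega
    -- For `θ = 1/2` coprimality leaves only `k = 1`, `r = 2`, and the quarter-turn frame applies.
    have hk1 : k = 1 := by
      rw [hrk] at hkr
      exact Nat.Coprime.eq_one_of_dvd hkr (Dvd.intro_left 2 rfl)
    subst hk1
    have hR0 := normQ_ne_zero hP (ne_zero_of_noZerosOrPoles hQ)
    obtain ⟨b, hb, hbR, hb2⟩ := exists_balanced hR0
    obtain ⟨W, N, hform⟩ := exists_rotationForm_of_pos_degree hP hQ hpos hneg hb hbR
    have hsum := balanced_summable hR0 hd hb hb2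
    have e : ((1 : ℕ) : ℝ) * (Real.pi / r) = Real.pi / 2 := by rw [hrk]; push_cast; ring
    rw [e]
    refine ⟨by omega, b, W, 1, 1, N, hform, ?_, fun ⟨c, hc⟩ => ?_, fun _ =>
      ⟨tendsto_balanced_ratio hb hbR hb2, fun hi => ?_, fun _ => Eventually.of_forall hb⟩⟩
    · simpa only [abs_of_pos (hb _)] using hsum
    · rw [hc, RatFunc.intDegree_C] at hd
      omega
    · exact (not_eventuallyIncreasing_of_balanced hneg hb hbR
        (balanced_tendsto_zero hR0 (by omega) hb2) hi).elim

/-! ### The arcs of the elliptic types -/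

theorem arrangedInOrder_arcMap {ε : ℝ} (hε : ε = 1 ∨ ε = -1) {T : ℝ ≃o ℝ} (hT : IsCircleLift T)
    {m : ℕ} {S : Fin m → Set (ℝ × ℝ)} {A : Fin m → Set ℝ} (hS : ∀ i, S i = arcMap ε T '' A i)
    (hlt : ∀ i j, i < j → ∀ x ∈ A i, ∀ y ∈ A j, x < y)
    (hturn : ∀ i j, ∀ x ∈ A i, ∀ y ∈ A j, y < x + 2 * Real.pi) : ArrangedInOrder S := by
  refine ⟨ε, hε, fun i => T '' A i, fun i => (hS i).trans (arcMap_image ε T (A i)), ?_, ?_⟩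
  · rintro i j hij _ ⟨x, hx, rfl⟩ _ ⟨y, hy, rfl⟩
    exact T.strictMono (hlt i j hij x hx y hy)
  · rintro i j _ ⟨x, hx, rfl⟩ _ ⟨y, hy, rfl⟩
    linarith [T_lt_add hT (hturn i j x hx y hy)]

/-- The half-open interval that contains `b` if `σ = 1` and `a` otherwise. -/
def halfOpen (σ a b : ℝ) : Set ℝ := if σ = 1 then Set.Ioc a b else Set.Ico a b

theorem closure_halfOpen {σ a b : ℝ} (h : a < b) : closure (halfOpen σ a b) = Set.Icc a b := by
  rw [halfOpen]
  split_ifs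
  · exact closure_Ioc h.ne
  · exact closure_Ico h.ne

theorem halfOpen_lt {σ a b c d x y : ℝ} (hbc : b ≤ c) (hx : x ∈ halfOpen σ a b)
    (hy : y ∈ halfOpen σ c d) : x < y := by
  rw [halfOpen] at hx hy
  split_ifs at hx hy
  · exact (hx.2.trans hbc).trans_lt hy.1
  · exact hx.2.trans_le (hbc.trans hy.1)

theorem halfOpen_add (σ a b c : ℝ) : (fun x => x + c) '' halfOpen σ a b = halfOpen σ (a + c) (b + c) := by
  rw [halfOpen, halfOpen]
  split_ifs
  · exact Set.image_add_const_Ioc c a b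
  · exact Set.image_add_const_Ico c a b

theorem arcMap_image_halfOpen_add {ε : ℝ} (hε : ε = 1 ∨ ε = -1) {T : ℝ ≃o ℝ} (hT : IsCircleLift T)
    (σ a b : ℝ) : arcMap ε T '' halfOpen σ (a + 2 * Real.pi) (b + 2 * Real.pi) =
      arcMap ε T '' halfOpen σ a b := by
  rw [← halfOpen_add, Set.image_image]
  simp only [arcMap_add_two_pi hε hT]

theorem isHalfOpenArc_arcMap_halfOpen {ε : ℝ} (hε : ε = 1 ∨ ε = -1) {T : ℝ ≃o ℝ}
    (hT : IsCircleLift T) {σ a b : ℝ} (hab : a < b) (hb : b < a + 2 * Real.pi) :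
    IsHalfOpenArc (arcMap ε T '' halfOpen σ a b) := by
  rw [halfOpen]
  split_ifs
  · exact isHalfOpenArc_arcMap_Ioc hε hT hab hb
  · exact isHalfOpenArc_arcMap_Ico hε hT hab hb

theorem exists_mem_halfOpen {r : ℕ} (hr : 0 < r) (σ x : ℝ) :
    ∃ j < 2 * r, ∃ y ∈ halfOpen σ (j * (Real.pi / r)) ((j + 1) * (Real.pi / r)),
      ∃ l : ℤ, x = y + l * (2 * Real.pi) := by
  have hr0 : (0 : ℝ) < r := by exact_mod_cast hr
  have hβ : 0 < Real.pi / r := by have := Real.pi_pos; positivity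
  have h2 : 2 * Real.pi = ((2 * r : ℕ) : ℝ) * (Real.pi / r) := by push_cast; field_simp
  simp only [halfOpen]
  split_ifs
  · obtain ⟨y, hy, l, hl⟩ := exists_mod_two_pi_Ioc x
    obtain ⟨j, hj⟩ : ∃ j, ⌈y / (Real.pi / r)⌉₊ = j + 1 :=
      Nat.exists_eq_succ_of_ne_zero (Nat.ceil_pos.2 (div_pos hy.1 hβ)).ne'
    obtain ⟨h3, h4⟩ := (Nat.ceil_eq_iff (Nat.succ_ne_zero j)).1 hj
    refine ⟨j, ?_, y, ⟨?_, ?_⟩, l, hl⟩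
    · have : ⌈y / (Real.pi / r)⌉₊ ≤ 2 * r := Nat.ceil_le.2 ((div_le_iff₀ hβ).2 (h2 ▸ hy.2))
      omega
    · rw [Nat.succ_sub_one, lt_div_iff₀ hβ] at h3
      exact h3
    · rw [div_le_iff₀ hβ] at h4
      exact_mod_cast h4
  · obtain ⟨y, hy, l, hl⟩ := exists_mod_two_pi_Ico x
    have hy0 : 0 ≤ y / (Real.pi / r) := div_nonneg hy.1 hβ.le
    refine ⟨⌊y / (Real.pi / r)⌋₊, ?_, y, ⟨?_, ?_⟩, l, hl⟩
    · exact (Nat.floor_lt hy0).2 ((div_lt_iff₀ hβ).2 (h2 ▸ hy.2))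
    · exact (le_div_iff₀ hβ).1 (Nat.floor_le hy0)
    · exact (div_lt_iff₀ hβ).1 (Nat.lt_floor_add_one _)

theorem IsRotationForm.hasUltimateSign_sWord {P Q : RatFunc ℝ} {k r : ℕ} {δ : ℕ → ℝ}
    {W : ℕ → (ℝ × ℝ →ₗ[ℝ] ℂ)} {C : ℝ} {a N : ℕ}
    (h : IsRotationForm P Q (k * (Real.pi / r)) δ W C a N) (hr : 2 ≤ r) {v : ℝ × ℝ} {j : ℕ}
    (h1 : ∀ᶠ n in atTop, 0 < (W n v * cis (-(j * (Real.pi / r)))).im)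
    (h2 : ∀ᶠ n in atTop, (W n v * cis (-((j + 1) * (Real.pi / r)))).im < 0) :
    HasUltimateSign (fun n => sol P Q n v) (sWord k r j) := by
  rw [HolonomicSign.hasUltimateSign_sWord (by omega)]
  filter_upwards [h1, h2] with n h3 h4
  have h5 := sign_im_of_sector hr h3 h4 (n * k)
  rw [h.sign_eq, ← mul_assoc, ← Nat.cast_mul, h5, ellSign]
  push_cast
  ring_nf

theorem IsRotationForm.hasUltimateSign_tWord {P Q : RatFunc ℝ} {k r : ℕ} {δ : ℕ → ℝ}
    {W : ℕ → (ℝ × ℝ →ₗ[ℝ] ℂ)} {C : ℝ} {a N : ℕ}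
    (h : IsRotationForm P Q (k * (Real.pi / r)) δ W C a N) (hr : 0 < r) {v : ℝ × ℝ} {j : ℕ}
    (h1 : ∀ᶠ n in atTop, W n v = cis (j * (Real.pi / r))) :
    HasUltimateSign (fun n => sol P Q n v) (tWord k r j) := by
  rw [HolonomicSign.hasUltimateSign_tWord hr]
  filter_upwards [h1] with n h3
  have hr0 : (r : ℝ) ≠ 0 := by positivity
  rw [h.sign_eq, h3, ← cis_add, cis_im, ellSign]
  congr 2
  push_cast
  field_simp
  ring

theorem cis_eq_mk (ψ : ℝ) : (⟨Real.cos ψ, Real.sin ψ⟩ : ℂ) = cis ψ :=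
  Complex.ext (cis_re ψ).symm (cis_im ψ).symm

theorem eventually_im_pos {w : ℕ → ℂ} {ψ t : ℝ} (hw : Tendsto w atTop (𝓝 (cis ψ))) (h0 : t < ψ)
    (h1 : ψ < t + Real.pi) : ∀ᶠ n in atTop, 0 < (w n * cis (-t)).im := by
  have h2 : Tendsto (fun n => (w n * cis (-t)).im) atTop (𝓝 (cis ψ * cis (-t)).im) :=
    (Complex.continuous_im.tendsto _).comp (hw.mul_const _)
  refine h2.eventually_const_lt ?_
  rw [← cis_add, cis_im]
  exact Real.sin_pos_of_pos_of_lt_pi (by linarith) (by linarith)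

theorem eventually_im_neg {w : ℕ → ℂ} {ψ t : ℝ} (hw : Tendsto w atTop (𝓝 (cis ψ))) (h0 : ψ < t)
    (h1 : t < ψ + Real.pi) : ∀ᶠ n in atTop, (w n * cis (-t)).im < 0 := by
  have h2 : Tendsto (fun n => (w n * cis (-t)).im) atTop (𝓝 (cis ψ * cis (-t)).im) :=
    (Complex.continuous_im.tendsto _).comp (hw.mul_const _)
  refine h2.eventually_lt_const ?_
  rw [← cis_add, cis_im]
  exact Real.sin_neg_of_neg_of_neg_pi_lt (by linarith) (by linarith)

theorem cis_two_mul_rat {k r : ℕ} (hr : 0 < r) :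
    cis ((r : ℕ) * (2 * (k * (Real.pi / r)))) = 1 := by
  have hr0 : (r : ℝ) ≠ 0 := by positivity
  rw [show (r : ℝ) * (2 * (k * (Real.pi / r))) = (k : ℤ) * (2 * Real.pi) by
    push_cast; field_simp]
  exact cis_int_mul_two_pi k

/-- The coordinates are those of the limit of `W n`, and the arcs are the sectors of angle `π/r`.
For `δ > 0` the rotation is anticlockwise, so a limit on a ray is approached from below and the ray
belongs to the sector that ends there; for `δ < 0` it belongs to the one that starts there. -/
theorem elliptic_nonconstant {P Q : RatFunc ℝ} (hP : P ≠ 0) (hQ : NoZerosOrPoles Q)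
    (hpos : RatHasUltimateSign P [1]) {k r : ℕ} (hk : 0 < k) (hr : 0 < r) (hkr : Nat.Coprime k r)
    (h : IsOElliptic P Q ((k : ℚ) / (r : ℚ))) (hc : ¬ IsConstant (normQ P Q)) :
    PartitionsCircle (sSets P Q k r) ∧ ArrangedInOrder (sSets P Q k r) ∧
      (∀ j, IsHalfOpenArc (sSets P Q k r j)) ∧
      ∀ j j' : Fin (2 * r), (j' : ℕ) = ((j : ℕ) + 1) % (2 * r) →
        ∃ v : ℝ × ℝ, closure (sSets P Q k r j) ∩ closure (sSets P Q k r j') = {v} ∧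
          (EventuallyIncreasing (normQ P Q) → v ∈ sSets P Q k r j') ∧
          (EventuallyDecreasing (normQ P Q) → v ∈ sSets P Q k r j) := by
  obtain ⟨hr2, δ, W, C, a, N, hform, hsum, -, hnc⟩ :=
    exists_rotationForm_of_isOElliptic hP hQ hpos hk hr hkr h
  obtain ⟨hratio, hinc, hdec⟩ := hnc hc
  have hδ0 : Tendsto δ atTop (𝓝 0) :=
    (tendsto_zero_iff_abs_tendsto_zero _).2 hsum.tendsto_atTop_zero
  obtain ⟨σ, hσ, hσδ⟩ := exists_sign_of_ratio hratio
  obtain ⟨M, hM, hlim⟩ := hform.exists_limit hsum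
  have hpi := Real.pi_pos
  have hr0 : (0 : ℝ) < r := by exact_mod_cast hr
  have hr2' : (2 : ℝ) ≤ r := by exact_mod_cast hr2
  set β := Real.pi / r with hβdef
  have hβ : 0 < β := by positivity
  have hβr : 2 * Real.pi = 2 * r * β := by rw [hβdef]; field_simp
  have hβ2 : 2 * β ≤ Real.pi := by nlinarith
  obtain ⟨ε, hε, T, hT, hpI, hpart⟩ := partition_of_classification (P := P) (Q := Q) hM
    (m := 2 * r) (fun j => sWord k r j) (fun j => halfOpen σ (j * β) ((j + 1) * β))
    (fun j x hx v hv => by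
      have hw := hlim v
      rw [hv, cis_eq_mk] at hw
      have hside := hform.exists_side hδ0 hratio hr (cis_two_mul_rat hr) hσ hσδ (cis_ne_zero x) hw
      rw [conj_cis] at hside
      rcases hσ with rfl | rfl
      · rw [halfOpen, if_pos rfl] at hx
        refine hform.hasUltimateSign_sWord hr2 (eventually_im_pos hw hx.1 (by linarith [hx.2])) ?_
        rcases hx.2.eq_or_lt with h1 | h1
        · filter_upwards [hside] with n hn
          rwa [one_mul, h1] at hn
        · exact eventually_im_neg hw h1 (by linarith [hx.1])
      · rw [halfOpen, if_neg (by norm_num)] at hx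
        refine hform.hasUltimateSign_sWord hr2 ?_ (eventually_im_neg hw hx.2 (by linarith [hx.1]))
        rcases hx.1.eq_or_lt with h1 | h1
        · filter_upwards [hside] with n hn
          rw [neg_one_mul, neg_lt_zero, ← h1] at hn
          exact hn
        · exact eventually_im_pos hw h1 (by linarith [hx.2]))
    (fun x => by
      obtain ⟨j, hj, hy⟩ := exists_mem_halfOpen hr σ x
      exact ⟨⟨j, hj⟩, hy⟩)
    (fun i j hij f hi hj => by
      rw [hasUltimateSign_sWord hr] at hi hj
      have := ellSign_eq_of_frequently hkr hr2 (y := 2 * i + 1) (y' := 2 * j + 1)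
        (by rw [abs_lt]; omega) (by
          filter_upwards [hi, hj] with n h1 h2
          rw [← h1, h2])
      exact hij (Fin.ext (by omega)))
  have hsets : ∀ j : Fin (2 * r), sSets P Q k r j = arcMap ε T '' halfOpen σ (j * β) ((j + 1) * β) :=
    hpI
  refine ⟨hpart, arrangedInOrder_arcMap hε hT hsets ?_ ?_, fun j => ?_, fun j j' hj' => ?_⟩
  · intro i j hij x hx y hy
    refine halfOpen_lt ?_ hx hy
    have : ((i : ℕ) : ℝ) + 1 ≤ (j : ℕ) := by exact_mod_cast hij
    exact mul_le_mul_of_nonneg_right this hβ.le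
  · intro i j x hx y hy
    have h1 : y ∈ halfOpen σ ((j : ℕ) * β) (((j : ℕ) + 1) * β) := hy
    have h2 : x + 2 * Real.pi ∈ halfOpen σ ((i : ℕ) * β + 2 * Real.pi) (((i : ℕ) + 1) * β + 2 * Real.pi) := by
      rw [← halfOpen_add]
      exact ⟨x, hx, rfl⟩
    refine halfOpen_lt ?_ h1 h2
    have h3 : ((j : ℕ) : ℝ) + 1 ≤ 2 * r := by exact_mod_cast j.2
    have h4 := mul_le_mul_of_nonneg_right h3 hβ.le
    have : 0 ≤ ((i : ℕ) : ℝ) * β := by positivity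
    linarith
  · rw [hsets]
    exact isHalfOpenArc_arcMap_halfOpen hε hT (by linarith) (by linarith)
  -- The successor of the last interval is the first one, shifted by a full turn.
  · have hset' : sSets P Q k r j' = arcMap ε T '' halfOpen σ ((j + 1) * β) ((j + 1 + 1) * β) := by
      rw [hsets]
      rcases (show (j : ℕ) + 1 ≤ 2 * r from j.2).lt_or_eq with h1 | h1
      · rw [Nat.mod_eq_of_lt h1] at hj'
        rw [hj']
        push_cast
        rfl
      · have h2 : ((j : ℕ) : ℝ) + 1 = 2 * r := by exact_mod_cast h1
        rw [h1, Nat.mod_self] at hj'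
        rw [hj', h2, show 2 * (r : ℝ) * β = ((0 : ℕ) : ℝ) * β + 2 * Real.pi by rw [hβr]; simp,
          show (2 * (r : ℝ) + 1) * β = (((0 : ℕ) : ℝ) + 1) * β + 2 * Real.pi by
            rw [hβr]; push_cast; ring, arcMap_image_halfOpen_add hε hT]
    refine ⟨arcMap ε T ((j + 1) * β), ?_, fun hi => ?_, fun hd => ?_⟩
    · rw [hset', hsets, closure_arcMap_image ε T (closure_halfOpen (by linarith)),
        closure_arcMap_image ε T (closure_halfOpen (by linarith))]
      exact arcMap_Icc_inter hε hT (by linarith) (by linarith) (by linarith)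
    · rw [hset']
      obtain ⟨n, h1, h2⟩ := ((hinc hi).and hσδ).exists
      have h3 : σ ≠ 1 := by
        rintro rfl
        linarith
      refine ⟨_, ?_, rfl⟩
      rw [halfOpen, if_neg h3]
      exact ⟨le_rfl, by linarith⟩
    · rw [hsets]
      obtain ⟨n, h1, h2⟩ := ((hdec hd).and hσδ).exists
      have h3 : σ = 1 := by
        refine hσ.resolve_right ?_
        rintro rfl
        linarith
      refine ⟨_, ?_, rfl⟩
      rw [halfOpen, if_pos h3]
      exact ⟨by linarith, le_rfl⟩

/-- The words `t_0, s_0, t_1, s_1, …`. -/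
def tsWord (k r i : ℕ) : List SignType := if i % 2 = 0 then tWord k r (i / 2) else sWord k r (i / 2)

/-- The degenerate intervals `{0}`, `(0, β)`, `{β}`, `(β, 2 β)`, …. -/
def tsInterval (β : ℝ) (i : ℕ) : Set ℝ :=
  if i % 2 = 0 then {((i / 2 : ℕ) : ℝ) * β} else
    Set.Ioo (((i / 2 : ℕ) : ℝ) * β) ((((i / 2 : ℕ) : ℝ) + 1) * β)

theorem hasUltimateSign_tsWord {k r : ℕ} (hr : 0 < r) (i : ℕ) (f : ℕ → ℝ) :
    HasUltimateSign f (tsWord k r i) ↔ ∀ᶠ n in atTop, SignType.sign (f n) = ellSign k r i n := by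
  rw [tsWord]
  split_ifs with h
  · rw [hasUltimateSign_tWord hr, show (2 * (i / 2 : ℕ) : ℤ) = i by omega]
  · rw [hasUltimateSign_sWord hr, show (2 * (i / 2 : ℕ) + 1 : ℤ) = i by omega]

theorem tsInterval_lt {β : ℝ} (hβ : 0 < β) {i j : ℕ} (hij : i < j) {x y : ℝ}
    (hx : x ∈ tsInterval β i) (hy : y ∈ tsInterval β j) : x < y := by
  have hle : ∀ {a b : ℕ}, a ≤ b → (a : ℝ) * β ≤ b * β := fun h =>
    mul_le_mul_of_nonneg_right (by exact_mod_cast h) hβ.le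
  have hle' : ∀ {a b : ℕ}, a < b → ((a : ℝ) + 1) * β ≤ b * β := fun h =>
    mul_le_mul_of_nonneg_right (by exact_mod_cast h) hβ.le
  rw [tsInterval] at hx hy
  split_ifs at hx hy with h1 h2 h2
  · rw [Set.mem_singleton_iff.1 hx, Set.mem_singleton_iff.1 hy]
    have := hle' (show i / 2 < j / 2 by omega)
    linarith
  · rw [Set.mem_singleton_iff.1 hx]
    exact (hle (show i / 2 ≤ j / 2 by omega)).trans_lt hy.1
  · rw [Set.mem_singleton_iff.1 hy]
    exact hx.2.trans_le (hle' (show i / 2 < j / 2 by omega))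
  · exact (hx.2.trans_le (hle' (show i / 2 < j / 2 by omega))).trans hy.1

theorem mem_Ico_of_mem_tsInterval {β : ℝ} (hβ : 0 < β) {r i : ℕ} (hi : i < 4 * r) {x : ℝ}
    (hx : x ∈ tsInterval β i) : x ∈ Set.Ico 0 (2 * r * β) := by
  have h1 : ((i / 2 : ℕ) : ℝ) + 1 ≤ 2 * r := by exact_mod_cast (show i / 2 + 1 ≤ 2 * r by omega)
  have h2 := mul_le_mul_of_nonneg_right h1 hβ.le
  have h3 : 0 ≤ ((i / 2 : ℕ) : ℝ) * β := by positivity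
  rw [tsInterval] at hx
  split_ifs at hx
  · rw [Set.mem_singleton_iff.1 hx]
    exact ⟨h3, by linarith⟩
  · exact ⟨h3.trans hx.1.le, hx.2.trans_le h2⟩

/-- Here `δ = 0`, so `W n` is eventually equal to its limit. A limit on a ray stays there and
produces the zeros of `t_j`. -/
theorem elliptic_constant {P Q : RatFunc ℝ} (hP : P ≠ 0) (hQ : NoZerosOrPoles Q)
    (hpos : RatHasUltimateSign P [1]) {k r : ℕ} (hk : 0 < k) (hr : 0 < r) (hkr : Nat.Coprime k r)
    (h : IsOElliptic P Q ((k : ℚ) / (r : ℚ))) (hc : IsConstant (normQ P Q)) :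
    PartitionsCircle (tsSets P Q k r) ∧ ArrangedInOrder (tsSets P Q k r) ∧
      ∀ j < 2 * r, IsSingleton (pI P Q (tWord k r j)) ∧ IsOpenArc (pI P Q (sWord k r j)) := by
  obtain ⟨hr2, δ, W, C, a, N, hform, hsum, hδ, -⟩ :=
    exists_rotationForm_of_isOElliptic hP hQ hpos hk hr hkr h
  obtain ⟨M, hM, hlim⟩ := hform.exists_limit hsum
  have hpi := Real.pi_pos
  have hr0 : (0 : ℝ) < r := by exact_mod_cast hr
  have hr2' : (2 : ℝ) ≤ r := by exact_mod_cast hr2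
  set β := Real.pi / r with hβdef
  have hβ : 0 < β := by positivity
  have hβr : 2 * Real.pi = 2 * r * β := by rw [hβdef]; field_simp
  have hβ2 : 2 * β ≤ Real.pi := by nlinarith
  have hconst : ∀ v x, M v = (Real.cos x, Real.sin x) → ∀ᶠ n in atTop, W n v = cis x := fun v x hv => by
    have hWN : ∀ n ≥ N, W n v = W N v := fun n hn => by
      induction n, hn using Nat.le_induction with
      | base => rfl
      | succ n hn ih => rw [hform.step n hn, hδ hc, Complex.ofReal_zero, zero_mul, add_zero, ih]
    have hw := hlim v
    rw [hv, cis_eq_mk] at hw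
    have he : (fun n => W n v) =ᶠ[atTop] fun _ => W N v :=
      (eventually_ge_atTop N).mono fun n hn => hWN n hn
    rw [tendsto_nhds_unique hw ((tendsto_congr' he).2 tendsto_const_nhds)]
    exact he
  obtain ⟨ε, hε, T, hT, hpI, hpart⟩ := partition_of_classification (P := P) (Q := Q) hM
    (m := 4 * r) (fun i => tsWord k r i) (fun i => tsInterval β i)
    (fun i x hx v hv => by
      have hw := hconst v x hv
      have ht := tendsto_nhds_of_eventually_eq hw
      simp only [tsWord]
      rw [tsInterval] at hx
      split_ifs at hx ⊢
      · rw [Set.mem_singleton_iff.1 hx] at hw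
        exact hform.hasUltimateSign_tWord hr hw
      · exact hform.hasUltimateSign_sWord hr2 (eventually_im_pos ht hx.1 (by linarith [hx.2]))
          (eventually_im_neg ht hx.2 (by linarith [hx.1])))
    (fun x => by
      obtain ⟨j, hj, y, hy, l, hl⟩ := exists_mem_halfOpen hr 0 x
      rw [halfOpen, if_neg zero_ne_one] at hy
      rcases hy.1.eq_or_lt with h1 | h1
      · refine ⟨⟨2 * j, by omega⟩, y, ?_, l, hl⟩
        simp only [tsInterval]
        rw [if_pos (by omega), show 2 * j / 2 = j by omega]
        exact h1.symm
      · refine ⟨⟨2 * j + 1, by omega⟩, y, ?_, l, hl⟩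
        simp only [tsInterval]
        rw [if_neg (by omega), show (2 * j + 1) / 2 = j by omega]
        exact ⟨h1, hy.2⟩)
    (fun i j hij f hi hj => by
      rw [hasUltimateSign_tsWord hr] at hi hj
      have := ellSign_eq_of_frequently hkr hr2 (y := (i : ℕ)) (y' := (j : ℕ))
        (by rw [abs_lt]; omega) (by
          filter_upwards [hi, hj] with n h1 h2
          rw [← h1, h2])
      exact hij (Fin.ext (by omega)))
  have hsets : ∀ i, tsSets P Q k r i = pI P Q (tsWord k r i) := fun i => by
    rw [tsSets, tsWord, apply_ite (pI P Q)]
  refine ⟨by rwa [funext hsets], arrangedInOrder_arcMap hε hT (fun i => (hsets i).trans (hpI i)) ?_ ?_,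
    fun j hj => ⟨?_, ?_⟩⟩
  · exact fun i j hij x hx y hy => tsInterval_lt hβ hij hx hy
  · intro i j x hx y hy
    have h1 := (mem_Ico_of_mem_tsInterval hβ i.2 hx).1
    have h2 := (mem_Ico_of_mem_tsInterval hβ j.2 hy).2
    linarith
  · have h1 := hpI ⟨2 * j, by omega⟩
    simp only [tsWord, tsInterval] at h1
    rw [if_pos (by omega), if_pos (by omega), show 2 * j / 2 = j by omega, Set.image_singleton] at h1
    exact ⟨_, h1⟩
  · have h1 := hpI ⟨2 * j + 1, by omega⟩
    simp only [tsWord, tsInterval] at h1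
    rw [if_neg (by omega), if_neg (by omega), show (2 * j + 1) / 2 = j by omega] at h1
    rw [h1]
    exact isOpenArc_arcMap hε hT (by linarith) (by linarith)

/-! ### Elliptic types without ultimate signs -/

theorem not_hasUltimateSign_of_degree {P Q : RatFunc ℝ} (hP : P ≠ 0) (hQ : NoZerosOrPoles Q)
    (hpos : RatHasUltimateSign P [1]) (hneg : RatHasUltimateSign (normQ P Q) [-1])
    (h0 : 0 < (normQ P Q).intDegree) (h2 : (normQ P Q).intDegree ≤ 2) {v : ℝ × ℝ} (hv : v ≠ 0)
    (s : List SignType) : ¬ HasUltimateSign (fun n => sol P Q n v) s := by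
  have hR0 := normQ_ne_zero hP (ne_zero_of_noZerosOrPoles hQ)
  obtain ⟨b, hb, hbR, hb2⟩ := exists_balanced hR0
  obtain ⟨W, N, hform⟩ := exists_rotationForm_of_pos_degree hP hQ hpos hneg hb hbR
  obtain ⟨c, hc, hlow⟩ := balanced_lower_bound hR0 h2 hb hb2
  refine hform.no_sign_of_divergent (balanced_tendsto_zero hR0 h0 hb2)
    (tendsto_balanced_ratio hb hbR hb2) hc ?_ (T₀ := 4) (by norm_num) ?_ hv s
  · simpa only [abs_of_pos (hb _)] using hlow
  · rw [show ((4 : ℕ) : ℝ) * (Real.pi / 2) = (1 : ℤ) * (2 * Real.pi) by push_cast; ring]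
    exact cis_int_mul_two_pi 1

theorem HasExpansion.exists_lower_bound {R : RatFunc ℝ} {α₀ α₁ α₂ : ℝ} (h : HasExpansion R α₀ α₁ α₂)
    (hα : α₁ ≠ 0) : ∃ c > 0, ∀ᶠ n : ℕ in atTop, c / (n : ℝ) ≤ |val R n - α₀| := by
  obtain ⟨K, hK, hb⟩ := h.exists_bound
  have hα' := abs_pos.2 hα
  refine ⟨|α₁| / 2, by positivity, ?_⟩
  have t1 : Tendsto (fun n : ℕ => (|α₂| + K) / (n : ℝ)) atTop (𝓝 0) :=
    tendsto_const_div_atTop_nhds_zero_nat _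
  filter_upwards [hb, t1.eventually_lt_const (half_pos hα'), eventually_ge_atTop 1] with n h1 h2 hn
  have hn1 : (1 : ℝ) ≤ n := by exact_mod_cast hn
  have hn0 : (0 : ℝ) < n := by linarith
  have h3 : |α₁| / n ≤ |val R n - α₀| + |α₂| / (n : ℝ) ^ 2 + K / (n : ℝ) ^ 3 := by
    calc |α₁| / n = |α₁ / n| := by rw [abs_div, abs_of_pos hn0]
      _ = |(val R n - α₀) + -(α₂ / (n : ℝ) ^ 2) + -(val R n - (α₀ + α₁ / n + α₂ / (n : ℝ) ^ 2))| := by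
        congr 1; ring
      _ ≤ _ := (abs_add_three _ _ _).trans (by
        rw [abs_neg, abs_neg, abs_div α₂, abs_of_pos (show 0 < (n : ℝ) ^ 2 by positivity)]
        gcongr)
  have h4 : |α₂| / (n : ℝ) ^ 2 + K / (n : ℝ) ^ 3 ≤ (|α₂| + K) / n / n := by
    have : K / (n : ℝ) ^ 3 ≤ K / (n : ℝ) ^ 2 := by
      gcongr
      norm_num
    rw [div_div, ← sq, add_div]
    linarith
  have h5 : (|α₂| + K) / n / n ≤ |α₁| / 2 / n := by gcongr
  have h6 : |α₁| / n = |α₁| / 2 / n + |α₁| / 2 / n := by ring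
  linarith

theorem rational_of_cis_eq_one {θ : ℝ} (hθ : 0 ≤ θ) {τ : ℕ} (hτ : 0 < τ)
    (h : cis (2 * (τ * (θ * Real.pi))) = 1) : ∃ q : ℚ, 0 ≤ q ∧ θ = q := by
  rw [cis, Complex.exp_eq_one_iff] at h
  obtain ⟨l, hl⟩ := h
  have h1 : 2 * (τ * (θ * Real.pi)) = l * (2 * Real.pi) := by
    have := congrArg Complex.im hl
    simpa using this
  have hτ0 : (τ : ℝ) ≠ 0 := by positivity
  have h2 : θ = ((l / τ : ℚ) : ℝ) := by
    push_cast
    rw [eq_div_iff hτ0]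
    have hp := Real.pi_pos.ne'
    apply mul_right_cancel₀ (mul_ne_zero two_ne_zero hp)
    linarith
  exact ⟨_, by rw [h2] at hθ; exact_mod_cast hθ, h2⟩

/-- For `d = 1, 2` the rotation `δ = b` diverges relative to a quarter-turn frame. For `d ≤ 0` there
are three cases: `θ = 0` is parabolic; rational `θ > 0` forces `α₁ ≠ 0`, so `δ = R - α₀` is at least
of order `1/n`; for irrational `θ` the frame alone produces both signs. -/
theorem qOmega_elliptic {P Q : RatFunc ℝ} (hP : P ≠ 0) (hQ : NoZerosOrPoles Q)
    (hpos : RatHasUltimateSign P [1]) (h : IsQOmegaElliptic P Q) {v : ℝ × ℝ} (hv : v ≠ 0)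
    (s : List SignType) : ¬ HasUltimateSign (fun n => sol P Q n v) s := by
  have hpi := Real.pi_pos
  obtain ⟨hneg, h1 | h2 | ⟨-, α₀, α₁, α₂, hexp, hlex, θ, hθ0, hθ1, hα₀, hθ⟩⟩ := h
  · exact not_hasUltimateSign_of_degree hP hQ hpos hneg (by omega) (by omega) hv s
  · exact not_hasUltimateSign_of_degree hP hQ hpos hneg (by omega) (by omega) hv s
  rcases hθ0.eq_or_lt with rfl | hθ0
  · have h4 : α₀ = -(1 / 4) := by rw [hα₀]; simp
    subst h4
    refine no_sign_of_parabolic hP hQ hpos hexp ?_ hv s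
    rw [lexGe_iff] at hlex
    push Not at hlex
    rcases lt_trichotomy α₁ 0 with h5 | h5 | h5
    · exact Or.inl h5
    · exact Or.inr ⟨h5, (hlex.2 rfl).2 h5⟩
    · exact absurd (hlex.2 rfl).1 (not_le.2 h5)
  · obtain ⟨W, C, N, hform⟩ := exists_rotationForm_of_lt hP hQ hpos
      (θ := θ * Real.pi) (by positivity) (by nlinarith)
    have hδ : (fun n : ℕ => val (normQ P Q) n + 1 / (4 * Real.cos (θ * Real.pi) ^ 2)) =
        fun n : ℕ => val (normQ P Q) n - α₀ := by
      funext n; rw [hα₀]; ring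
    rw [hδ] at hform
    have hδ0 : Tendsto (fun n : ℕ => val (normQ P Q) n - α₀) atTop (𝓝 0) := by
      simpa using (tendsto_expansion hexp).sub_const α₀
    by_cases hq : ∃ q : ℚ, 0 < q ∧ θ = q
    · have hα₁ : α₁ ≠ 0 := fun h => hθ ⟨hq, h⟩
      obtain ⟨q, hq0, rfl⟩ := hq
      obtain ⟨c, hc, hlow⟩ := hexp.exists_lower_bound hα₁
      refine hform.no_sign_of_divergent hδ0 (tendsto_ratio_sub_const fun hR => ?_) hc hlow
        (T₀ := 2 * q.den) (by have := q.den_pos; omega) ?_ hv s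
      · obtain ⟨n, h1, h2⟩ := (hlow.and (eventually_gt_atTop 0)).exists
        rw [hR, val_C, sub_self, abs_zero] at h1
        have : (0 : ℝ) < n := by exact_mod_cast h2
        exact absurd (by positivity : 0 < c / (n : ℝ)) (not_lt.2 h1)
      · have h1 : (q : ℝ) * q.den = q.num := by exact_mod_cast q.mul_den_eq_num
        rw [show ((2 * q.den : ℕ) : ℝ) * (q * Real.pi) = q.num * (2 * Real.pi) by
          rw [← h1]; push_cast; ring]
        exact cis_int_mul_two_pi _
    · refine hform.no_sign_of_irrational hδ0 (fun τ hτ h => ?_) hv s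
      obtain ⟨q, hq0, rfl⟩ := rational_of_cis_eq_one hθ0.le hτ h
      exact hq ⟨q, by exact_mod_cast hθ0, rfl⟩

end HolonomicSign

end

/-! ### The five types together. -/

theorem mainTheorem1 (P Q : RatFunc ℝ)
    (hP : HolonomicSign.NoZerosOrPoles P) (hQ : HolonomicSign.NoZerosOrPoles Q)
    (hpos : HolonomicSign.RatHasUltimateSign P [1]) :
    -- the type `∞-O` loxodromic
    (HolonomicSign.IsInftyOLoxodromic P Q →
      HolonomicSign.PartitionsCircle
        ![HolonomicSign.pI P Q [1, -1], HolonomicSign.pI P Q [-1, 1],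
          HolonomicSign.pI P Q [1], HolonomicSign.pI P Q [-1]] ∧
      HolonomicSign.IsClosedArc (HolonomicSign.pI P Q [1, -1]) ∧
      HolonomicSign.IsClosedArc (HolonomicSign.pI P Q [-1, 1]) ∧
      HolonomicSign.IsOpenArc (HolonomicSign.pI P Q [1]) ∧
      HolonomicSign.IsOpenArc (HolonomicSign.pI P Q [-1])) ∧
    -- the type `∞-Ω` loxodromic
    (HolonomicSign.IsInftyOmegaLoxodromic P Q →
      HolonomicSign.PartitionsCircle
        ![HolonomicSign.pI P Q [1, -1], HolonomicSign.pI P Q [-1, 1],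
          HolonomicSign.pI P Q [1], HolonomicSign.pI P Q [-1]] ∧
      HolonomicSign.IsSingleton (HolonomicSign.pI P Q [1, -1]) ∧
      HolonomicSign.IsSingleton (HolonomicSign.pI P Q [-1, 1]) ∧
      HolonomicSign.IsOpenArc (HolonomicSign.pI P Q [1]) ∧
      HolonomicSign.IsOpenArc (HolonomicSign.pI P Q [-1])) ∧
    -- the hyperbolic type
    (HolonomicSign.IsHyperbolic P Q →
      HolonomicSign.PartitionsCircle
        ![HolonomicSign.pI P Q [1], HolonomicSign.pI P Q [-1]] ∧
      HolonomicSign.IsHalfOpenArc (HolonomicSign.pI P Q [1]) ∧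
      HolonomicSign.IsHalfOpenArc (HolonomicSign.pI P Q [-1])) ∧
    -- the type `k/r-O` elliptic
    (∀ k r : ℕ, 0 < k → 0 < r → Nat.Coprime k r →
      HolonomicSign.IsOElliptic P Q ((k : ℚ) / (r : ℚ)) →
      (HolonomicSign.IsConstant (HolonomicSign.normQ P Q) →
        HolonomicSign.PartitionsCircle (HolonomicSign.tsSets P Q k r) ∧
        HolonomicSign.ArrangedInOrder (HolonomicSign.tsSets P Q k r) ∧
        ∀ j < 2 * r,
          HolonomicSign.IsSingleton (HolonomicSign.pI P Q (HolonomicSign.tWord k r j)) ∧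
          HolonomicSign.IsOpenArc (HolonomicSign.pI P Q (HolonomicSign.sWord k r j))) ∧
      (¬ HolonomicSign.IsConstant (HolonomicSign.normQ P Q) →
        HolonomicSign.PartitionsCircle (HolonomicSign.sSets P Q k r) ∧
        HolonomicSign.ArrangedInOrder (HolonomicSign.sSets P Q k r) ∧
        (∀ j, HolonomicSign.IsHalfOpenArc (HolonomicSign.sSets P Q k r j)) ∧
        -- for cyclically consecutive `j`, `j'`, the common boundary point of the two intervals
        ∀ j j' : Fin (2 * r), (j' : ℕ) = ((j : ℕ) + 1) % (2 * r) →
          ∃ v : ℝ × ℝ,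
            closure (HolonomicSign.sSets P Q k r j) ∩ closure (HolonomicSign.sSets P Q k r j') = {v} ∧
            (HolonomicSign.EventuallyIncreasing (HolonomicSign.normQ P Q) →
              v ∈ HolonomicSign.sSets P Q k r j') ∧
            (HolonomicSign.EventuallyDecreasing (HolonomicSign.normQ P Q) →
              v ∈ HolonomicSign.sSets P Q k r j))) ∧
    -- the type `ℚ-Ω` elliptic
    (HolonomicSign.IsQOmegaElliptic P Q →
      ∀ f : ℕ → ℝ, HolonomicSign.IsHolonomic P Q f → f ≠ 0 →
        ∀ s : List SignType, ¬ HolonomicSign.HasUltimateSign f s) := by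
  have hP0 := HolonomicSign.ne_zero_of_noZerosOrPoles hP
  refine ⟨HolonomicSign.inftyO_loxodromic hP0 hQ hpos,
    HolonomicSign.inftyOmega_loxodromic hP0 hQ hpos, HolonomicSign.hyperbolic hP0 hQ hpos,
    fun k r hk hr hkr h => ⟨HolonomicSign.elliptic_constant hP0 hQ hpos hk hr hkr h,
      HolonomicSign.elliptic_nonconstant hP0 hQ hpos hk hr hkr h⟩, fun h f hf hf0 s hs => ?_⟩
  have hfun : f = fun n => HolonomicSign.sol P Q n (f 0, f 1) := funext hf.eq_sol
  refine HolonomicSign.qOmega_elliptic hP0 hQ hpos h (v := (f 0, f 1)) (fun h0 => hf0 ?_) s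
    (hfun ▸ hs)
  rw [hfun, h0]
  funext n
  exact map_zero _
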